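/- **Conventions.** Manifolds are smooth, finite-dimensional and Hausdorff; $G$ is a second countable Lie group; $k$ is a fixed natural number. An exterior differential system (EDS) $(M,\mathcal I)$ is a manifold with homogeneous ideals $\mathcal I_x\subset\bigwedge T_x^*M$ without degree-$0$ part, such that the sections $\Gamma(\mathcal I)$ are closed under $d$ and $\mathcal I$ is a vector subbundle off a closed set of measure zero. An *integral element* at $x$ is a $k$-plane $P\subset T_xM$ with $\mathcal I_x|_P=0$. The *prolongation* $(M,\mathcal I)^{(1)}$ is the manifold $M^{(1)}\subset J^1_kM$ of all integral elements, from which a relatively closed set may have been removed; $M^{(1)}$ is assumed to be an embedded submanifold of the bundle $J^1_kM$ of $k$-planes, and $\pi:M^{(1)}\to M$ to be a surjective submersion (e.g. a fibre bundle). Its ideal $\mathcal I^{(1)}$ is the contact ideal, generated by the forms $\theta$ and $d\theta$, where $\theta$ is a $1$-form that annihilates $d\pi^{-1}(P)$ at each point $P\in M^{(1)}$. Iteration gives $\mathcal E^{(r)}=(M^{(r)},\mathcal I^{(r)})$. A first-order PDE system on $B$ is a submanifold $\bar\Delta\subset J^1_kB$ that submerses onto $B$, with the restricted contact ideal $\mathcal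 C^{(1)}|_{\bar\Delta}$. If $G$ acts on an invariant open set $U\subset M$ of a $G$-invariant system $(M,\mathcal I)$ so that $U/G$ is a (Hausdorff) manifold for which $\mathfrak p:U\to U/G$ is a submersion, then the *reduced system* is $(U/G,\bar{\mathcal I})$, where $\bar{\mathcal I}$ is the largest ideal with $\mathfrak p^*\bar{\mathcal I}_{\mathfrak p(x)}\subset\mathcal I_x$ for all $x\in U$. **Assumptions.** $\mathcal E=(M,\mathcal I)$ is a $G$-invariant EDS with prolongations $\mathcal E^{(r)}$, on which $G$ acts by the prolonged smooth action. 1. $\mathcal E$ is of infinite type: $\dim M^{(r)}>\dim M^{(r-1)}$ for all $r>1$. 2. There are an integer $r_s$ and a closed $G$-invariant set $X\subset M^{(r_s)}$ of measure zero such that $G$ acts freely on $M^{(r_s)}\setminus X$. 3. $(M^{(r_s)}\setminus X)/G$ is a manifold, with submersive projection. 4. There is an integer $r_{cf}$ such that for every $s\ge r_{cf}$ an invariant horizontal coframe of order $s$ exists at almost every point $P$ of $M^{(s+1)}$: on an invariant open neighbourhood, in $M^{(s)}$, of the base point of the $k$-plane $P$ there are smooth $G$-invariant functions $y^1,\dots,y^k$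 whose differentials restrict to a basis of $P^*$. Put $m=\max(r_s,r_{cf})$. For $r\ge m+1$ let $U_r\subset M^{(r)}$ be the open set of the points that project into $M^{(r_s)}\setminus X$ and to a point of $M^{(m+1)}$ at which an invariant horizontal coframe of order $m$ exists; let $\overline{M^{(r)}}=U_r/G$, and let $\overline{\mathcal E^{(r)}}=(\overline{M^{(r)}},\overline{\mathcal I^{(r)}})$ be the reduced system. **Theorem.** The orbit spaces $\overline{M^{(r)}}$, $r\ge m+1$, are Hausdorff manifolds with submersive projections $U_r\to\overline{M^{(r)}}$, and there is an order $r_o\le\max(r_s,r_{cf})+2$ such that the following hold. (a) For every $r\ge r_o$, reduction of $\mathcal E^{(r)}$ commutes with prolongation, $$\bigl(\overline{\mathcal E^{(r)}}\bigr)^{(1)}=\overline{\mathcal E^{(r+1)}} .$$ That is, the map $P\mapsto d\mathfrak p(P)$ induces an embedding of $\overline{M^{(r+1)}}$ into $J^1_k\overline{M^{(r)}}$, whose image is the set of all integral elements of $\overline{\mathcal E^{(r)}}$ except for the images $d\mathfrak p(P)$ of those integral elements $P$ of $\mathcal E^{(r)}$ at points of $U_r$ that were removed from $M^{(r+1)}$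 (nothing is excepted if nothing was removed), and $\overline{\mathcal I^{(r+1)}}$ is the prolonged ideal. (b) For every $r\ge r_o$, with $r\geq 1$, the map $P\mapsto d\mathfrak p(P)$ induces an embedding $\iota_1:\overline{M^{(r)}}\to J^1_k\overline{M^{(r-1)}}$ whose image is a first-order PDE system $\bar\Delta$ (the syzygies of the differential invariants), with $\overline{\mathcal I^{(r)}}=\iota_1^*\mathcal C^{(1)}$, and $\overline{\mathcal E^{(r+1)}}$ is the prolongation of $(\bar\Delta,\mathcal C^{(1)}|_{\bar\Delta})$. -/

import Mathlib

open scoped Manifold ContDiff Topology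
open TopologicalSpace (Opens)

noncomputable section

namespace EDS

/-! All manifolds are smooth, without boundary, and modelled on `Euc d`. The tangent space of such a
manifold `M` at `x` is, by definition in Mathlib, a copy of `Euc d` (tangent vectors are written in
the preferred chart at `x`), so that a field of tangent subspaces is a map `M → Submodule ℝ (Euc d)`
and a field of alternating forms is a map `M → AltForm d n`. -/

/-- The model space `ℝ^d`. -/
abbrev Euc (d : ℕ) : Type := EuclideanSpace ℝ (Fin d)

/-- Alternating `n`-forms on a `d`-dimensional tangent space. -/
abbrev AltForm (d n : ℕ) : Type := Euc d [⋀^Fin n]→L[ℝ] ℝ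

/-- The wedge product `α ∧ η` of a covector with an alternating `n`-form,
`(α ∧ η)(v₀, …, vₙ) = ∑ᵢ (-1)^i α(vᵢ) η(v₀, …, v̂ᵢ, …, vₙ)`. -/
def wedge {d n : ℕ} (α : Euc d →L[ℝ] ℝ) (η : AltForm d n) : AltForm d (n + 1) :=
  .alternatizeUncurryFin (α.smulRight η)

theorem wedge_comp {d e n : ℕ} (L : Euc e →L[ℝ] Euc d) (α : Euc d →L[ℝ] ℝ) (η : AltForm d n) :
    (wedge α η).compContinuousLinearMap L
      = wedge (α.comp L) (η.compContinuousLinearMap L) := by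
  ext v
  simp only [wedge, ContinuousAlternatingMap.compContinuousLinearMap_apply,
    ContinuousAlternatingMap.alternatizeUncurryFin_apply, ContinuousLinearMap.smulRight_apply,
    ContinuousAlternatingMap.smul_apply, ContinuousLinearMap.comp_apply, Function.comp_apply]
  rfl

/-- A homogeneous ideal of the exterior algebra of a `d`-dimensional cotangent space, given by its
homogeneous components. As the exterior algebra is generated by covectors and is graded commutative,
closure under the wedge product with covectors is the ideal property. -/
@[ext]
structure GradedIdeal (d : ℕ) where
  deg : ∀ n, Submodule ℝ (AltForm d n)
  wedge_mem : ∀ n (α : Euc d →L[ℝ] ℝ) (η : AltForm d n), η ∈ deg n → wedge α η ∈ deg (n + 1)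

/-- The smallest homogeneous ideal that contains the given sets of forms. -/
def GradedIdeal.generate {d : ℕ} (S : ∀ n, Set (AltForm d n)) : GradedIdeal d where
  deg n := ⨅ J : {J : GradedIdeal d // ∀ m, S m ⊆ J.deg m}, J.1.deg n
  wedge_mem n α η h := by
    rw [Submodule.mem_iInf] at h ⊢
    exact fun J => J.1.wedge_mem n α η (h J)

section Manifolds

variable {M : Type*} {d : ℕ} [TopologicalSpace M] [ChartedSpace (Euc d) M]
variable {N : Type*} {e : ℕ} [TopologicalSpace N] [ChartedSpace (Euc e) N]

/-- The differential of a map of manifolds at `x`. -/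
def diff {M N : Type*} [TopologicalSpace M] [TopologicalSpace N] (d e : ℕ)
    [ChartedSpace (Euc d) M] [ChartedSpace (Euc e) N] (f : M → N) (x : M) : Euc d →L[ℝ] Euc e :=
  mfderiv (𝓡 d) (𝓡 e) f x

/-- A set of measure zero: its part in each chart is Lebesgue null. -/
def IsNull (d : ℕ) [ChartedSpace (Euc d) M] (S : Set M) : Prop :=
  ∀ x : M, MeasureTheory.volume
    (extChartAt (𝓡 d) x '' (S ∩ (chartAt (Euc d) x).source)) = 0

/-- The expression of an `n`-form field in the preferred chart at `x₀`. -/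
def inChart (x₀ : M) {n : ℕ} (η : M → AltForm d n) : Euc d → AltForm d n := fun u =>
  (η ((extChartAt (𝓡 d) x₀).symm u)).compContinuousLinearMap
    (diff d d (extChartAt (𝓡 d) x₀).symm u)

/-- Smoothness of a form field at a point. -/
def SmoothFormAt {n : ℕ} (η : M → AltForm d n) (x : M) : Prop :=
  ContDiffAt ℝ ∞ (inChart x η) (extChartAt (𝓡 d) x x)

/-- The exterior derivative, computed in the preferred chart at `x` (in which the tangent space at
`x` is written). -/
def extd {n : ℕ} (η : M → AltForm d n) (x : M) : AltForm d (n + 1) :=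
  extDeriv (inChart x η) (extChartAt (𝓡 d) x x)

/-- `(M, J)` is an exterior differential system: there are no functions in `J`, the sections of `J`
form a differential ideal, and `J` is a subbundle (is locally framed by smooth forms) off a closed
set of measure zero. -/
structure IsEDS (J : M → GradedIdeal d) : Prop where
  no_functions : ∀ x, (J x).deg 0 = ⊥
  closed : ∀ (n : ℕ) (η : M → AltForm d n), (∀ x, SmoothFormAt η x) →
    (∀ x, η x ∈ (J x).deg n) → ∀ x, extd η x ∈ (J x).deg (n + 1)
  subbundle : ∃ X : Set M, IsClosed X ∧ IsNull d X ∧ ∀ (n : ℕ), ∀ x ∉ X,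
    ∃ (m : ℕ) (η : Fin m → M → AltForm d n), ∀ᶠ y in 𝓝 x,
      (∀ i, SmoothFormAt (η i) y) ∧ LinearIndependent ℝ (fun i => η i y) ∧
        Submodule.span ℝ (Set.range fun i => η i y) = (J y).deg n

/-- A pair consisting of a point of `M` and a tangent subspace at this point. -/
@[ext]
structure Plane (M : Type*) (d : ℕ) where
  base : M
  plane : Submodule ℝ (Euc d)

/-- Coordinates on the space of planes, over the domain of the preferred chart at `x₀`. In the chart
a plane becomes a subspace of `ℝ^d`, and the subspace is represented by the orthogonal projection
onto it; this represents the Grassmann manifolds of `ℝ^d` as embedded submanifolds of the space of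
matrices. -/
def planeCoord (x₀ : M) (Q : Plane M d) : Euc d × (Euc d →L[ℝ] Euc d) :=
  let P : Submodule ℝ (Euc d) := Q.plane.map (diff d d (extChartAt (𝓡 d) x₀) Q.base).toLinearMap
  (extChartAt (𝓡 d) x₀ Q.base, P.starProjection)

/-- The topology of the bundle of planes (for `k`-dimensional planes, of `J¹ₖM`). -/
instance : TopologicalSpace (Plane M d) where
  IsOpen O := ∀ Q ∈ O, ∃ V : Set (Euc d × (Euc d →L[ℝ] Euc d)), IsOpen V ∧
    planeCoord Q.base Q ∈ V ∧ ∀ Q' : Plane M d, Q'.base ∈ (chartAt (Euc d) Q.base).source →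
      planeCoord Q.base Q' ∈ V → Q' ∈ O
  isOpen_univ := fun _ _ => ⟨Set.univ, isOpen_univ, trivial, fun _ _ _ => trivial⟩
  isOpen_inter := by
    rintro O₁ O₂ h₁ h₂ Q ⟨hQ₁, hQ₂⟩
    obtain ⟨V₁, a₁, b₁, c₁⟩ := h₁ Q hQ₁
    obtain ⟨V₂, a₂, b₂, c₂⟩ := h₂ Q hQ₂
    exact ⟨V₁ ∩ V₂, a₁.inter a₂, ⟨b₁, b₂⟩, fun Q' h h' => ⟨c₁ Q' h h'.1, c₂ Q' h h'.2⟩⟩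
  isOpen_sUnion := by
    rintro S hS Q ⟨O, hO, hQ⟩
    obtain ⟨V, a, b, c⟩ := hS O hO Q hQ
    exact ⟨V, a, b, fun Q' h h' => ⟨O, hO, c Q' h h'⟩⟩

/-- `φ : N → J¹ₖM` is a first order PDE system on `M` for `k`-dimensional submanifolds: a smooth
embedding onto a submanifold of the bundle `J¹ₖM` of `k`-planes, that submerges onto `M`. -/
structure IsPDESystem (e : ℕ) [ChartedSpace (Euc e) N] (k : ℕ) (φ : N → Plane M d) : Prop where
  finrank_eq : ∀ z, Module.finrank ℝ (φ z).plane = k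
  isEmbedding : Topology.IsEmbedding φ
  smooth : ∀ z, ContMDiffAt (𝓡 e) 𝓘(ℝ, Euc d × (Euc d →L[ℝ] Euc d)) ∞
    (planeCoord (φ z).base ∘ φ) z
  immersion : ∀ z, Function.Injective
    (mfderiv (𝓡 e) 𝓘(ℝ, Euc d × (Euc d →L[ℝ] Euc d)) (planeCoord (φ z).base ∘ φ) z)
  surjective : Function.Surjective fun z => (φ z).base
  submersion : ∀ z, Function.Surjective (diff e d (fun z => (φ z).base) z)

/-- The contact ideal of `J¹ₖM`, pulled back by `φ : N → J¹ₖM`: at `z` it is generated by the values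
`θ(z)` and `dθ(z)` of the contact forms, that is, of the smooth 1-forms near `z` that at each point
`z'` annihilate the vectors which are projected into the plane `φ z'`. -/
def contactIdeal (e : ℕ) [ChartedSpace (Euc e) N] (φ : N → Plane M d) (z : N) : GradedIdeal e :=
  let Contact : (N → AltForm e 1) → Prop := fun θ => ∀ᶠ z' in 𝓝 z, SmoothFormAt θ z' ∧
    ∀ v, diff e d (fun z => (φ z).base) z' v ∈ (φ z').plane → θ z' ![v] = 0
  GradedIdeal.generate fun n => match n with
    | 1 => {η | ∃ θ, Contact θ ∧ η = θ z}
    | 2 => {η | ∃ θ, Contact θ ∧ η = extd θ z}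
    | _ => ∅

/-- The `k`-dimensional integral elements of `(M, J)`: the `k`-planes that annihilate `J`. -/
def integralElements (k : ℕ) (J : M → GradedIdeal d) : Set (Plane M d) :=
  {Q | Module.finrank ℝ Q.plane = k ∧ ∀ (n : ℕ), ∀ η ∈ (J Q.base).deg n,
    η.compContinuousLinearMap Q.plane.subtypeL = 0}

/-- The integral elements that do not belong to the image of `φ`. -/
def removed (k : ℕ) (J : M → GradedIdeal d) (φ : N → Plane M d) : Set (Plane M d) :=
  integralElements k J \ Set.range φ

/-- `N`, embedded by `φ`, is the manifold of the `k`-dimensional prolongation of `(M, J)`: the set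
of all `k`-dimensional integral elements, from which the closed set `removed k J φ` has been removed
(it is empty if nothing is removed). The prolonged ideal is `contactIdeal e φ`. -/
structure IsProlongation (e : ℕ) [ChartedSpace (Euc e) N] (k : ℕ) (J : M → GradedIdeal d) (φ : N → Plane M d) : Prop
    extends IsPDESystem e k φ where
  integral : ∀ z, φ z ∈ integralElements k J
  removed_closed : ∃ C : Set (Plane M d), IsClosed C ∧ removed k J φ = integralElements k J ∩ C

end Manifolds

section Orbits

variable (G : Type*) [Group G] {M : Type*} {d : ℕ} [TopologicalSpace M] [ChartedSpace (Euc d) M]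
  [MulAction G M]

/-- Two points of `U` are equivalent if they lie in the same `G`-orbit. -/
def orbitSetoid (U : Opens M) : Setoid U :=
  (MulAction.orbitRel G M).comap (fun z : U => (z : M))

/-- The orbit space `U / G`, for an invariant open set `U`. -/
def OrbitSpace (U : Opens M) : Type _ := Quotient (orbitSetoid G U)

instance (U : Opens M) : TopologicalSpace (OrbitSpace G U) :=
  inferInstanceAs (TopologicalSpace (Quotient (orbitSetoid G U)))

/-- The projection `U → U / G`. -/
def toOrbit (U : Opens M) (z : U) : OrbitSpace G U := Quotient.mk (orbitSetoid G U) z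

/-- The orbit space `U / G` (with the quotient topology and the given charts) is a Hausdorff smooth
manifold of dimension `n`, and the projection is a submersion. -/
structure IsOrbitManifold (U : Opens M) (d : ℕ) [ChartedSpace (Euc d) M] (n : ℕ)
    [ChartedSpace (Euc n) (OrbitSpace G U)] : Prop where
  isManifold : IsManifold (𝓡 n) ∞ (OrbitSpace G U)
  t2 : T2Space (OrbitSpace G U)
  smooth : ContMDiff (𝓡 d) (𝓡 n) ∞ (toOrbit G U)
  submersion : ∀ z : U, Function.Surjective (diff d n (toOrbit G U) z)

/-- The reduced ideal: the largest ideal on `U / G` whose pullback to `U` lies in `J`.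
(The tangent space at a point of the open set `U` is that of `M`.) -/
def reducedIdeal (U : Opens M) (n : ℕ) [ChartedSpace (Euc n) (OrbitSpace G U)]
    (J : M → GradedIdeal d) (b : OrbitSpace G U) : GradedIdeal n where
  deg m :=
    { carrier := {η | ∀ z : U, toOrbit G U z = b →
        η.compContinuousLinearMap (diff d n (toOrbit G U) z) ∈ (J z).deg m}
      add_mem' := fun {a b} ha hb z hz => (J z).deg m |>.add_mem (ha z hz) (hb z hz)
      zero_mem' := fun z _ => ((J z).deg m).zero_mem
      smul_mem' := fun c a ha z hz => ((J z).deg m).smul_mem c (ha z hz) }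
  wedge_mem m α η h z hz := by
    rw [wedge_comp]
    exact (J z).wedge_mem m _ _ (h z hz)

variable {G} in
/-- The image in `U / G` of a tangent plane at a point `z` of `U`. -/
def pushPlane {U : Opens M} {n : ℕ} [ChartedSpace (Euc n) (OrbitSpace G U)] (z : U)
    (P : Submodule ℝ (Euc d)) : Plane (OrbitSpace G U) n :=
  ⟨toOrbit G U z, P.map (diff d n (toOrbit G U) z).toLinearMap⟩

/-- At the point `w` of `N`, `φ : N → J¹ₖM`, there is a horizontal invariant coframe: functions
`y¹, …, yᵏ` that are smooth and `G`-invariant on an invariant open set and whose differentials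
restrict to a basis of the dual of the `k`-plane `φ w`. -/
def HasInvariantCoframe (k : ℕ) {N : Type*} (φ : N → Plane M d) (w : N) : Prop :=
  ∃ (V : Set M) (y : M → Euc k), IsOpen V ∧ (φ w).base ∈ V ∧ (∀ g : G, ∀ z ∈ V, g • z ∈ V) ∧
    ContMDiffOn (𝓡 d) (𝓡 k) ∞ y V ∧ (∀ g : G, ∀ z ∈ V, y (g • z) = y z) ∧
    ∀ u : Euc k, ∃! v, v ∈ (φ w).plane ∧ diff d k y (φ w).base v = u

end Orbits

section Towers

variable {M : ℕ → Type*} {d : ℕ → ℕ} [∀ r, TopologicalSpace (M r)]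
  [∀ r, ChartedSpace (Euc (d r)) (M r)]

/-- The ideals of a prolongation tower that starts with `(M 0, J₀)`. -/
def towerIdeal (J₀ : M 0 → GradedIdeal (d 0)) (φ : ∀ r, M (r + 1) → Plane (M r) (d r)) :
    ∀ r, M r → GradedIdeal (d r)
  | 0 => J₀
  | r + 1 => contactIdeal (d (r + 1)) (φ r)

/-- `M 0 ← M 1 ← M 2 ← ⋯` is the `k`-dimensional prolongation tower of `(M 0, J₀)`; each `M (r + 1)`
is embedded by `φ r` into the bundle of `k`-planes of `M r`. -/
def IsTower (k : ℕ) (J₀ : M 0 → GradedIdeal (d 0))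
    (φ : ∀ r, M (r + 1) → Plane (M r) (d r)) : Prop :=
  ∀ r, IsProlongation (d (r + 1)) k (towerIdeal J₀ φ r) (φ r)

/-- The `G`-actions on the manifolds of the tower are the prolongations of the action on `M 0`:
each group element acts on a plane by its differential. -/
def IsProlongedAction (G : Type*) [Group G] [∀ r, MulAction G (M r)]
    (φ : ∀ r, M (r + 1) → Plane (M r) (d r)) : Prop :=
  ∀ (r : ℕ) (g : G) (z : M (r + 1)), φ r (g • z) = ⟨g • (φ r z).base,
    (φ r z).plane.map (diff (d r) (d r) (fun x : M r => g • x) (φ r z).base).toLinearMap⟩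

/-- `LiesOver φ S r z`: the image of `z ∈ M r` under the tower projection `M r → M s` lies in `S`
(in particular `s ≤ r`). -/
inductive LiesOver (φ : ∀ r, M (r + 1) → Plane (M r) (d r)) {s : ℕ} (S : Set (M s)) :
    ∀ r, M r → Prop
  | base (z : M s) : z ∈ S → LiesOver φ S s z
  | step (r : ℕ) (z : M (r + 1)) : LiesOver φ S r (φ r z).base → LiesOver φ S (r + 1) z

/-- The part of `M r` that is reduced: the points that lie over the set `W ⊆ M s` on which the
action is free, and over the set of the points of `M (m + 1)` at which there is a horizontal
coframe of invariants of order `m`. (This set is open; taking the interior makes this visible.) -/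
def regularDomain (G : Type*) [Group G] [∀ r, MulAction G (M r)] (k : ℕ)
    (φ : ∀ r, M (r + 1) → Plane (M r) (d r)) {s : ℕ} (W : Set (M s)) (m r : ℕ) : Opens (M r) :=
  ⟨interior {z | LiesOver φ W r z ∧ LiesOver φ {w : M (m + 1) | HasInvariantCoframe G k (φ m) w} r z},
    isOpen_interior⟩

variable {G : Type*} [Group G] [∀ r, MulAction G (M r)]

/-- `ψ : U' / G → J¹ₖ(U / G)` is induced by `φ : M (r + 1) → J¹ₖ(M r)`. -/
def IsInduced {r : ℕ} (φ : M (r + 1) → Plane (M r) (d r)) {U : Opens (M r)}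
    {U' : Opens (M (r + 1))} {n : ℕ} [ChartedSpace (Euc n) (OrbitSpace G U)]
    (ψ : OrbitSpace G U' → Plane (OrbitSpace G U) n) : Prop :=
  ∀ w : U', ∃ h : (φ w).base ∈ U, ψ (toOrbit G U' w) = pushPlane ⟨_, h⟩ (φ w).plane

end Towers

end EDS

end

open EDS

/-!
Two transversality statements carry the proof.

The first concerns the group. Let `m` be the larger one of the orders at which the action is free
and at which horizontal coframes of invariants appear. Since `G` has countably many charts, a free
action with a manifold as quotient has orbits of the dimension of the fibres (`IsQuot.dim_eq`).
Hence the inverse function theorem provides local moving frames, that is, equivariant maps `ρ` to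
`G` (`IsQuot.exists_frame`). Frames are pulled back to all higher orders of the tower, and the
level sets of `ρ` are slices, which give charts of the orbit spaces (`exists_slice_coordinates`).
Two orbits lie in the domain of a common frame, or they are separated by invariant open sets from
a lower order (`exists_frame_or_disjoint`). Therefore the orbit spaces are Hausdorff manifolds
(`exists_isOrbitManifold`).

The second concerns the contact distribution. An infinitesimal symmetry annihilates the functions
of an invariant horizontal coframe, so it is not tangent to the plane on which the coframe exists,
and this property propagates up the tower (`infAction_eq_zero_of_mem_plane`). Thus the contact
distribution at an order `j + 1 > m` is transversal to the orbits. As integral elements lie in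
this distribution, they are determined by their images in the quotient, and they can be recovered
from these images smoothly along a section of the quotient map (`IsQuot.exists_plane_lift`). It
follows that the map `ψ` that the planes of order `j + 2` induce on orbit spaces is an embedding
and an immersion, and represents a first order PDE system (`IsReduction.isPDESystem`).

The reduced ideal of order `j + 2` is the contact ideal of `ψ` (`IsReduction.quotIdeal_eq`).
Contact forms of the quotient are pulled back to contact forms, which gives one inclusion. For the
other one, the differential of the quotient map has a right inverse `σ` at each point that
respects the contact distributions, and it suffices that `σ` pulls the contact ideal back to the
contact ideal of `ψ` (`IsReduction.exists_splitting`). This is clear for the contact forms `θ`.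
Modulo contact forms, `dθ` at a point depends only on the value of `θ` there
(`IsPDESystem.extd_eq_zero`), and by transversality this value is the sum of the pullback of a
contact form of `ψ` and the pullback of a contact form `α` of order `j + 1`, for which `dα`
vanishes on the integral elements. So `σ` pulls `dθ` back to the exterior derivative of a contact
form of `ψ`, up to a form of degree two that vanishes on the contact distribution; such a form
lies in the ideal generated by the annihilator of the distribution
(`GradedIdeal.mem_two_of_annihilator`).

The right inverse `σ` also lifts integral elements of the reduced system to integral elements
(`IsReduction.exists_integral_lift`), so that the integral elements that are missing in the
quotient are exactly the images of the missing ones, and the quotient of the prolongation is the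
prolongation of the quotient (`IsReduction.removed_eq`, `IsReduction.isProlongation`). The
argument for the ideal of order `r` uses the transversality at the order `r - 1 ≥ m + 1`, and this
is the reason for the bound `m + 2`.
-/

noncomputable section

namespace EDS

set_option linter.unusedSectionVars false

/-! ### Maps of manifolds in charts -/

section DiffBasics

variable {M : Type*} {d : ℕ} [TopologicalSpace M] [ChartedSpace (Euc d) M]
variable {N : Type*} {e : ℕ} [TopologicalSpace N] [ChartedSpace (Euc e) N]
variable {N' : Type*} {e' : ℕ} [TopologicalSpace N'] [ChartedSpace (Euc e') N']

theorem diff_comp {f : M → N} {g : N → N'} {x : M}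
    (hg : MDifferentiableAt (𝓡 e) (𝓡 e') g (f x)) (hf : MDifferentiableAt (𝓡 d) (𝓡 e) f x) :
    diff d e' (g ∘ f) x = (diff e e' g (f x)).comp (diff d e f x) :=
  mfderiv_comp x hg hf

theorem diff_id (x : M) : diff d d (id : M → M) x = ContinuousLinearMap.id ℝ (Euc d) :=
  mfderiv_id

theorem diff_congr {f g : M → N} {x : M} (h : f =ᶠ[𝓝 x] g) : diff d e f x = diff d e g x :=
  h.mfderiv_eq

theorem diff_eq_fderiv (f : Euc d → Euc e) (u : Euc d) : diff d e f u = fderiv ℝ f u :=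
  mfderiv_eq_fderiv

theorem contMDiffAt_diffble {f : M → N} {x : M} (h : ContMDiffAt (𝓡 d) (𝓡 e) ∞ f x) :
    MDifferentiableAt (𝓡 d) (𝓡 e) f x :=
  h.mdifferentiableAt (by simp)

theorem extChartAt_target_mem_nhds_of_mem {x₀ z : M} (hz : z ∈ (chartAt (Euc d) x₀).source) :
    (extChartAt (𝓡 d) x₀).target ∈ 𝓝 (extChartAt (𝓡 d) x₀ z) := by
  apply extChartAt_target_mem_nhds'
  exact (extChartAt (𝓡 d) x₀).map_source (by simpa using hz)

/-- The expression of a map in the preferred charts at `x₀` and `y₀`. -/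
def inCharts (d e : ℕ) [ChartedSpace (Euc d) M] [ChartedSpace (Euc e) N] (x₀ : M) (y₀ : N)
    (f : M → N) : Euc d → Euc e :=
  extChartAt (𝓡 e) y₀ ∘ f ∘ (extChartAt (𝓡 d) x₀).symm

theorem inCharts_apply {x₀ z : M} {y₀ : N} {f : M → N} (hz : z ∈ (chartAt (Euc d) x₀).source) :
    inCharts d e x₀ y₀ f (extChartAt (𝓡 d) x₀ z) = extChartAt (𝓡 e) y₀ (f z) := by
  simp only [inCharts, Function.comp_apply]
  rw [(extChartAt (𝓡 d) x₀).left_inv (by simpa using hz)]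

/-- A property that holds near `z` holds in the chart near the coordinates of `z`. -/
theorem eventually_chart_symm {x₀ z : M} (hz : z ∈ (chartAt (Euc d) x₀).source) {p : M → Prop}
    (h : ∀ᶠ y in 𝓝 z, p y) :
    ∀ᶠ u in 𝓝 (extChartAt (𝓡 d) x₀ z), p ((extChartAt (𝓡 d) x₀).symm u) := by
  have hz' : z ∈ (extChartAt (𝓡 d) x₀).source := by simpa using hz
  have hc := (continuousAt_extChartAt_symm' hz')
  rw [ContinuousAt, (extChartAt (𝓡 d) x₀).left_inv hz'] at hc
  exact hc.eventually h

theorem chart_source_mem_nhds {x₀ z : M} (hz : z ∈ (chartAt (Euc d) x₀).source) :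
    ∀ᶠ y in 𝓝 z, y ∈ (chartAt (Euc d) x₀).source :=
  (chartAt (Euc d) x₀).open_source.mem_nhds hz

/-- A property near the coordinates of `z` holds at the coordinates of the points near `z`. -/
theorem eventually_chart {x₀ z : M} (hz : z ∈ (chartAt (Euc d) x₀).source) {p : Euc d → Prop}
    (h : ∀ᶠ u in 𝓝 (extChartAt (𝓡 d) x₀ z), p u) : ∀ᶠ y in 𝓝 z, p (extChartAt (𝓡 d) x₀ y) :=
  (continuousAt_extChartAt' (by simpa using hz)).eventually h

section Smooth
variable [IsManifold (𝓡 d) ∞ M] [IsManifold (𝓡 e) ∞ N]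

theorem diff_extChartAt_self (x : M) :
    diff d d (extChartAt (𝓡 d) x) x = ContinuousLinearMap.id ℝ (Euc d) := by
  have : IsManifold (𝓡 d) 1 M := IsManifold.of_le (n := ∞) (by simp)
  unfold diff
  exact mfderiv_extChartAt_self

theorem contMDiffAt_chart {x₀ z : M} (hz : z ∈ (chartAt (Euc d) x₀).source) :
    ContMDiffAt (𝓡 d) (𝓡 d) ∞ (extChartAt (𝓡 d) x₀) z :=
  contMDiffAt_extChartAt' hz

theorem contMDiffAt_chart_symm {x₀ : M} {u : Euc d} (hu : u ∈ (extChartAt (𝓡 d) x₀).target) :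
    ContMDiffAt (𝓡 d) (𝓡 d) ∞ (extChartAt (𝓡 d) x₀).symm u :=
  (contMDiffOn_extChartAt_symm x₀).contMDiffAt ((isOpen_extChartAt_target x₀).mem_nhds hu)

theorem diff_chart_symm_comp {x₀ z : M} (hz : z ∈ (chartAt (Euc d) x₀).source) :
    (diff d d (extChartAt (𝓡 d) x₀).symm (extChartAt (𝓡 d) x₀ z)).comp
      (diff d d (extChartAt (𝓡 d) x₀) z) = ContinuousLinearMap.id ℝ (Euc d) := by
  have hz' : z ∈ (extChartAt (𝓡 d) x₀).source := by simpa using hz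
  rw [← diff_comp, ← diff_id (M := M) z]
  · apply diff_congr
    filter_upwards [(isOpen_extChartAt_source (I := 𝓡 d) x₀).mem_nhds hz'] with y hy
    exact (extChartAt (𝓡 d) x₀).left_inv hy
  · exact contMDiffAt_diffble (contMDiffAt_chart_symm ((extChartAt (𝓡 d) x₀).map_source hz'))
  · exact contMDiffAt_diffble (contMDiffAt_chart hz)

theorem diff_chart_comp_symm {x₀ : M} {u : Euc d} (hu : u ∈ (extChartAt (𝓡 d) x₀).target) :
    (diff d d (extChartAt (𝓡 d) x₀) ((extChartAt (𝓡 d) x₀).symm u)).comp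
      (diff d d (extChartAt (𝓡 d) x₀).symm u) = ContinuousLinearMap.id ℝ (Euc d) := by
  have hz' := (extChartAt (𝓡 d) x₀).map_target hu
  rw [← diff_comp, ← diff_id (M := Euc d) (d := d) u]
  · apply diff_congr
    filter_upwards [(isOpen_extChartAt_target (I := 𝓡 d) x₀).mem_nhds hu] with y hy
    exact (extChartAt (𝓡 d) x₀).right_inv hy
  · exact contMDiffAt_diffble (contMDiffAt_chart (by simpa using hz'))
  · exact contMDiffAt_diffble (contMDiffAt_chart_symm hu)

theorem diff_chart_symm_apply {x₀ z : M} (hz : z ∈ (chartAt (Euc d) x₀).source) (v : Euc d) :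
    diff d d (extChartAt (𝓡 d) x₀).symm (extChartAt (𝓡 d) x₀ z)
      (diff d d (extChartAt (𝓡 d) x₀) z v) = v :=
  DFunLike.congr_fun (diff_chart_symm_comp hz) v

theorem diff_chart_apply_symm {x₀ z : M} (hz : z ∈ (chartAt (Euc d) x₀).source) (v : Euc d) :
    diff d d (extChartAt (𝓡 d) x₀) z
      (diff d d (extChartAt (𝓡 d) x₀).symm (extChartAt (𝓡 d) x₀ z) v) = v := by
  have hz' : z ∈ (extChartAt (𝓡 d) x₀).source := by simpa using hz
  have := DFunLike.congr_fun (diff_chart_comp_symm ((extChartAt (𝓡 d) x₀).map_source hz')) v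
  rwa [(extChartAt (𝓡 d) x₀).left_inv hz'] at this

theorem diff_chart_symm_self (x : M) :
    diff d d (extChartAt (𝓡 d) x).symm (extChartAt (𝓡 d) x x) = ContinuousLinearMap.id ℝ (Euc d) := by
  have := diff_chart_symm_comp (d := d) (x₀ := x) (z := x) (mem_chart_source _ x)
  rwa [diff_extChartAt_self, ContinuousLinearMap.comp_id] at this

theorem inCharts_contDiffAt {x₀ z : M} {y₀ : N} {f : M → N}
    (hz : z ∈ (chartAt (Euc d) x₀).source) (hy : f z ∈ (chartAt (Euc e) y₀).source)
    (hf : ContMDiffAt (𝓡 d) (𝓡 e) ∞ f z) :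
    ContDiffAt ℝ ∞ (inCharts d e x₀ y₀ f) (extChartAt (𝓡 d) x₀ z) := by
  rw [← contMDiffAt_iff_contDiffAt]
  have hz' : z ∈ (extChartAt (𝓡 d) x₀).source := by simpa using hz
  have hl := (extChartAt (𝓡 d) x₀).left_inv hz'
  have h1 := contMDiffAt_chart_symm ((extChartAt (𝓡 d) x₀).map_source hz')
  refine ContMDiffAt.comp (I' := 𝓡 e) _ ?_ (ContMDiffAt.comp (I' := 𝓡 d) _ ?_ h1)
  · simp only [Function.comp_apply, hl]
    exact contMDiffAt_chart hy
  · rwa [hl]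

theorem inCharts_fderiv {x₀ z : M} {y₀ : N} {f : M → N}
    (hz : z ∈ (chartAt (Euc d) x₀).source) (hy : f z ∈ (chartAt (Euc e) y₀).source)
    (hf : MDifferentiableAt (𝓡 d) (𝓡 e) f z) :
    fderiv ℝ (inCharts d e x₀ y₀ f) (extChartAt (𝓡 d) x₀ z) =
      (diff e e (extChartAt (𝓡 e) y₀) (f z)).comp ((diff d e f z).comp
        (diff d d (extChartAt (𝓡 d) x₀).symm (extChartAt (𝓡 d) x₀ z))) := by
  have hz' : z ∈ (extChartAt (𝓡 d) x₀).source := by simpa using hz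
  have hl := (extChartAt (𝓡 d) x₀).left_inv hz'
  have h1 := contMDiffAt_diffble (contMDiffAt_chart_symm ((extChartAt (𝓡 d) x₀).map_source hz'))
  have h2 : MDifferentiableAt (𝓡 d) (𝓡 e) f
    ((extChartAt (𝓡 d) x₀).symm (extChartAt (𝓡 d) x₀ z)) := by rwa [hl]
  have h3 : MDifferentiableAt (𝓡 e) (𝓡 e) (extChartAt (𝓡 e) y₀)
    ((f ∘ (extChartAt (𝓡 d) x₀).symm) (extChartAt (𝓡 d) x₀ z)) := by
    simp only [Function.comp_apply, hl]
    exact contMDiffAt_diffble (contMDiffAt_chart hy)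
  rw [← diff_eq_fderiv, inCharts, diff_comp h3 (h2.comp _ h1), diff_comp h2 h1]
  simp only [Function.comp_apply, hl]

theorem inCharts_fderiv_self {z : M} {f : M → N} (hf : MDifferentiableAt (𝓡 d) (𝓡 e) f z) :
    fderiv ℝ (inCharts d e z (f z) f) (extChartAt (𝓡 d) z z) = diff d e f z := by
  rw [inCharts_fderiv (mem_chart_source _ z) (mem_chart_source _ _) hf, diff_extChartAt_self,
    diff_chart_symm_self, ContinuousLinearMap.comp_id, ContinuousLinearMap.id_comp]

end Smooth

end DiffBasics

/-! ### The infinitesimal action -/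

section Orb

theorem contMDiff_smul_left {G : Type*} (dG : ℕ) [Group G] [TopologicalSpace G]
    [ChartedSpace (Euc dG) G] {M : Type*} {d : ℕ} [TopologicalSpace M] [ChartedSpace (Euc d) M]
    [MulAction G M] [ContMDiffSMul (𝓡 dG) (𝓡 d) ∞ G M] (g : G) :
    ContMDiff (𝓡 d) (𝓡 d) ∞ (fun x : M => g • x) :=
  ContMDiffSMul.contMDiff_const_smul (I := 𝓡 dG) g

variable {G : Type*} {dG : ℕ} [Group G] [TopologicalSpace G] [ChartedSpace (Euc dG) G]
  [LieGroup (𝓡 dG) ∞ G]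
variable {M : Type*} {d : ℕ} [TopologicalSpace M] [ChartedSpace (Euc d) M]
  [IsManifold (𝓡 d) ∞ M] [MulAction G M] [ContMDiffSMul (𝓡 dG) (𝓡 d) ∞ G M]

theorem contMDiff_orb (z : M) : ContMDiff (𝓡 dG) (𝓡 d) ∞ (fun g : G => g • z) :=
  ContMDiff.smul (I := 𝓡 dG) (I' := 𝓡 d) contMDiff_id contMDiff_const

theorem contMDiffAt_smul_of {E : Type*} [NormedAddCommGroup E] [NormedSpace ℝ E] {H : Type*}
    [TopologicalSpace H] {I : ModelWithCorners ℝ E H} {N : Type*} [TopologicalSpace N]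
    [ChartedSpace H N] {f : N → G} {h : N → M} {x : N} (hf : ContMDiffAt I (𝓡 dG) ∞ f x)
    (hh : ContMDiffAt I (𝓡 d) ∞ h x) :
    ContMDiffAt I (𝓡 d) ∞ (fun y => f y • h y) x :=
  ContMDiffAt.smul (I := 𝓡 dG) (I' := 𝓡 d) hf hh

variable (dG d) in
/-- The infinitesimal action at `z`: the differential of `g ↦ g • z` at the identity. -/
def infAction (G : Type*) [Group G] [TopologicalSpace G] [ChartedSpace (Euc dG) G] [MulAction G M]
    (z : M) : Euc dG →L[ℝ] Euc d :=
  diff dG d (fun g : G => g • z) (1 : G)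

/-- The differential of the orbit map at `g`, in terms of the infinitesimal action. -/
theorem diff_orb_mul (z : M) (g : G) (ξ : Euc dG) :
    diff dG d (fun h : G => h • z) g (diff dG dG (fun h : G => g * h) 1 ξ) =
      diff d d (fun x : M => g • x) z (infAction dG d G z ξ) := by
  have h1 : MDifferentiableAt (𝓡 dG) (𝓡 dG) (fun h : G => g * h) 1 :=
    contMDiffAt_diffble (contMDiff_mul_left (I := 𝓡 dG) (n := ∞) (a := g)).contMDiffAt
  have h2 : MDifferentiableAt (𝓡 dG) (𝓡 d) (fun h : G => h • z) ((fun h : G => g * h) 1) :=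
    contMDiffAt_diffble (contMDiff_orb z).contMDiffAt
  have h3 : MDifferentiableAt (𝓡 d) (𝓡 d) (fun x : M => g • x) ((fun h : G => h • z) 1) :=
    contMDiffAt_diffble (contMDiff_smul_left dG g).contMDiffAt
  have h4 : MDifferentiableAt (𝓡 dG) (𝓡 d) (fun h : G => h • z) 1 :=
    contMDiffAt_diffble (contMDiff_orb z).contMDiffAt
  have e1 := diff_comp (f := fun h : G => g * h) (g := fun h : G => h • z) h2 h1
  have e2 := diff_comp (f := fun h : G => h • z) (g := fun x : M => g • x) h3 h4
  have : (fun h : G => h • z) ∘ (fun h : G => g * h) =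
      (fun x : M => g • x) ∘ (fun h : G => h • z) := by
    funext h; simp [mul_smul]
  rw [this, e2] at e1
  have e3 := DFunLike.congr_fun e1 ξ
  simp only [ContinuousLinearMap.comp_apply, mul_one, one_smul] at e3
  exact e3.symm

/-- At a point with trivial stabilizer the infinitesimal action is injective: an integral curve
of the left invariant field that belongs to a vector in the kernel is mapped to a point by the
orbit map, hence is constant. -/
theorem infAction_injective {z : M} (hz : ∀ g : G, g • z = z → g = 1) :
    Function.Injective (infAction dG d G z) := by
  have : LieGroup (𝓡 dG) (minSmoothness ℝ 3) G := LieGroup.of_le (n := ∞) (by simpa using ENat.LEInfty.out)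
  have : IsManifold (𝓡 dG) 1 G := IsManifold.of_le (n := ∞) (by simp)
  rw [injective_iff_map_eq_zero]
  intro ξ hξ
  -- an integral curve of the left invariant field that belongs to `ξ`
  let V : ∀ g : G, TangentSpace (𝓡 dG) g := mulInvariantVectorField (I := 𝓡 dG) (G := G) ξ
  obtain ⟨γ, hγ0, hγ⟩ := exists_isMIntegralCurveAt_of_contMDiffAt_boundaryless (v := V)
    (x₀ := (1 : G)) (I := 𝓡 dG) 0
    (((contMDiff_mulInvariantVectorField (I := 𝓡 dG) (G := G) ξ).of_le (by simp)).contMDiffAt)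
  have horb : ∀ g : G, diff dG d (fun h : G => h • z) g (V g) = 0 := by
    intro g
    have := diff_orb_mul (dG := dG) (d := d) z g ξ
    rw [hξ, map_zero] at this
    exact this
  -- the image of the curve under the orbit map is constant
  have hconst : ∀ᶠ t in 𝓝 (0 : ℝ), γ t • z = z := by
    let c := extChartAt (𝓡 d) z
    have hcont : ContinuousAt (fun t => γ t • z) 0 := by
      have h := hγ.continuousAt
      exact ContinuousAt.comp (g := fun g : G => g • z)
        (contMDiff_orb (dG := dG) (d := d) z).continuous.continuousAt h
    have hsrc : ∀ᶠ t in 𝓝 (0 : ℝ), γ t • z ∈ (chartAt (Euc d) z).source := by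
      apply hcont
      simp only [hγ0, one_smul]
      exact (chartAt (Euc d) z).open_source.mem_nhds (mem_chart_source _ z)
    have hder : ∀ᶠ t in 𝓝 (0 : ℝ), HasDerivAt (fun t => c (γ t • z)) 0 t := by
      filter_upwards [hγ, hsrc] with t ht hs
      have h1 : HasMFDerivAt (𝓡 dG) (𝓡 d) (fun h : G => h • z) (γ t) (diff dG d (fun h : G => h • z) (γ t)) :=
        (contMDiffAt_diffble (contMDiff_orb z).contMDiffAt).hasMFDerivAt
      have h2 : HasMFDerivAt (𝓡 d) (𝓡 d) c (γ t • z) (diff d d c (γ t • z)) :=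
        (contMDiffAt_diffble (contMDiffAt_chart hs)).hasMFDerivAt
      let A : ℝ →L[ℝ] Euc dG := ContinuousLinearMap.smulRight (1 : ℝ →L[ℝ] ℝ) (V (γ t) : Euc dG)
      have h3 : HasFDerivAt (fun t => c (γ t • z)) ((diff d d c (γ t • z)).comp
          ((diff dG d (fun h : G => h • z) (γ t)).comp A)) t :=
        (h2.comp t (h1.comp t ht)).hasFDerivAt
      have h4 : (diff d d c (γ t • z)).comp
          ((diff dG d (fun h : G => h • z) (γ t)).comp A) 1 = 0 := by
        have h5 : A 1 = (V (γ t) : Euc dG) := one_smul ℝ (show Euc dG from V (γ t))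
        rw [ContinuousLinearMap.comp_apply, ContinuousLinearMap.comp_apply, h5, horb, map_zero]
      exact h4 ▸ h3.hasDerivAt
    obtain ⟨ε, hε, hball⟩ := Metric.eventually_nhds_iff_ball.1 (hder.and hsrc)
    filter_upwards [Metric.ball_mem_nhds (0 : ℝ) hε] with t ht
    have hc : c (γ t • z) = c (γ 0 • z) := by
      refine (convex_ball (0 : ℝ) ε).is_const_of_fderivWithin_eq_zero (𝕜 := ℝ)
        (fun s hs => ((hball s hs).1.differentiableAt).differentiableWithinAt) ?_ ht
        (Metric.mem_ball_self hε)
      intro s hs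
      rw [fderivWithin_of_isOpen Metric.isOpen_ball hs]
      have := (hball s hs).1.hasFDerivAt.fderiv
      rw [this]; ext; simp
    rw [hγ0, one_smul] at hc
    exact c.injOn (by simpa [c] using (hball t ht).2) (by simp [c]) hc
  have hγc : γ =ᶠ[𝓝 0] fun _ => (1 : G) := by
    filter_upwards [hconst] with t ht using hz _ ht
  have h5 := hγ.hasMFDerivAt
  have h6 : HasMFDerivAt 𝓘(ℝ, ℝ) (𝓡 dG) γ 0 _ :=
    (hasMFDerivAt_const (1 : G) (0 : ℝ)).congr_of_eventuallyEq hγc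
  have h7 := hasMFDerivAt_unique h5 h6
  have h8 := DFunLike.congr_fun h7 (1 : ℝ)
  have h9 : V (γ 0) = 0 := (one_smul ℝ (V (γ 0))).symm.trans h8
  rw [hγ0] at h9
  have h10 : V 1 = ξ := by
    change mfderiv (𝓡 dG) (𝓡 dG) (fun h : G => 1 * h) 1 ξ = ξ
    have : (fun h : G => 1 * h) = id := by funext h; simp
    rw [this, mfderiv_id]; rfl
  exact h10.symm.trans h9

end Orb

/-! ### The inverse function theorem and local sections -/

section Inverse

/-- The inverse function theorem, with a smooth inverse near the image point. -/
theorem exists_smooth_local_inverse {E F : Type*} [NormedAddCommGroup E] [NormedSpace ℝ E]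
    [CompleteSpace E] [NormedAddCommGroup F] [NormedSpace ℝ F] [CompleteSpace F] {f : E → F} {a : E}
    (hf : ∀ᶠ x in 𝓝 a, ContDiffAt ℝ ∞ f x) (f' : E ≃L[ℝ] F) (hf' : HasFDerivAt f (f' : E →L[ℝ] F) a) :
    ∃ g : F → E, g (f a) = a ∧ (∀ᶠ y in 𝓝 (f a), ContDiffAt ℝ ∞ g y ∧ f (g y) = y) ∧
      ∀ᶠ x in 𝓝 a, g (f x) = x := by
  have ha : ContDiffAt ℝ ∞ f a := hf.self_of_nhds
  have hn : (∞ : WithTop ℕ∞) ≠ 0 := by simp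
  let e := ha.toOpenPartialHomeomorph f hf' hn
  have hae : a ∈ e.source := ha.mem_toOpenPartialHomeomorph_source hf' hn
  have hat : f a ∈ e.target := e.map_source hae
  have hsymm : e.symm (f a) = a := e.left_inv hae
  have hcont : ContinuousAt e.symm (f a) := e.continuousAt_symm hat
  have hder : ∀ᶠ x in 𝓝 a, ∃ A : E ≃L[ℝ] F, HasFDerivAt f (A : E →L[ℝ] F) x := by
    have h1 : ContinuousAt (fderiv ℝ f) a := (ha.fderiv_right (m := 0) (by simp)).continuousAt
    have h2 : ∀ᶠ L in 𝓝 (fderiv ℝ f a), L ∈ Set.range ((↑) : (E ≃L[ℝ] F) → E →L[ℝ] F) := by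
      rw [hf'.fderiv]
      exact ContinuousLinearEquiv.nhds f'
    filter_upwards [h1.eventually h2, hf] with x ⟨A, hA⟩ hx
    exact ⟨A, hA ▸ (hx.differentiableAt hn).hasFDerivAt⟩
  refine ⟨e.symm, hsymm, ?_, ?_⟩
  · rw [ContinuousAt, hsymm] at hcont
    filter_upwards [e.open_target.mem_nhds hat, hcont.eventually hder, hcont.eventually hf]
      with y hy ⟨A, hA⟩ hfy
    exact ⟨e.contDiffAt_symm hy hA hfy, e.right_inv hy⟩
  · filter_upwards [e.open_source.mem_nhds hae] with x hx using e.left_inv hx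

variable {M : Type*} {d : ℕ} [TopologicalSpace M] [ChartedSpace (Euc d) M] [IsManifold (𝓡 d) ∞ M]
variable {N : Type*} {e : ℕ} [TopologicalSpace N] [ChartedSpace (Euc e) N] [IsManifold (𝓡 e) ∞ N]

/-- A submersion has smooth local sections. -/
theorem exists_local_section {f : M → N} {x : M}
    (hf : ∀ᶠ y in 𝓝 x, ContMDiffAt (𝓡 d) (𝓡 e) ∞ f y)
    (hs : Function.Surjective (diff d e f x)) :
    ∃ s : N → M, s (f x) = x ∧ ∀ᶠ y in 𝓝 (f x), ContMDiffAt (𝓡 e) (𝓡 d) ∞ s y ∧ f (s y) = y := by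
  have hfx := hf.self_of_nhds
  have hx : x ∈ (chartAt (Euc d) x).source := mem_chart_source _ x
  have hfx' : f x ∈ (chartAt (Euc e) (f x)).source := mem_chart_source _ _
  set c := extChartAt (𝓡 d) x
  set c' := extChartAt (𝓡 e) (f x)
  set F := inCharts d e x (f x) f
  have hFx : F (c x) = c' (f x) := inCharts_apply hx
  have hFs : ∀ᶠ u in 𝓝 (c x), ContDiffAt ℝ ∞ F u := by
    have h1 : ∀ᶠ y in 𝓝 x, ContDiffAt ℝ ∞ F (c y) := by
      filter_upwards [hf, chart_source_mem_nhds hx,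
        hfx.continuousAt.eventually (chart_source_mem_nhds hfx')] with y h1 h2 h3
      exact inCharts_contDiffAt h2 h3 h1
    filter_upwards [eventually_chart_symm hx h1,
      (isOpen_extChartAt_target (I := 𝓡 d) x).mem_nhds (mem_extChartAt_target x)] with u hu hu'
    rwa [(extChartAt (𝓡 d) x).right_inv hu'] at hu
  have hFd : HasFDerivAt F (diff d e f x) (c x) := by
    rw [← inCharts_fderiv_self (contMDiffAt_diffble hfx)]
    exact (hFs.self_of_nhds.differentiableAt (by simp)).hasFDerivAt
  -- composition with a right inverse `R` of the differential reduces the claim to the inverse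
  -- function theorem
  obtain ⟨R, hR⟩ := (diff d e f x).exists_rightInverse_of_surjective
    (LinearMap.range_eq_top.2 hs)
  let a : Euc e → Euc d := fun v => c x + R v
  have ha0 : a 0 = c x := by simp [a]
  have haS : ContDiff ℝ ∞ a := contDiff_const.add R.contDiff
  have hk : ∀ᶠ v in 𝓝 (0 : Euc e), ContDiffAt ℝ ∞ (F ∘ a) v := by
    have h1 : ContinuousAt a 0 := haS.continuous.continuousAt
    rw [ContinuousAt, ha0] at h1
    filter_upwards [h1.eventually hFs] with v hv
    exact hv.comp v haS.contDiffAt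
  have hk' : HasFDerivAt (F ∘ a) ((ContinuousLinearEquiv.refl ℝ (Euc e) : Euc e ≃L[ℝ] Euc e) :
      Euc e →L[ℝ] Euc e) 0 := by
    have h1 : HasFDerivAt a R 0 := (R.hasFDerivAt).const_add (c x)
    have h2 : HasFDerivAt F (diff d e f x) (a 0) := by rwa [ha0]
    have h3 := h2.comp (0 : Euc e) h1
    rw [hR] at h3
    exact h3
  obtain ⟨k, hk0, hk1, -⟩ := exists_smooth_local_inverse hk _ hk'
  have hFa : (F ∘ a) 0 = c' (f x) := by simp [ha0, hFx]
  rw [hFa] at hk0 hk1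
  refine ⟨fun y => c.symm (a (k (c' y))), ?_, ?_⟩
  · simp only [hk0, ha0]
    exact c.left_inv (mem_extChartAt_source x)
  have hc' : Filter.Tendsto c' (𝓝 (f x)) (𝓝 (c' (f x))) :=
    (contMDiffAt_extChartAt (n := ∞)).continuousAt
  have hkc : Filter.Tendsto (fun y => a (k (c' y))) (𝓝 (f x)) (𝓝 (c x)) := by
    have h1 : ContinuousAt k (c' (f x)) := (hk1.self_of_nhds).1.continuousAt
    have h2 : ContinuousAt a (k (c' (f x))) := haS.continuous.continuousAt
    have h3 := (h2.tendsto.comp h1.tendsto).comp hc'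
    rw [hk0, ha0] at h3
    exact h3
  have hcs : Filter.Tendsto (fun y => c.symm (a (k (c' y)))) (𝓝 (f x)) (𝓝 x) := by
    have h1 : ContinuousAt c.symm (c x) := continuousAt_extChartAt_symm x
    have h2 := h1.tendsto.comp hkc
    rwa [c.left_inv (mem_extChartAt_source x)] at h2
  have hfc : Filter.Tendsto (fun y => f (c.symm (a (k (c' y))))) (𝓝 (f x)) (𝓝 (f x)) :=
    hfx.continuousAt.tendsto.comp hcs
  filter_upwards [hc'.eventually hk1, hkc.eventually
    ((isOpen_extChartAt_target (I := 𝓡 d) x).mem_nhds (mem_extChartAt_target x)),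
    chart_source_mem_nhds hfx', hfc.eventually (chart_source_mem_nhds hfx')] with y h1 h2 h3 h4
  constructor
  · have t1 : ContMDiffAt (𝓡 e) (𝓡 e) ∞ c' y := contMDiffAt_chart h3
    have t2 : ContMDiffAt (𝓡 e) (𝓡 e) ∞ k (c' y) := h1.1.contMDiffAt
    have t3 : ContMDiffAt (𝓡 e) (𝓡 d) ∞ a (k (c' y)) := haS.contDiffAt.contMDiffAt
    have t4 : ContMDiffAt (𝓡 d) (𝓡 d) ∞ c.symm (a (k (c' y))) := contMDiffAt_chart_symm h2
    have t5 : ContMDiffAt (𝓡 e) (𝓡 e) ∞ (k ∘ c') y := t2.comp (I' := 𝓡 e) y t1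
    have t6 : ContMDiffAt (𝓡 e) (𝓡 d) ∞ (a ∘ (k ∘ c')) y := ContMDiffAt.comp (I' := 𝓡 e) y t3 t5
    exact ContMDiffAt.comp (I' := 𝓡 d) (g := c.symm) (f := a ∘ (k ∘ c')) y t4 t6
  · have h5 : c' (f (c.symm (a (k (c' y))))) = c' y := h1.2
    exact c'.injOn (by simpa [c'] using h4) (by simpa [c'] using h3) h5

/-- Right inverse of the differential given by a section. -/
theorem diff_comp_section {f : M → N} {s : N → M} {y : N}
    (hf : ContMDiffAt (𝓡 d) (𝓡 e) ∞ f (s y)) (hs : ContMDiffAt (𝓡 e) (𝓡 d) ∞ s y)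
    (h : ∀ᶠ y' in 𝓝 y, f (s y') = y') (v : Euc e) : diff d e f (s y) (diff e d s y v) = v := by
  have h1 := diff_comp (contMDiffAt_diffble hf) (contMDiffAt_diffble hs)
  have h2 : diff e e (f ∘ s) y = ContinuousLinearMap.id ℝ (Euc e) := by
    rw [← diff_id (M := N) (d := e) y]
    exact diff_congr h
  rw [h2] at h1
  exact (DFunLike.congr_fun h1 v).symm

end Inverse

/-! ### Quotients by group actions -/

section Quotients

/-- `p` presents the manifold `B` as the quotient of the open invariant subset `U` of the
`G`-manifold `M`: on `U` it is a smooth submersion onto `B` whose fibres are the orbits. (The values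
of `p` off `U` are irrelevant.) -/
structure IsQuot (G : Type*) [Group G] {M B : Type*} (d n : ℕ) [TopologicalSpace M]
    [ChartedSpace (Euc d) M] [MulAction G M] [TopologicalSpace B] [ChartedSpace (Euc n) B]
    (U : Set M) (p : M → B) : Prop where
  isOpen : IsOpen U
  smul_mem : ∀ (g : G), ∀ z ∈ U, g • z ∈ U
  smooth : ∀ z ∈ U, ContMDiffAt (𝓡 d) (𝓡 n) ∞ p z
  submersion : ∀ z ∈ U, Function.Surjective (diff d n p z)
  eq_iff : ∀ z ∈ U, ∀ w ∈ U, p z = p w ↔ ∃ g : G, g • z = w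
  onto : ∀ b, ∃ z ∈ U, p z = b

variable {G : Type*} {dG : ℕ} [Group G] [TopologicalSpace G] [ChartedSpace (Euc dG) G]
  [LieGroup (𝓡 dG) ∞ G]
variable {M : Type*} {d : ℕ} [TopologicalSpace M] [ChartedSpace (Euc d) M]
  [IsManifold (𝓡 d) ∞ M] [MulAction G M] [ContMDiffSMul (𝓡 dG) (𝓡 d) ∞ G M]
variable {B : Type*} {n : ℕ} [TopologicalSpace B] [ChartedSpace (Euc n) B] [IsManifold (𝓡 n) ∞ B]
variable {U : Set M} {p : M → B}

theorem IsQuot.smul_eq (h : IsQuot G d n U p) (g : G) {z : M} (hz : z ∈ U) : p (g • z) = p z :=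
  ((h.eq_iff z hz _ (h.smul_mem g z hz)).2 ⟨g, rfl⟩).symm

theorem IsQuot.eventually_mem (h : IsQuot G d n U p) {z : M} (hz : z ∈ U) : ∀ᶠ y in 𝓝 z, y ∈ U :=
  h.isOpen.mem_nhds hz

theorem IsQuot.eventually_smooth (h : IsQuot G d n U p) {z : M} (hz : z ∈ U) :
    ∀ᶠ y in 𝓝 z, ContMDiffAt (𝓡 d) (𝓡 n) ∞ p y := by
  filter_upwards [h.eventually_mem hz] with y hy using h.smooth y hy

theorem IsQuot.exists_section (h : IsQuot G d n U p) {z : M} (hz : z ∈ U) :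
    ∃ s : B → M, s (p z) = z ∧ ∀ᶠ b in 𝓝 (p z), s b ∈ U ∧ ContMDiffAt (𝓡 n) (𝓡 d) ∞ s b ∧
      p (s b) = b := by
  obtain ⟨s, hs, hs'⟩ := exists_local_section (h.eventually_smooth hz) (h.submersion z hz)
  refine ⟨s, hs, ?_⟩
  have hc : ContinuousAt s (p z) := hs'.self_of_nhds.1.continuousAt
  rw [ContinuousAt, hs] at hc
  filter_upwards [hs', hc.eventually (h.eventually_mem hz)] with b h1 h2 using ⟨h2, h1⟩

theorem IsQuot.diff_infAction (h : IsQuot G d n U p) {z : M} (hz : z ∈ U) (ξ : Euc dG) :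
    diff d n p z (infAction dG d G z ξ) = 0 := by
  have h1 : MDifferentiableAt (𝓡 d) (𝓡 n) p ((fun g : G => g • z) 1) := by
    simpa using contMDiffAt_diffble (h.smooth z hz)
  have h2 := diff_comp (f := fun g : G => g • z) (g := p) h1
    (contMDiffAt_diffble (contMDiff_orb (dG := dG) z).contMDiffAt)
  have h3 : p ∘ (fun g : G => g • z) = fun _ => p z := by
    funext g; exact h.smul_eq g hz
  have h4 : diff dG n (fun _ : G => p z) 1 = 0 := mfderiv_const
  rw [h3, h4] at h2
  have h5 := DFunLike.congr_fun h2 ξ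
  simp only [one_smul] at h5
  exact h5.symm

/-- The fibres of a free quotient have the dimension of the group. The orbits fill the fibres, so
their dimension is not smaller; this uses that `G` has countably many charts. -/
theorem IsQuot.dim_eq [SecondCountableTopology G] (h : IsQuot G d n U p)
    (hfree : ∀ (g : G), ∀ z ∈ U, g • z = z → g = 1) {x₀ : M} (hx₀ : x₀ ∈ U) : n + dG = d := by
  apply le_antisymm
  -- the orbit directions form a `dG`-dimensional subspace of the kernel of the differential
  · have h1 := LinearMap.finrank_range_add_finrank_ker (diff d n p x₀).toLinearMap
    have h2 : Module.finrank ℝ (LinearMap.range (diff d n p x₀).toLinearMap) = n := by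
      rw [LinearMap.range_eq_top.2 (h.submersion x₀ hx₀)]; simp
    have h3 : LinearMap.range (infAction dG d G x₀).toLinearMap ≤
        LinearMap.ker (diff d n p x₀).toLinearMap := by
      rintro _ ⟨ξ, rfl⟩
      exact h.diff_infAction hx₀ ξ
    have h4 := Submodule.finrank_mono h3
    have h5 : Module.finrank ℝ (LinearMap.range (infAction dG d G x₀).toLinearMap) = dG := by
      have := LinearMap.finrank_range_of_inj (f := (infAction dG d G x₀).toLinearMap)
        (infAction_injective fun g hg => hfree g x₀ hx₀ hg)
      simpa using this
    simp only [finrank_euclideanSpace, Fintype.card_fin] at h1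
    omega
  -- the translates of a section fill a neighbourhood of `x₀`; in charts they form a countable
  -- union of locally Lipschitz images of sets of dimension at most `dG + n`, so the Hausdorff
  -- dimension of this neighbourhood, which is `d`, is at most `dG + n`
  · obtain ⟨s, hs0, hs⟩ := h.exists_section hx₀
    obtain ⟨C, hC, hCu⟩ := TopologicalSpace.countable_cover_nhds
      (f := fun g : G => (chartAt (Euc dG) g).source)
      (fun g => (chartAt (Euc dG) g).open_source.mem_nhds (mem_chart_source _ g))
    set c := extChartAt (𝓡 d) x₀
    set cb := extChartAt (𝓡 n) (p x₀)
    let P : G → Euc dG × Euc n → M := fun g q => (extChartAt (𝓡 dG) g).symm q.1 • s (cb.symm q.2)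
    let A : G → Set (Euc dG × Euc n) := fun g => {q | q.1 ∈ (extChartAt (𝓡 dG) g).target ∧
      q.2 ∈ cb.target ∧ ContMDiffAt (𝓡 n) (𝓡 d) ∞ s (cb.symm q.2) ∧
      P g q ∈ (chartAt (Euc d) x₀).source}
    have hA : ∀ g, dimH ((fun q => c (P g q)) '' A g) ≤ ((dG + n : ℕ) : ENNReal) := by
      intro g
      refine (dimH_image_le_of_locally_lipschitzOn fun q hq => ?_).trans ?_
      · obtain ⟨h1, h2, h3, h4⟩ := hq
        have t1 : ContMDiffAt 𝓘(ℝ, Euc dG × Euc n) (𝓡 dG) ∞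
            (fun q : Euc dG × Euc n => (extChartAt (𝓡 dG) g).symm q.1) q :=
          ContMDiffAt.comp (I' := 𝓡 dG) (g := (extChartAt (𝓡 dG) g).symm) q
            (contMDiffAt_chart_symm h1) contDiffAt_fst.contMDiffAt
        have t2 : ContMDiffAt 𝓘(ℝ, Euc dG × Euc n) (𝓡 n) ∞
            (fun q : Euc dG × Euc n => cb.symm q.2) q :=
          ContMDiffAt.comp (I' := 𝓡 n) (g := cb.symm) q
            (contMDiffAt_chart_symm h2) contDiffAt_snd.contMDiffAt
        have t3 : ContMDiffAt 𝓘(ℝ, Euc dG × Euc n) (𝓡 d) ∞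
            (fun q : Euc dG × Euc n => s (cb.symm q.2)) q :=
          ContMDiffAt.comp (I' := 𝓡 n) (g := s) q h3 t2
        have t4 : ContMDiffAt 𝓘(ℝ, Euc dG × Euc n) (𝓡 d) ∞ (P g) q := contMDiffAt_smul_of t1 t3
        have t5 : ContMDiffAt 𝓘(ℝ, Euc dG × Euc n) (𝓡 d) ∞ (fun q => c (P g q)) q :=
          ContMDiffAt.comp (I' := 𝓡 d) (g := c) q (contMDiffAt_chart h4) t4
        obtain ⟨K, t, ht, hK⟩ := (t5.contDiffAt.of_le (m := 1) (by simp)).exists_lipschitzOnWith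
        exact ⟨K, t, mem_nhdsWithin_of_mem_nhds ht, hK⟩
      · refine (dimH_mono (Set.subset_univ _)).trans ?_
        rw [Real.dimH_univ_eq_finrank]
        simp
    have hO : (⋃ g ∈ C, (fun q => c (P g q)) '' A g) ∈ 𝓝 (c x₀) := by
      have e1 : ∀ᶠ x in 𝓝 x₀, x ∈ U ∧ x ∈ (chartAt (Euc d) x₀).source ∧
          p x ∈ (chartAt (Euc n) (p x₀)).source ∧ s (p x) ∈ U ∧
          ContMDiffAt (𝓡 n) (𝓡 d) ∞ s (p x) ∧ p (s (p x)) = p x := by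
        have hc := (h.smooth x₀ hx₀).continuousAt
        filter_upwards [h.eventually_mem hx₀, chart_source_mem_nhds (mem_chart_source (Euc d) x₀),
          hc.eventually (chart_source_mem_nhds (mem_chart_source (Euc n) (p x₀))),
          hc.eventually hs] with x a1 a2 a3 a4 using ⟨a1, a2, a3, a4⟩
      filter_upwards [eventually_chart_symm (mem_chart_source (Euc d) x₀) e1,
        (isOpen_extChartAt_target (I := 𝓡 d) x₀).mem_nhds (mem_extChartAt_target x₀)] with u hu hut
      obtain ⟨a1, a2, a3, a4, a5, a6⟩ := hu
      set x := c.symm u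
      obtain ⟨g, hg⟩ := (h.eq_iff _ a4 _ a1).1 a6
      have hgC : g ∈ ⋃ g ∈ C, (chartAt (Euc dG) g).source := by rw [hCu]; trivial
      simp only [Set.mem_iUnion] at hgC ⊢
      obtain ⟨g', hg', hgg⟩ := hgC
      have b1 : (extChartAt (𝓡 dG) g').symm (extChartAt (𝓡 dG) g' g) = g :=
        (extChartAt (𝓡 dG) g').left_inv (by simpa using hgg)
      have b2 : cb.symm (cb (p x)) = p x := cb.left_inv (by simpa [cb] using a3)
      have b3 : P g' (extChartAt (𝓡 dG) g' g, cb (p x)) = x := by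
        simp only [P, b1, b2, hg]
      refine ⟨g', hg', (extChartAt (𝓡 dG) g' g, cb (p x)),
        ⟨(extChartAt (𝓡 dG) g').map_source (by simpa using hgg),
          cb.map_source (by simpa [cb] using a3), by simpa only [b2] using a5,
          by rw [b3]; exact a2⟩, ?_⟩
      simp only [b3]
      exact c.right_inv hut
    have h1 := Real.dimH_of_mem_nhds hO
    rw [dimH_bUnion hC] at h1
    have h2 : (Module.finrank ℝ (Euc d) : ENNReal) ≤ ((dG + n : ℕ) : ENNReal) := by
      rw [← h1]
      exact iSup₂_le fun g _ => hA g
    simp only [finrank_euclideanSpace, Fintype.card_fin] at h2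
    have h3 : d ≤ dG + n := by exact_mod_cast h2
    omega

/-- The kernel of the differential of a free quotient is tangent to the orbits. -/
theorem IsQuot.exists_infAction (h : IsQuot G d n U p) (hdim : n + dG = d)
    {z : M} (hz : z ∈ U) (hfree : ∀ g : G, g • z = z → g = 1) {v : Euc d}
    (hv : diff d n p z v = 0) : ∃ ξ, infAction dG d G z ξ = v := by
  have h1 := LinearMap.finrank_range_add_finrank_ker (diff d n p z).toLinearMap
  have h2 : Module.finrank ℝ (LinearMap.range (diff d n p z).toLinearMap) = n := by
    rw [LinearMap.range_eq_top.2 (h.submersion z hz)]; simp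
  have h3 : LinearMap.range (infAction dG d G z).toLinearMap ≤
      LinearMap.ker (diff d n p z).toLinearMap := by
    rintro _ ⟨ξ, rfl⟩
    exact h.diff_infAction hz ξ
  have h5 : Module.finrank ℝ (LinearMap.range (infAction dG d G z).toLinearMap) = dG := by
    have := LinearMap.finrank_range_of_inj (f := (infAction dG d G z).toLinearMap)
      (infAction_injective hfree)
    simpa using this
  simp only [finrank_euclideanSpace, Fintype.card_fin] at h1
  have h6 := Submodule.eq_of_le_of_finrank_eq h3 (by omega)
  have h7 : v ∈ LinearMap.ker (diff d n p z).toLinearMap := hv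
  rw [← h6] at h7
  exact h7

end Quotients

/-! ### Moving frames -/

section Frames

/-- `ρ` is a left moving frame on the open invariant set `O`: a smooth equivariant map to `G`. -/
structure IsFrame (G : Type*) [Group G] {M : Type*} (dG d : ℕ) [TopologicalSpace G]
    [ChartedSpace (Euc dG) G] [TopologicalSpace M] [ChartedSpace (Euc d) M] [MulAction G M]
    (O : Set M) (ρ : M → G) : Prop where
  isOpen : IsOpen O
  smul_mem : ∀ (g : G), ∀ z ∈ O, g • z ∈ O
  smooth : ∀ z ∈ O, ContMDiffAt (𝓡 d) (𝓡 dG) ∞ ρ z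
  equivariant : ∀ (g : G), ∀ z ∈ O, ρ (g • z) = g * ρ z

variable {G : Type*} {dG : ℕ} [Group G] [TopologicalSpace G] [ChartedSpace (Euc dG) G]
  [LieGroup (𝓡 dG) ∞ G]
variable {M : Type*} {d : ℕ} [TopologicalSpace M] [ChartedSpace (Euc d) M]
  [IsManifold (𝓡 d) ∞ M] [MulAction G M] [ContMDiffSMul (𝓡 dG) (𝓡 d) ∞ G M]
variable {B : Type*} {n : ℕ} [TopologicalSpace B] [ChartedSpace (Euc n) B] [IsManifold (𝓡 n) ∞ B]
variable {U : Set M} {p : M → B}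

/-- In the coordinates `(g, b) ↦ g • s b` given by a section `s`, the group component is smooth near
the section. -/
theorem exists_group_component (h : IsQuot G d n U p) (hdim : n + dG = d)
    (hfree : ∀ (g : G), ∀ z ∈ U, g • z = z → g = 1) {s : B → M} {b : B}
    (hs : ∀ᶠ b' in 𝓝 b, s b' ∈ U ∧ ContMDiffAt (𝓡 n) (𝓡 d) ∞ s b' ∧ p (s b') = b') :
    ∃ γ : M → G, ContMDiffAt (𝓡 d) (𝓡 dG) ∞ γ (s b) ∧
      ∀ᶠ x in 𝓝 (s b), γ x • s (p x) = x := by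
  obtain ⟨hbU, hbs, hpb⟩ := hs.self_of_nhds
  set x₁ := s b with hx₁
  set c := extChartAt (𝓡 d) x₁
  set cb := extChartAt (𝓡 n) b
  set cG := extChartAt (𝓡 dG) (1 : G)
  let P : Euc dG × Euc n → M := fun q => cG.symm q.1 • s (cb.symm q.2)
  let F : Euc dG × Euc n → Euc d := fun q => c (P q)
  let q₀ : Euc dG × Euc n := (cG 1, cb b)
  have hcG : cG.symm (cG 1) = 1 := cG.left_inv (mem_extChartAt_source _)
  have hcb : cb.symm (cb b) = b := cb.left_inv (mem_extChartAt_source _)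
  have hP0 : P q₀ = x₁ := by simp only [P, q₀, hcG, hcb, one_smul, hx₁]
  have hPs : ∀ᶠ q in 𝓝 q₀, ContMDiffAt 𝓘(ℝ, Euc dG × Euc n) (𝓡 d) ∞ P q := by
    have e1 : ∀ᶠ q in 𝓝 q₀, q.1 ∈ cG.target :=
      continuousAt_fst.eventually ((isOpen_extChartAt_target (I := 𝓡 dG) (1 : G)).mem_nhds
        (mem_extChartAt_target _))
    have e2 : ∀ᶠ q in 𝓝 q₀, q.2 ∈ cb.target :=
      continuousAt_snd.eventually ((isOpen_extChartAt_target (I := 𝓡 n) b).mem_nhds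
        (mem_extChartAt_target _))
    have e3 : ∀ᶠ q in 𝓝 q₀, ContMDiffAt (𝓡 n) (𝓡 d) ∞ s (cb.symm q.2) := by
      have := eventually_chart_symm (mem_chart_source (Euc n) b) hs
      filter_upwards [(show ContinuousAt Prod.snd q₀ from continuousAt_snd).eventually this] with q hq using hq.2.1
    filter_upwards [e1, e2, e3] with q h1 h2 h3
    have t1 : ContMDiffAt 𝓘(ℝ, Euc dG × Euc n) (𝓡 dG) ∞
        (fun q : Euc dG × Euc n => cG.symm q.1) q :=
      ContMDiffAt.comp (I' := 𝓡 dG) (g := cG.symm) q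
        (contMDiffAt_chart_symm h1) contDiffAt_fst.contMDiffAt
    have t2 : ContMDiffAt 𝓘(ℝ, Euc dG × Euc n) (𝓡 n) ∞
        (fun q : Euc dG × Euc n => cb.symm q.2) q :=
      ContMDiffAt.comp (I' := 𝓡 n) (g := cb.symm) q
        (contMDiffAt_chart_symm h2) contDiffAt_snd.contMDiffAt
    exact contMDiffAt_smul_of t1 (ContMDiffAt.comp (I' := 𝓡 n) (g := s) q h3 t2)
  have hPc : ContinuousAt P q₀ := hPs.self_of_nhds.continuousAt
  have hPsrc : ∀ᶠ q in 𝓝 q₀, P q ∈ (chartAt (Euc d) x₁).source := by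
    rw [ContinuousAt, hP0] at hPc
    exact hPc.eventually (chart_source_mem_nhds (mem_chart_source _ _))
  have hFs : ∀ᶠ q in 𝓝 q₀, ContDiffAt ℝ ∞ F q := by
    filter_upwards [hPs, hPsrc] with q h1 h2
    rw [← contMDiffAt_iff_contDiffAt]
    exact ContMDiffAt.comp (I' := 𝓡 d) (g := c) q (contMDiffAt_chart h2) h1
  have hFd := (hFs.self_of_nhds.differentiableAt (by simp)).hasFDerivAt
  -- the two partial derivatives
  have hF1 : ∀ ξ, fderiv ℝ F q₀ (ξ, 0) = infAction dG d G x₁ ξ := by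
    intro ξ
    have h1 : HasFDerivAt (fun ξ : Euc dG => (ξ, cb b)) (ContinuousLinearMap.inl ℝ _ _) (cG 1) :=
      hasFDerivAt_prodMk_left _ _
    have h2 := (HasFDerivAt.comp (g := F) (cG 1) hFd h1).fderiv
    have h3 : F ∘ (fun ξ : Euc dG => (ξ, cb b)) = inCharts dG d 1 x₁ (fun g : G => g • x₁) := by
      funext ξ
      simp only [F, P, Function.comp_apply, inCharts, hcb, ← hx₁]
      rfl
    have h4 : (fun g : G => g • x₁) 1 ∈ (chartAt (Euc d) x₁).source := by simp
    rw [h3, inCharts_fderiv (f := fun g : G => g • x₁) (mem_chart_source _ _) h4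
      (contMDiffAt_diffble (contMDiff_orb x₁).contMDiffAt), diff_chart_symm_self] at h2
    have h5 := DFunLike.congr_fun h2 ξ
    simp only [ContinuousLinearMap.comp_apply, one_smul, diff_extChartAt_self,
      ContinuousLinearMap.id_apply, ContinuousLinearMap.inl_apply] at h5
    exact h5.symm
  have hF2 : ∀ v, fderiv ℝ F q₀ (0, v) = diff n d s b v := by
    intro v
    have h1 : HasFDerivAt (fun v : Euc n => (cG 1, v)) (ContinuousLinearMap.inr ℝ _ _) (cb b) :=
      hasFDerivAt_prodMk_right _ _
    have h2 := (HasFDerivAt.comp (g := F) (cb b) hFd h1).fderiv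
    have h3 : F ∘ (fun v : Euc n => (cG 1, v)) = inCharts n d b (s b) s := by
      funext v
      simp only [F, P, Function.comp_apply, inCharts, hcG, one_smul]
      rfl
    rw [h3, inCharts_fderiv_self (contMDiffAt_diffble hbs)] at h2
    exact (DFunLike.congr_fun h2 v).symm
  have hsec : ∀ᶠ b' in 𝓝 b, p (s b') = b' := hs.mono fun _ h => h.2.2
  have hinj : Function.Injective (fderiv ℝ F q₀) := by
    rw [injective_iff_map_eq_zero]
    rintro ⟨ξ, v⟩ hξv
    have h1 : ((ξ, v) : Euc dG × Euc n) = (ξ, 0) + (0, v) := by simp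
    rw [h1, map_add, hF1, hF2] at hξv
    have h2 := congrArg (diff d n p x₁) hξv
    rw [map_add, h.diff_infAction hbU, zero_add, map_zero,
      diff_comp_section (h.smooth _ hbU) hbs hsec] at h2
    rw [h2, map_zero, add_zero] at hξv
    have h3 := infAction_injective (fun g hg => hfree g x₁ hbU hg) (hξv.trans (map_zero _).symm)
    rw [h2, h3]; rfl
  let A : (Euc dG × Euc n) ≃L[ℝ] Euc d :=
    (LinearEquiv.ofInjectiveOfFinrankEq (fderiv ℝ F q₀).toLinearMap hinj
      (by simp; omega)).toContinuousLinearEquiv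
  obtain ⟨k, hk0, hk1, -⟩ := exists_smooth_local_inverse hFs A (by
    have : (A : (Euc dG × Euc n) →L[ℝ] Euc d) = fderiv ℝ F q₀ := ContinuousLinearMap.ext fun q => rfl
    rwa [this])
  have hF0 : F q₀ = c x₁ := by simp only [F, hP0]
  rw [hF0] at hk0 hk1
  have hct : Filter.Tendsto c (𝓝 x₁) (𝓝 (c x₁)) := (contMDiffAt_extChartAt (n := ∞)).continuousAt
  have hkc : Filter.Tendsto (fun x => k (c x)) (𝓝 x₁) (𝓝 q₀) := by
    have h1 : ContinuousAt k (c x₁) := hk1.self_of_nhds.1.continuousAt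
    have h2 := h1.tendsto.comp hct
    rwa [hk0] at h2
  refine ⟨fun x => cG.symm (k (c x)).1, ?_, ?_⟩
  · have t1 : ContMDiffAt (𝓡 d) (𝓡 d) ∞ c x₁ := contMDiffAt_extChartAt
    have t2 : ContMDiffAt (𝓡 d) (𝓡 dG) ∞ (fun u => (k u).1) (c x₁) :=
      (hk1.self_of_nhds.1.fst).contMDiffAt
    have t3 : ContMDiffAt (𝓡 dG) (𝓡 dG) ∞ cG.symm (k (c x₁)).1 := by
      rw [hk0]; exact contMDiffAt_chart_symm (mem_extChartAt_target _)
    have t4 : ContMDiffAt (𝓡 d) (𝓡 dG) ∞ (fun x => (k (c x)).1) x₁ :=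
      ContMDiffAt.comp (I' := 𝓡 d) (g := fun u => (k u).1) x₁ t2 t1
    exact ContMDiffAt.comp (I' := 𝓡 dG) (g := cG.symm) (f := fun x => (k (c x)).1) x₁ t3 t4
  · have hs' : ∀ᶠ q in 𝓝 q₀, s (cb.symm q.2) ∈ U ∧ p (s (cb.symm q.2)) = cb.symm q.2 := by
      have := eventually_chart_symm (mem_chart_source (Euc n) b) hs
      filter_upwards [(show ContinuousAt Prod.snd q₀ from continuousAt_snd).eventually this] with q hq using ⟨hq.1, hq.2.2⟩
    filter_upwards [hct.eventually hk1, hkc.eventually hPsrc, hkc.eventually hs',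
      chart_source_mem_nhds (mem_chart_source (Euc d) x₁)] with x h1 h2 h3 h4
    have h5 : P (k (c x)) = x :=
      c.injOn (by simpa [c] using h2) (by simpa [c] using h4) h1.2
    have h6 : p x = cb.symm (k (c x)).2 := by
      rw [← h3.2, ← h.smul_eq (cG.symm (k (c x)).1) h3.1]
      exact congrArg p h5.symm
    rw [h6]
    exact h5

/-- A free quotient has a moving frame over a neighbourhood of each point of the base. -/
theorem IsQuot.exists_frame (h : IsQuot G d n U p) (hdim : n + dG = d)
    (hfree : ∀ (g : G), ∀ z ∈ U, g • z = z → g = 1) {x₀ : M} (hx₀ : x₀ ∈ U) :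
    ∃ (O : Set M) (ρ : M → G), IsFrame G dG d O ρ ∧ O ⊆ U ∧ x₀ ∈ O := by
  classical
  obtain ⟨s, hs0, hs⟩ := h.exists_section hx₀
  obtain ⟨V, hV, hVo, hxV⟩ := eventually_nhds_iff.1 hs
  -- every orbit over `V` meets the section in one point, and freeness makes the group element that
  -- moves this point to `x` unique
  let ρ : M → G := fun x => if hx : ∃ g : G, g • s (p x) = x then hx.choose else 1
  have hex : ∀ x ∈ U, p x ∈ V → ∃ g : G, g • s (p x) = x := fun x hx hpx =>
    (h.eq_iff _ (hV _ hpx).1 _ hx).1 (hV _ hpx).2.2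
  have hρ : ∀ x ∈ U, p x ∈ V → ρ x • s (p x) = x := by
    intro x hx hpx
    simp only [ρ, dif_pos (hex x hx hpx)]
    exact (hex x hx hpx).choose_spec
  have huniq : ∀ x ∈ U, p x ∈ V → ∀ g : G, g • s (p x) = x → g = ρ x := by
    intro x hx hpx g hg
    have h1 : (g⁻¹ * ρ x) • s (p x) = s (p x) := by
      rw [mul_smul, hρ x hx hpx, inv_smul_eq_iff, hg]
    exact (inv_mul_eq_one.1 (hfree _ _ (hV _ hpx).1 h1))
  have heq : ∀ (g : G), ∀ x ∈ U, p x ∈ V → ρ (g • x) = g * ρ x := by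
    intro g x hx hpx
    have hpg := h.smul_eq g hx
    refine (huniq _ (h.smul_mem g x hx) (by rwa [hpg]) _ ?_).symm
    rw [hpg, mul_smul, hρ x hx hpx]
  have hsm : ∀ x ∈ U, p x ∈ V → ContMDiffAt (𝓡 d) (𝓡 dG) ∞ ρ (s (p x)) := by
    intro x hx hpx
    obtain ⟨γ, hγ, hγ'⟩ := exists_group_component h hdim hfree (s := s) (b := p x)
      (eventually_nhds_iff.2 ⟨V, hV, hVo, hpx⟩)
    obtain ⟨b1, b2, b3⟩ := hV _ hpx
    refine hγ.congr_of_eventuallyEq ?_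
    have hc : ContinuousAt p (s (p x)) := (h.smooth _ b1).continuousAt
    rw [ContinuousAt, b3] at hc
    filter_upwards [hγ', h.eventually_mem b1, hc.eventually (hVo.mem_nhds hpx)] with y h1 h2 h3
    exact (huniq y h2 h3 _ h1).symm
  refine ⟨U ∩ p ⁻¹' V, ρ, ⟨?_, ?_, ?_, ?_⟩, Set.inter_subset_left, hx₀, hxV⟩
  · rw [isOpen_iff_mem_nhds]
    rintro x ⟨hx, hpx⟩
    exact Filter.inter_mem (h.isOpen.mem_nhds hx)
      ((h.smooth x hx).continuousAt.preimage_mem_nhds (hVo.mem_nhds hpx))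
  · rintro g x ⟨hx, hpx⟩
    exact ⟨h.smul_mem g x hx, by rwa [Set.mem_preimage, h.smul_eq g hx]⟩
  · rintro x ⟨hx, hpx⟩
    have h1 : ContMDiffAt (𝓡 d) (𝓡 d) ∞ (fun y : M => (ρ x)⁻¹ • y) x :=
      (contMDiff_smul_left dG _).contMDiffAt
    have h2 : (ρ x)⁻¹ • x = s (p x) := by rw [inv_smul_eq_iff, hρ x hx hpx]
    have h3 : ContMDiffAt (𝓡 d) (𝓡 dG) ∞ (fun y : M => ρ ((ρ x)⁻¹ • y)) x :=
      ContMDiffAt.comp (I' := 𝓡 d) (g := ρ) x (by rw [h2]; exact hsm x hx hpx) h1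
    have h4 : ContMDiffAt (𝓡 d) (𝓡 dG) ∞ (fun y : M => ρ x * ρ ((ρ x)⁻¹ • y)) x :=
      ContMDiffAt.comp (I' := 𝓡 dG) (g := fun k : G => ρ x * k) x
        (contMDiff_mul_left (I := 𝓡 dG) (n := ∞)).contMDiffAt h3
    refine h4.congr_of_eventuallyEq ?_
    filter_upwards [h.eventually_mem hx, (h.smooth x hx).continuousAt.eventually
      (hVo.mem_nhds hpx)] with y h5 h6
    rw [heq _ y h5 h6, mul_inv_cancel_left]
  · rintro g x ⟨hx, hpx⟩
    exact heq g x hx hpx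

end Frames

/-! ### Slices of a free action -/

section Slices

variable {G : Type*} {dG : ℕ} [Group G] [TopologicalSpace G] [ChartedSpace (Euc dG) G]
  [LieGroup (𝓡 dG) ∞ G]
variable {M : Type*} {d : ℕ} [TopologicalSpace M] [ChartedSpace (Euc d) M]
  [IsManifold (𝓡 d) ∞ M] [MulAction G M] [ContMDiffSMul (𝓡 dG) (𝓡 d) ∞ G M]

/-- The Leibniz rule for `γ • h`, at a point where `γ` is the identity. -/
theorem diff_smul_of_eq_one {N : Type*} {e : ℕ} [TopologicalSpace N] [ChartedSpace (Euc e) N]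
    {γ : N → G} {h : N → M} {y : N} (hγ : ContMDiffAt (𝓡 e) (𝓡 dG) ∞ γ y)
    (hh : ContMDiffAt (𝓡 e) (𝓡 d) ∞ h y) (h1 : γ y = 1) (v : Euc e) :
    diff e d (fun y => γ y • h y) y v =
      infAction dG d G (h y) (diff e dG γ y v) + diff e d h y v := by
  let f : G × M → M := fun q => q.1 • q.2
  have hf : MDifferentiableAt ((𝓡 dG).prod (𝓡 d)) (𝓡 d) f (γ y, h y) :=
    (contMDiff_smul (I := 𝓡 dG) (I' := 𝓡 d) (n := ∞)).contMDiffAt.mdifferentiableAt (by simp)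
  have h2 : MDifferentiableAt (𝓡 e) ((𝓡 dG).prod (𝓡 d)) (fun y => (γ y, h y)) y :=
    (contMDiffAt_diffble hγ).prodMk (contMDiffAt_diffble hh)
  have h3 := mfderiv_comp y hf h2
  rw [mfderiv_prodMk (contMDiffAt_diffble hγ) (contMDiffAt_diffble hh)] at h3
  have h4 : diff e d (fun y => γ y • h y) y v =
    mfderiv ((𝓡 dG).prod (𝓡 d)) (𝓡 d) f (γ y, h y) (diff e dG γ y v, diff e d h y v) :=
    DFunLike.congr_fun h3 v
  rw [h4]
  refine (mfderiv_prod_eq_add_apply hf).trans ?_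
  have h5 : (fun z : M => f (γ y, z)) = id := by funext z; simp [f, h1]
  have h6 : mfderiv (𝓡 d) (𝓡 d) (fun z : M => f (γ y, z)) (h y) (diff e d h y v) =
      diff e d h y v := by
    rw [h5, mfderiv_id]; rfl
  have h7 : mfderiv (𝓡 dG) (𝓡 d) (fun g : G => f (g, h y)) (γ y) (diff e dG γ y v) =
      infAction dG d G (h y) (diff e dG γ y v) := by
    rw [h1]; rfl
  exact congrArg₂ (· + ·) h7 h6

variable {O : Set M} {ρ : M → G}

theorem IsFrame.eq_one (hρ : IsFrame G dG d O ρ) {z : M} (hz : z ∈ O) (g : G) (h : g • z = z) :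
    g = 1 := by
  have := hρ.equivariant g z hz
  rw [h] at this
  exact (mul_eq_right.1 this.symm)

/-- The projection of the domain of a frame onto the slice through `z₀`, along the orbits. -/
def sliceProj (ρ : M → G) (z₀ z : M) : M := (ρ z₀ * (ρ z)⁻¹) • z

theorem sliceProj_self (z₀ : M) : sliceProj ρ z₀ z₀ = z₀ := by simp [sliceProj]

theorem sliceProj_smul (hρ : IsFrame G dG d O ρ) (z₀ : M) (g : G) {z : M} (hz : z ∈ O) :
    sliceProj ρ z₀ (g • z) = sliceProj ρ z₀ z := by
  rw [sliceProj, hρ.equivariant g z hz, sliceProj, smul_smul]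
  group

theorem sliceProj_mem (hρ : IsFrame G dG d O ρ) (z₀ : M) {z : M} (hz : z ∈ O) :
    sliceProj ρ z₀ z ∈ O := hρ.smul_mem _ _ hz

theorem sliceProj_idem (hρ : IsFrame G dG d O ρ) (z₀ : M) {z : M} (hz : z ∈ O) :
    sliceProj ρ z₀ (sliceProj ρ z₀ z) = sliceProj ρ z₀ z := sliceProj_smul hρ z₀ _ hz

theorem sliceProj_smooth (hρ : IsFrame G dG d O ρ) (z₀ : M) {z : M} (hz : z ∈ O) :
    ContMDiffAt (𝓡 d) (𝓡 d) ∞ (sliceProj ρ z₀) z := by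
  refine contMDiffAt_smul_of (dG := dG) ?_ contMDiffAt_id
  exact (contMDiffAt_const (I' := 𝓡 dG)).mul ((hρ.smooth z hz).inv)

/-- The differential of the projection onto the slice is idempotent, and its kernel consists of the
orbit directions; therefore its rank is the codimension of the orbits. -/
theorem diff_sliceProj (hρ : IsFrame G dG d O ρ) {z₀ : M} (hz₀ : z₀ ∈ O) :
    (∀ v, diff d d (sliceProj ρ z₀) z₀ (diff d d (sliceProj ρ z₀) z₀ v) =
      diff d d (sliceProj ρ z₀) z₀ v) ∧
    Module.finrank ℝ (LinearMap.range (diff d d (sliceProj ρ z₀) z₀).toLinearMap) + dG = d := by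
  set τ := sliceProj ρ z₀
  have hsm := contMDiffAt_diffble (sliceProj_smooth hρ z₀ hz₀)
  have hτ0 : τ z₀ = z₀ := sliceProj_self z₀
  constructor
  · intro v
    have h1 : MDifferentiableAt (𝓡 d) (𝓡 d) τ (τ z₀) := by rwa [hτ0]
    have h2 := diff_comp h1 hsm
    have h3 : diff d d (τ ∘ τ) z₀ = diff d d τ z₀ := diff_congr (by
      filter_upwards [hρ.isOpen.mem_nhds hz₀] with y hy using sliceProj_idem hρ z₀ hy)
    rw [h3, hτ0] at h2
    exact (DFunLike.congr_fun h2 v).symm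
  · have hker : LinearMap.ker (diff d d τ z₀).toLinearMap =
        LinearMap.range (infAction dG d G z₀).toLinearMap := by
      apply le_antisymm
      · intro v hv
        have h1 : ContMDiffAt (𝓡 d) (𝓡 dG) ∞ (fun z => ρ z₀ * (ρ z)⁻¹) z₀ :=
          (contMDiffAt_const (I' := 𝓡 dG)).mul ((hρ.smooth z₀ hz₀).inv)
        have h4 : diff d d (id : M → M) z₀ v = v := DFunLike.congr_fun (diff_id (d := d) z₀) v
        have h2 : diff d d τ z₀ v =
            infAction dG d G z₀ (diff d dG (fun z => ρ z₀ * (ρ z)⁻¹) z₀ v) + v :=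
          (diff_smul_of_eq_one (M := M) h1 contMDiffAt_id (by simp) v).trans (congrArg _ h4)
        have h3 : diff d d τ z₀ v = 0 := hv
        rw [h3] at h2
        refine ⟨-(diff d dG (fun z => ρ z₀ * (ρ z)⁻¹) z₀ v), ?_⟩
        have h6 := eq_neg_of_add_eq_zero_left h2.symm
        change infAction dG d G z₀ (-_) = v
        rw [map_neg, h6, neg_neg]
      · rintro _ ⟨ξ, rfl⟩
        have h1 : MDifferentiableAt (𝓡 d) (𝓡 d) τ ((fun g : G => g • z₀) 1) := by simpa using hsm
        have h2 := diff_comp (f := fun g : G => g • z₀) (g := τ) h1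
          (contMDiffAt_diffble (contMDiff_orb (dG := dG) z₀).contMDiffAt)
        have h3 : τ ∘ (fun g : G => g • z₀) = fun _ => τ z₀ := by
          funext g; exact sliceProj_smul hρ z₀ g hz₀
        have h4 : diff dG d (fun _ : G => τ z₀) 1 = 0 := mfderiv_const
        rw [h3, h4] at h2
        have h5 := DFunLike.congr_fun h2 ξ
        simp only [one_smul] at h5
        exact h5.symm
    have h1 := LinearMap.finrank_range_add_finrank_ker (diff d d τ z₀).toLinearMap
    have h5 : Module.finrank ℝ (LinearMap.range (infAction dG d G z₀).toLinearMap) = dG := by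
      have := LinearMap.finrank_range_of_inj (f := (infAction dG d G z₀).toLinearMap)
        (infAction_injective (hρ.eq_one hz₀))
      simpa using this
    rw [hker, h5] at h1
    simpa using h1

/-- Near `z₀`, slice coordinates `f` are invariant functions that separate the orbits, and `j` is
the parametrization of the slice by these coordinates. -/
theorem exists_slice_coordinates (hρ : IsFrame G dG d O ρ) {z₀ : M} (hz₀ : z₀ ∈ O) {n : ℕ}
    (hn : n + dG = d) :
    ∃ (O' : Set M) (f : M → Euc n) (j : Euc n → M) (V : Set (Euc n)), IsOpen O' ∧ O' ⊆ O ∧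
      z₀ ∈ O' ∧ (∀ (g : G), ∀ z ∈ O', g • z ∈ O') ∧ IsOpen V ∧
      (∀ z ∈ O', ContMDiffAt (𝓡 d) (𝓡 n) ∞ f z ∧ f z ∈ V ∧ (∀ g : G, f (g • z) = f z) ∧
        ∃ g : G, g • j (f z) = z) ∧
      ∀ v ∈ V, ContMDiffAt (𝓡 n) (𝓡 d) ∞ j v ∧ j v ∈ O' ∧ f (j v) = v := by
  obtain ⟨hidem, hrank⟩ := diff_sliceProj hρ hz₀
  set τ := sliceProj ρ z₀ with hτ
  have hτ0 : τ z₀ = z₀ := sliceProj_self z₀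
  have hτs : ContMDiffAt (𝓡 d) (𝓡 d) ∞ τ z₀ := sliceProj_smooth hρ z₀ hz₀
  set c := extChartAt (𝓡 d) z₀
  set u₀ := c z₀
  have hcs : ∀ y ∈ (chartAt (Euc d) z₀).source, c.symm (c y) = y := fun y hy =>
    c.left_inv (by simpa [c] using hy)
  have hu₀ : c.symm u₀ = z₀ := hcs _ (mem_chart_source _ _)
  set A := diff d d τ z₀
  -- linear slice coordinates, which vanish on the directions of the orbit
  let E : (LinearMap.range A.toLinearMap) ≃ₗ[ℝ] Euc n := LinearEquiv.ofFinrankEq _ _ (by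
    simp only [finrank_euclideanSpace, Fintype.card_fin]; omega)
  let L : Euc d →L[ℝ] Euc n :=
    LinearMap.toContinuousLinearMap (E.toLinearMap ∘ₗ A.toLinearMap.rangeRestrict)
  have hLA : ∀ v w, L v = L w → A v = A w := by
    intro v w h
    have h1 := E.injective h
    exact congrArg Subtype.val h1
  have hAL : ∀ v w, A v = A w → L v = L w := by
    intro v w h
    exact congrArg E (Subtype.ext h)
  have hLsurj : LinearMap.range L.toLinearMap = ⊤ := by
    rw [LinearMap.range_eq_top]
    intro y
    obtain ⟨⟨_, v, rfl⟩, hv⟩ := E.surjective y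
    exact ⟨v, hv⟩
  obtain ⟨R, hR⟩ := L.exists_rightInverse_of_surjective hLsurj
  have hLAR : ∀ v, L (A (R v)) = v := by
    intro v
    rw [hAL (A (R v)) (R v) (hidem _)]
    exact DFunLike.congr_fun hR v
  -- `τ` in the chart
  set T := inCharts d d z₀ z₀ τ with hT
  have hτsrc : ∀ᶠ y in 𝓝 z₀, τ y ∈ (chartAt (Euc d) z₀).source := by
    have := hτs.continuousAt
    rw [ContinuousAt, hτ0] at this
    exact this.eventually (chart_source_mem_nhds (mem_chart_source _ _))
  have hTs : ∀ᶠ u in 𝓝 u₀, ContDiffAt ℝ ∞ T u := by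
    have h1 : ∀ᶠ y in 𝓝 z₀, ContDiffAt ℝ ∞ T (c y) := by
      filter_upwards [hρ.isOpen.mem_nhds hz₀, chart_source_mem_nhds (mem_chart_source (Euc d) z₀),
        hτsrc] with y h1 h2 h3
      exact inCharts_contDiffAt h2 h3 (sliceProj_smooth hρ z₀ h1)
    filter_upwards [eventually_chart_symm (mem_chart_source (Euc d) z₀) h1,
      (isOpen_extChartAt_target (I := 𝓡 d) z₀).mem_nhds (mem_extChartAt_target z₀)] with u hu hu'
    rwa [(extChartAt (𝓡 d) z₀).right_inv hu'] at hu
  have hTd : HasStrictFDerivAt T A u₀ := by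
    have h1 := hTs.self_of_nhds.hasStrictFDerivAt (by simp)
    have h2 := inCharts_fderiv_self (d := d) (e := d) (contMDiffAt_diffble hτs)
    rw [hτ0] at h2
    rwa [h2] at h1
  have hT0 : T u₀ = u₀ := by
    rw [hT, inCharts_apply (mem_chart_source _ _), hτ0]
  -- the linear slice coordinates are injective on the fixed points of `τ` near `z₀`
  obtain ⟨N, hNo, hN0, hN⟩ : ∃ N : Set (Euc d), IsOpen N ∧ u₀ ∈ N ∧ ∀ u ∈ N, ∀ u' ∈ N,
      T u = u → T u' = u' → L u = L u' → u = u' := by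
    have h1 := hTd.isLittleO.def (c := 1 / 2) (by norm_num)
    rw [nhds_prod_eq] at h1
    obtain ⟨N, ⟨hN0, hNo⟩, hN⟩ := ((nhds_basis_opens u₀).prod_self.eventually_iff).1 h1
    refine ⟨N, hNo, hN0, fun u hu u' hu' h2 h3 h4 => ?_⟩
    have h5 := hN (show (u, u') ∈ N ×ˢ N from ⟨hu, hu'⟩)
    simp only [h2, h3, map_sub, hLA _ _ h4, sub_self, sub_zero] at h5
    have h6 : ‖u - u'‖ ≤ 0 := by linarith [norm_nonneg (u - u')]
    exact sub_eq_zero.1 (norm_le_zero_iff.1 h6)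
  -- the slice coordinates and their inversion
  let f : M → Euc n := fun z => L (c (τ z) - u₀)
  let a : Euc n → Euc d := fun v => u₀ + R v
  have ha0 : a 0 = u₀ := by simp [a]
  have haS : ContDiff ℝ ∞ a := contDiff_const.add R.contDiff
  let k : Euc n → Euc n := fun v => L (T (a v) - u₀)
  have hk0 : k 0 = 0 := by simp only [k, ha0, hT0, sub_self, map_zero]
  have hks : ∀ᶠ v in 𝓝 (0 : Euc n), ContDiffAt ℝ ∞ k v := by
    have h1 : ContinuousAt a 0 := haS.continuous.continuousAt
    rw [ContinuousAt, ha0] at h1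
    filter_upwards [h1.eventually hTs] with v hv
    exact L.contDiff.contDiffAt.comp v ((hv.comp v haS.contDiffAt).sub contDiffAt_const)
  have hkd : HasFDerivAt k ((ContinuousLinearEquiv.refl ℝ (Euc n) : Euc n ≃L[ℝ] Euc n) :
      Euc n →L[ℝ] Euc n) 0 := by
    have h1 : HasFDerivAt a R 0 := (R.hasFDerivAt).const_add u₀
    have h2 : HasFDerivAt T A (a 0) := by rw [ha0]; exact hTd.hasFDerivAt
    have h3 := (L.hasFDerivAt).comp (0 : Euc n) ((h2.comp (0 : Euc n) h1).sub_const u₀)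
    have h4 : L.comp (A.comp R) = ContinuousLinearMap.id ℝ (Euc n) :=
      ContinuousLinearMap.ext hLAR
    rw [h4] at h3
    exact h3
  obtain ⟨j₀, hj00, hj0, -⟩ := exists_smooth_local_inverse hks _ hkd
  rw [hk0] at hj00 hj0
  let j : Euc n → M := fun v => τ (c.symm (a (j₀ v)))
  have hac : Filter.Tendsto (fun v => a (j₀ v)) (𝓝 0) (𝓝 u₀) := by
    have h1 : ContinuousAt j₀ 0 := hj0.self_of_nhds.1.continuousAt
    have h2 := haS.continuous.continuousAt.tendsto.comp h1.tendsto
    rwa [hj00, ha0] at h2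
  have hcc : Filter.Tendsto (fun v => c.symm (a (j₀ v))) (𝓝 0) (𝓝 z₀) := by
    have h1 : ContinuousAt c.symm u₀ := continuousAt_extChartAt_symm z₀
    have h2 := h1.tendsto.comp hac
    rwa [hu₀] at h2
  have hgood : ∀ᶠ y in 𝓝 z₀, y ∈ O ∧ τ y ∈ (chartAt (Euc d) z₀).source ∧ c (τ y) ∈ N := by
    have h1 : ContinuousAt τ z₀ := hτs.continuousAt
    rw [ContinuousAt, hτ0] at h1
    filter_upwards [hρ.isOpen.mem_nhds hz₀, hτsrc,
      h1.eventually ((continuousAt_extChartAt (I := 𝓡 d) z₀).eventually (hNo.mem_nhds hN0))]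
      with y h1 h2 h3 using ⟨h1, h2, h3⟩
  have hVgood : ∀ᶠ v in 𝓝 (0 : Euc n), ContMDiffAt (𝓡 n) (𝓡 d) ∞ j v ∧
      c.symm (a (j₀ v)) ∈ O ∧ j v ∈ (chartAt (Euc d) z₀).source ∧ c (j v) ∈ N ∧ f (j v) = v := by
    filter_upwards [hj0, hac.eventually ((isOpen_extChartAt_target (I := 𝓡 d) z₀).mem_nhds
      (mem_extChartAt_target z₀)), hcc.eventually hgood] with v h1 h2 h3
    refine ⟨?_, h3.1, h3.2.1, h3.2.2, ?_⟩
    · have t1 : ContMDiffAt (𝓡 n) (𝓡 d) ∞ (fun v => a (j₀ v)) v :=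
        (haS.contDiffAt.comp v h1.1).contMDiffAt
      have t2 : ContMDiffAt (𝓡 n) (𝓡 d) ∞ (fun v => c.symm (a (j₀ v))) v :=
        ContMDiffAt.comp (I' := 𝓡 d) (g := c.symm) (f := fun v => a (j₀ v)) v
          (contMDiffAt_chart_symm h2) t1
      exact ContMDiffAt.comp (I' := 𝓡 d) (g := τ) (f := fun v => c.symm (a (j₀ v))) v
        (sliceProj_smooth hρ z₀ h3.1) t2
    · have h4 : f (j v) = k (j₀ v) := by
        have := sliceProj_idem hρ z₀ h3.1
        exact congrArg (fun y => L (c y - u₀)) this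
      rw [h4, h1.2]
  obtain ⟨V, hV, hVo, hV0⟩ := eventually_nhds_iff.1 hVgood
  have hfinv : ∀ (g : G), ∀ z ∈ O, f (g • z) = f z := fun g z hz => by
    simp only [f, hτ, sliceProj_smul hρ z₀ g hz]
  have hfs : ∀ z ∈ O, τ z ∈ (chartAt (Euc d) z₀).source → ContMDiffAt (𝓡 d) (𝓡 n) ∞ f z := by
    intro z hz hz'
    have t1 : ContMDiffAt (𝓡 d) (𝓡 d) ∞ (fun z => c (τ z)) z :=
      ContMDiffAt.comp (I' := 𝓡 d) (g := c) z (contMDiffAt_chart hz') (sliceProj_smooth hρ z₀ hz)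
    have t2 : ContDiff ℝ ∞ (fun u : Euc d => L (u - u₀)) :=
      L.contDiff.comp (contDiff_id.sub contDiff_const)
    exact ContMDiffAt.comp (I' := 𝓡 d) (g := fun u : Euc d => L (u - u₀)) (f := fun z => c (τ z)) z
      t2.contDiffAt.contMDiffAt t1
  have hTfix : ∀ y ∈ (chartAt (Euc d) z₀).source, τ y = y → T (c y) = c y := by
    intro y hy h
    rw [hT, inCharts_apply hy, h]
  refine ⟨{z | z ∈ O ∧ τ z ∈ (chartAt (Euc d) z₀).source ∧ c (τ z) ∈ N ∧ f z ∈ V}, f, j, V,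
    ?_, fun z hz => hz.1, ⟨hz₀, ?_⟩, ?_, hVo, ?_, ?_⟩
  · rw [isOpen_iff_mem_nhds]
    rintro z ⟨h1, h2, h3, h4⟩
    have hc1 : ContinuousAt τ z := (sliceProj_smooth hρ z₀ h1).continuousAt
    have hc2 : ContinuousAt c (τ z) := (contMDiffAt_chart (d := d) h2).continuousAt
    filter_upwards [hρ.isOpen.mem_nhds h1, hc1.eventually (chart_source_mem_nhds h2),
      hc1.eventually (hc2.eventually (hNo.mem_nhds h3)),
      (hfs z h1 h2).continuousAt.eventually (hVo.mem_nhds h4)] with y b1 b2 b3 b4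
    exact ⟨b1, b2, b3, b4⟩
  · rw [hτ0]
    refine ⟨mem_chart_source _ _, hN0, ?_⟩
    have : f z₀ = 0 := by
      simp only [f, hτ0]
      exact (congrArg L (sub_self u₀)).trans (map_zero L)
    rwa [this]
  · rintro g z ⟨h1, h2, h3, h4⟩
    refine ⟨hρ.smul_mem g z h1, ?_⟩
    rw [hfinv g z h1, hτ, sliceProj_smul hρ z₀ g h1]
    exact ⟨h2, h3, h4⟩
  · rintro z ⟨h1, h2, h3, h4⟩
    refine ⟨hfs z h1 h2, h4, fun g => hfinv g z h1, (ρ z₀ * (ρ z)⁻¹)⁻¹, ?_⟩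
    obtain ⟨b1, b2, b3, b4, b5⟩ := hV _ h4
    have b6 : τ (j (f z)) = j (f z) := sliceProj_idem hρ z₀ b2
    have b7 : τ (τ z) = τ z := sliceProj_idem hρ z₀ h1
    have b8 : c (j (f z)) = c (τ z) := by
      refine hN _ b4 _ h3 (hTfix _ b3 b6) (hTfix _ h2 b7) ?_
      have b9 : L (c (τ (j (f z))) - u₀) = L (c (τ z) - u₀) := b5
      rw [b6, map_sub, map_sub] at b9
      exact sub_left_injective b9
    have b9 : j (f z) = τ z := c.injOn (by simpa [c] using b3) (by simpa [c] using h2) b8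
    rw [b9, inv_smul_eq_iff]
    rfl
  · intro v hv
    obtain ⟨b1, b2, b3, b4, b5⟩ := hV _ hv
    have b6 : τ (j v) = j v := sliceProj_idem hρ z₀ b2
    refine ⟨b1, ⟨sliceProj_mem hρ z₀ b2, ?_⟩, b5⟩
    rw [b6, b5]
    exact ⟨b3, b4, hv⟩

end Slices

/-! ### The orbit space as a manifold -/

section OrbitManifold

variable {G : Type*} {dG : ℕ} [Group G] [TopologicalSpace G] [ChartedSpace (Euc dG) G]
  [LieGroup (𝓡 dG) ∞ G]
variable {M : Type*} {d : ℕ} [TopologicalSpace M] [ChartedSpace (Euc d) M]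
  [IsManifold (𝓡 d) ∞ M] [MulAction G M] [ContMDiffSMul (𝓡 dG) (𝓡 d) ∞ G M]
variable {U : Opens M}

/-- The inclusion of an open set is the identity on tangent spaces. -/
theorem diff_subtype_val (z : U) :
    diff d d (Subtype.val : U → M) z = ContinuousLinearMap.id ℝ (Euc d) := by
  have h1 : MDifferentiableAt (𝓡 d) (𝓡 d) (Subtype.val : U → M) z :=
    contMDiffAt_diffble contMDiff_subtype_val.contMDiffAt
  have h2 : MDifferentiableAt (𝓡 d) (𝓡 d) (extChartAt (𝓡 d) (z : M)) (z : M) :=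
    contMDiffAt_diffble contMDiffAt_extChartAt
  have h3 := diff_comp h2 h1
  have h4 : extChartAt (𝓡 d) (z : M) ∘ (Subtype.val : U → M) = extChartAt (𝓡 d) z := rfl
  rw [h4, diff_extChartAt_self, diff_extChartAt_self, ContinuousLinearMap.id_comp] at h3
  exact h3.symm

theorem toOrbit_eq_iff {z w : U} : toOrbit G U z = toOrbit G U w ↔ ∃ g : G, g • (z : M) = w := by
  have h1 : toOrbit G U z = toOrbit G U w ↔ (orbitSetoid G U).r z w := Quotient.eq
  rw [h1]
  constructor
  · rintro ⟨g, hg⟩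
    exact ⟨g⁻¹, by rw [inv_smul_eq_iff]; exact hg.symm⟩
  · rintro ⟨g, hg⟩
    exact ⟨g⁻¹, by simp only [← hg, inv_smul_smul]⟩

theorem toOrbit_surjective : Function.Surjective (toOrbit G U) := Quotient.mk_surjective

theorem isOpen_orbitSpace_iff {S : Set (OrbitSpace G U)} : IsOpen S ↔ IsOpen (toOrbit G U ⁻¹' S) :=
  Iff.rfl

theorem continuous_toOrbit : Continuous (toOrbit G U) := continuous_quotient_mk'

/-- The image in `U / G` of an invariant open set is open. -/
theorem isOpen_image_toOrbit {O : Set M} (hO : IsOpen O) (hinv : ∀ (g : G), ∀ z ∈ O, g • z ∈ O) :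
    IsOpen (toOrbit G U '' {z | (z : M) ∈ O}) := by
  rw [isOpen_orbitSpace_iff]
  convert hO.preimage continuous_subtype_val using 1
  ext z
  constructor
  · rintro ⟨w, hw, hwz⟩
    obtain ⟨g, hg⟩ := toOrbit_eq_iff.1 hwz
    simp only [Set.mem_preimage, ← hg]
    exact hinv g _ hw
  · intro hz
    exact ⟨z, hz, rfl⟩

theorem mem_image_toOrbit_iff {O : Set M} (hinv : ∀ (g : G), ∀ z ∈ O, g • z ∈ O) {z : U} :
    toOrbit G U z ∈ toOrbit G U '' {z | (z : M) ∈ O} ↔ (z : M) ∈ O := by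
  constructor
  · rintro ⟨w, hw, hwz⟩
    obtain ⟨g, hg⟩ := toOrbit_eq_iff.1 hwz
    rw [← hg]
    exact hinv g _ hw
  · intro hz
    exact ⟨z, hz, rfl⟩

/-- Slice coordinates give a chart of the orbit space. -/
theorem exists_orbit_chart {O : Set M} {ρ : M → G} (hρ : IsFrame G dG d O ρ) (hOU : O ⊆ U)
    {n : ℕ} (hn : n + dG = d) (z₀ : U) (hz₀ : (z₀ : M) ∈ O) :
    ∃ (e : OpenPartialHomeomorph (OrbitSpace G U) (Euc n)) (f : M → Euc n) (j : Euc n → M),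
      toOrbit G U z₀ ∈ e.source ∧
      (∀ z : U, toOrbit G U z ∈ e.source →
        ContMDiffAt (𝓡 d) (𝓡 n) ∞ f z ∧ e (toOrbit G U z) = f z) ∧
      ∀ v ∈ e.target, ContMDiffAt (𝓡 n) (𝓡 d) ∞ j v ∧
        ∃ h : j v ∈ U, e.symm v = toOrbit G U ⟨j v, h⟩ := by
  classical
  obtain ⟨O', f, j, V, hO', hO'O, hz₀', hinv, hV, hf, hj⟩ := exists_slice_coordinates hρ hz₀ hn
  let out : OrbitSpace G U → U := Function.surjInv toOrbit_surjective
  have hout : ∀ b, toOrbit G U (out b) = b := Function.surjInv_eq toOrbit_surjective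
  have hfout : ∀ z : U, (z : M) ∈ O' → f (out (toOrbit G U z)) = f z := by
    intro z hz
    obtain ⟨g, hg⟩ := toOrbit_eq_iff.1 (hout (toOrbit G U z)).symm
    rw [← hg, (hf z hz).2.2.1 g]
  have hjU : ∀ v ∈ V, j v ∈ U := fun v hv => hOU (hO'O (hj v hv).2.1)
  let inv : Euc n → OrbitSpace G U := fun v =>
    if h : j v ∈ U then toOrbit G U ⟨j v, h⟩ else toOrbit G U z₀
  have hinv' : ∀ v (hv : v ∈ V), inv v = toOrbit G U ⟨j v, hjU v hv⟩ := fun v hv => dif_pos _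
  let e : OpenPartialHomeomorph (OrbitSpace G U) (Euc n) :=
    { toFun := fun b => f (out b)
      invFun := inv
      source := toOrbit G U '' {z | (z : M) ∈ O'}
      target := V
      map_source' := by
        rintro _ ⟨z, hz, rfl⟩
        rw [hfout z hz]
        exact (hf z hz).2.1
      map_target' := fun v hv => by
        rw [hinv' v hv]
        exact ⟨_, (hj v hv).2.1, rfl⟩
      left_inv' := by
        rintro _ ⟨z, hz, rfl⟩
        rw [hfout z hz, hinv' _ (hf z hz).2.1, toOrbit_eq_iff]
        exact (hf z hz).2.2.2
      right_inv' := fun v hv => by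
        rw [hinv' v hv, hfout _ (hj v hv).2.1]
        exact (hj v hv).2.2
      open_source := isOpen_image_toOrbit hO' hinv
      open_target := hV
      continuousOn_toFun := by
        rw [continuousOn_open_iff (isOpen_image_toOrbit hO' hinv)]
        intro S hS
        rw [isOpen_orbitSpace_iff]
        have h1 : IsOpen (O' ∩ f ⁻¹' S) := by
          rw [isOpen_iff_mem_nhds]
          rintro z ⟨hz, hzS⟩
          exact Filter.inter_mem (hO'.mem_nhds hz)
            ((hf z hz).1.continuousAt.preimage_mem_nhds (hS.mem_nhds hzS))
        convert h1.preimage (continuous_subtype_val (p := fun z => z ∈ U)) using 1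
        ext z
        simp only [Set.mem_preimage, Set.mem_inter_iff]
        rw [mem_image_toOrbit_iff hinv]
        refine and_congr_right fun hz => ?_
        rw [hfout z hz]
      continuousOn_invFun := by
        intro v hv
        have h1 : ContinuousAt (fun v : V => (⟨j v, hjU v v.2⟩ : U)) ⟨v, hv⟩ := by
          rw [Topology.IsInducing.subtypeVal.continuousAt_iff]
          exact ContinuousAt.comp (g := j) (x := (⟨v, hv⟩ : V)) (hj v hv).1.continuousAt
            continuous_subtype_val.continuousAt
        rw [continuousWithinAt_iff_continuousAt_domRestrict _ hv]
        have h2 := (continuous_toOrbit (G := G) (U := U)).continuousAt.comp h1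
        refine h2.congr (Filter.Eventually.of_forall fun w => ?_)
        exact (hinv' w w.2).symm }
  refine ⟨e, f, j, ⟨z₀, hz₀', rfl⟩, fun z hz => ?_, fun v hv => ?_⟩
  · have hz' := (mem_image_toOrbit_iff hinv).1 hz
    exact ⟨(hf z hz').1, hfout z hz'⟩
  · exact ⟨(hj v hv).1, hjU v hv, hinv' v hv⟩

/-- If the open set `U` is covered by domains of moving frames, and two points of `U` have either a
common frame or disjoint invariant neighbourhoods, then `U / G` is a manifold. -/
theorem exists_isOrbitManifold [T2Space M] (hU : ∀ (g : G), ∀ z ∈ U, g • z ∈ U)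
    (hF : ∀ z ∈ U, ∀ w ∈ U,
      (∃ (O : Set M) (ρ : M → G), IsFrame G dG d O ρ ∧ O ⊆ U ∧ z ∈ O ∧ w ∈ O) ∨
      ∃ O O' : Set M, IsOpen O ∧ IsOpen O' ∧ (∀ (g : G), ∀ y ∈ O, g • y ∈ O) ∧
        (∀ (g : G), ∀ y ∈ O', g • y ∈ O') ∧ Disjoint O O' ∧ z ∈ O ∧ w ∈ O') :
    ∃ _ : ChartedSpace (Euc (d - dG)) (OrbitSpace G U), IsOrbitManifold G U d (d - dG) := by
  classical
  have hF1 : ∀ z ∈ U, ∃ (O : Set M) (ρ : M → G), IsFrame G dG d O ρ ∧ O ⊆ U ∧ z ∈ O := by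
    intro z hz
    rcases hF z hz z hz with ⟨O, ρ, h1, h2, h3, -⟩ | ⟨O, O', -, -, -, -, h1, h2, h3⟩
    · exact ⟨O, ρ, h1, h2, h3⟩
    · exact absurd h3 (Set.disjoint_left.1 h1 h2)
  have hdim : ∀ z ∈ U, d - dG + dG = d := by
    intro z hz
    obtain ⟨O, ρ, hρ, -, hzO⟩ := hF1 z hz
    have := (diff_sliceProj hρ hzO).2
    omega
  have hch : ∀ b : OrbitSpace G U,
      ∃ (e : OpenPartialHomeomorph (OrbitSpace G U) (Euc (d - dG))) (f : M → Euc (d - dG))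
        (j : Euc (d - dG) → M), b ∈ e.source ∧
      (∀ z : U, toOrbit G U z ∈ e.source →
        ContMDiffAt (𝓡 d) (𝓡 (d - dG)) ∞ f z ∧ e (toOrbit G U z) = f z) ∧
      ∀ v ∈ e.target, ContMDiffAt (𝓡 (d - dG)) (𝓡 d) ∞ j v ∧
        ∃ h : j v ∈ U, e.symm v = toOrbit G U ⟨j v, h⟩ := by
    intro b
    obtain ⟨z, rfl⟩ := toOrbit_surjective b
    obtain ⟨O, ρ, hρ, hOU, hzO⟩ := hF1 z z.2
    exact exists_orbit_chart hρ hOU (hdim z z.2) z hzO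
  choose e f j he hef hej using hch
  let inst : ChartedSpace (Euc (d - dG)) (OrbitSpace G U) :=
    { atlas := Set.range e
      chartAt := e
      mem_chart_source := he
      chart_mem_atlas := fun b => ⟨b, rfl⟩ }
  have hman : IsManifold (𝓡 (d - dG)) ∞ (OrbitSpace G U) := by
    apply isManifold_of_contDiffOn
    rintro _ _ ⟨b, rfl⟩ ⟨b', rfl⟩
    intro v hv
    simp only [modelWithCornersSelf_coe, modelWithCornersSelf_coe_symm, Set.preimage_id,
      Set.range_id, Set.inter_univ, OpenPartialHomeomorph.trans_source,
      OpenPartialHomeomorph.symm_source, Set.mem_inter_iff, Set.mem_preimage] at hv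
    obtain ⟨hv1, hv2⟩ := hv
    obtain ⟨h1, h2, h3⟩ := hej b v hv1
    rw [h3] at hv2
    have h4 := (hef b' _ hv2).1
    have h5 : ContMDiffAt (𝓡 (d - dG)) (𝓡 (d - dG)) ∞ (fun v => f b' (j b v)) v :=
      ContMDiffAt.comp (I' := 𝓡 d) (g := f b') v h4 h1
    refine ContDiffAt.contDiffWithinAt (h5.contDiffAt.congr_of_eventuallyEq ?_)
    have h6 : ∀ᶠ v' in 𝓝 v, v' ∈ (e b).target ∧ (e b).symm v' ∈ (e b').source := by
      refine Filter.Eventually.and ((e b).open_target.mem_nhds hv1) ?_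
      refine ((e b).continuousAt_symm hv1).eventually ((e b').open_source.mem_nhds ?_)
      rwa [h3]
    filter_upwards [h6] with v' ⟨hv', hv''⟩
    obtain ⟨-, h7, h8⟩ := hej b v' hv'
    rw [h8] at hv''
    change (e b') ((e b).symm v') = f b' (j b v')
    rw [h8]
    exact (hef b' _ hv'').2
  have hsmooth : ContMDiff (𝓡 d) (𝓡 (d - dG)) ∞ (toOrbit G U) := by
    intro z
    rw [contMDiffAt_iff_target]
    refine ⟨continuous_toOrbit.continuousAt, ?_⟩
    set b := toOrbit G U z with hb
    have h1 := contMDiffAt_subtype_iff.2 (hef b z (he b)).1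
    refine h1.congr_of_eventuallyEq ?_
    filter_upwards [continuous_toOrbit.continuousAt.eventually ((e b).open_source.mem_nhds (he b))]
      with w hw
    exact (hef b w hw).2
  refine ⟨inst, hman, ?_, hsmooth, ?_⟩
  · refine ⟨fun b b' hbb' => ?_⟩
    obtain ⟨z, rfl⟩ := toOrbit_surjective b
    obtain ⟨w, rfl⟩ := toOrbit_surjective b'
    obtain ⟨O, O', hO, hO', hOi, hOi', hd, hz, hw⟩ : ∃ O O' : Set M, IsOpen O ∧ IsOpen O' ∧
        (∀ (g : G), ∀ y ∈ O, g • y ∈ O) ∧ (∀ (g : G), ∀ y ∈ O', g • y ∈ O') ∧ Disjoint O O' ∧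
        (z : M) ∈ O ∧ (w : M) ∈ O' := by
      rcases hF z z.2 w w.2 with ⟨O, ρ, hρ, hOU, hz, hw⟩ | h
      · -- the normal forms `(ρ y)⁻¹ • y` of the two points are separated in `M`
        have hne : (ρ z)⁻¹ • (z : M) ≠ (ρ w)⁻¹ • (w : M) := by
          intro h
          refine hbb' (toOrbit_eq_iff.2 ⟨ρ w * (ρ z)⁻¹, ?_⟩)
          rw [mul_smul, h, smul_inv_smul]
        obtain ⟨A, B, hA, hB, hzA, hwB, hAB⟩ := t2_separation hne
        have hinv : ∀ (g : G), ∀ y ∈ O, (ρ (g • y))⁻¹ • (g • y) = (ρ y)⁻¹ • y := by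
          intro g y hy
          rw [hρ.equivariant g y hy, smul_smul]
          group
        have hopen : ∀ C : Set M, IsOpen C → IsOpen {y | y ∈ O ∧ (ρ y)⁻¹ • y ∈ C} := by
          intro C hC
          rw [isOpen_iff_mem_nhds]
          rintro y ⟨hy, hyC⟩
          have : ContMDiffAt (𝓡 d) (𝓡 d) ∞ (fun y => (ρ y)⁻¹ • y) y :=
            contMDiffAt_smul_of (dG := dG) (hρ.smooth y hy).inv contMDiffAt_id
          exact Filter.inter_mem (hρ.isOpen.mem_nhds hy)
            (this.continuousAt.preimage_mem_nhds (hC.mem_nhds hyC))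
        refine ⟨_, _, hopen A hA, hopen B hB, ?_, ?_, ?_, ⟨hz, hzA⟩, ⟨hw, hwB⟩⟩
        · rintro g y ⟨hy, hyA⟩
          exact ⟨hρ.smul_mem g y hy, by rwa [hinv g y hy]⟩
        · rintro g y ⟨hy, hyB⟩
          exact ⟨hρ.smul_mem g y hy, by rwa [hinv g y hy]⟩
        · rw [Set.disjoint_left]
          rintro y ⟨-, hyA⟩ ⟨-, hyB⟩
          exact Set.disjoint_left.1 hAB hyA hyB
      · exact h
    refine ⟨_, _, isOpen_image_toOrbit hO hOi, isOpen_image_toOrbit hO' hOi', ⟨z, hz, rfl⟩,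
      ⟨w, hw, rfl⟩, ?_⟩
    rw [Set.disjoint_left]
    rintro _ ⟨y, hy, rfl⟩ hy'
    exact Set.disjoint_left.1 hd hy ((mem_image_toOrbit_iff hOi').1 hy')
  · intro z
    set b := toOrbit G U z with hb
    have hfz := hef b z (he b)
    have hv : f b z ∈ (e b).target := hfz.2 ▸ (e b).map_source (he b)
    obtain ⟨hjs, hjU, hjb⟩ := hej b _ hv
    have h1 : b = toOrbit G U ⟨j b (f b z), hjU⟩ := by
      rw [← hjb, ← hfz.2]
      exact ((e b).left_inv (he b)).symm
    obtain ⟨g, hg⟩ := toOrbit_eq_iff.1 h1.symm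
    -- `v ↦ g • j v` is a section of `f` through `z`
    have hs : ContMDiffAt (𝓡 (d - dG)) (𝓡 d) ∞ (fun v => g • j b v) (f b z) :=
      contMDiffAt_smul_of (dG := dG) contMDiffAt_const hjs
    have hsz : (fun v => g • j b v) (f b z) = z := hg
    have hsec : ∀ᶠ v in 𝓝 (f b z), f b (g • j b v) = v := by
      filter_upwards [(e b).open_target.mem_nhds hv] with v hv'
      obtain ⟨-, h2, h3⟩ := hej b v hv'
      have h4 : toOrbit G U ⟨g • j b v, hU g _ h2⟩ = toOrbit G U ⟨j b v, h2⟩ :=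
        (toOrbit_eq_iff.2 ⟨g, rfl⟩).symm
      have h5 := (hef b ⟨g • j b v, hU g _ h2⟩ (by
        rw [h4, ← h3]; exact (e b).map_target hv')).2
      rw [← h5, h4, ← h3, (e b).right_inv hv']
    have hfs : ContMDiffAt (𝓡 d) (𝓡 (d - dG)) ∞ (f b) ((fun v => g • j b v) (f b z)) := by
      rw [hsz]; exact hfz.1
    have hsurj : Function.Surjective (diff d (d - dG) (f b) z) := by
      intro v
      have := diff_comp_section hfs hs hsec v
      rw [show g • j b (f b z) = (z : M) from hg] at this
      exact ⟨_, this⟩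
    have e1 : diff d (d - dG) (extChartAt (𝓡 (d - dG)) b ∘ toOrbit G U) z =
        diff d (d - dG) (toOrbit G U) z := by
      rw [diff_comp (contMDiffAt_diffble contMDiffAt_extChartAt)
        (contMDiffAt_diffble hsmooth.contMDiffAt), ← hb, diff_extChartAt_self,
        ContinuousLinearMap.id_comp]
    have e2 : diff d (d - dG) (extChartAt (𝓡 (d - dG)) b ∘ toOrbit G U) z =
        diff d (d - dG) (f b ∘ (Subtype.val : U → M)) z := by
      apply diff_congr
      filter_upwards [continuous_toOrbit.continuousAt.eventually
        ((e b).open_source.mem_nhds (he b))] with w hw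
      exact (hef b w hw).2
    rw [← e1, e2, diff_comp (contMDiffAt_diffble hfz.1)
      (contMDiffAt_diffble contMDiff_subtype_val.contMDiffAt), diff_subtype_val,
      ContinuousLinearMap.comp_id]
    exact hsurj

/-- The projection `U → U / G`, extended to `M` by a constant. -/
def orbitMap (G : Type*) [Group G] [MulAction G M] (U : Opens M) (u₀ : U) (z : M) :
    OrbitSpace G U := by
  classical
  exact if h : z ∈ U then toOrbit G U ⟨z, h⟩ else toOrbit G U u₀

theorem orbitMap_of_mem (u₀ : U) {z : M} (h : z ∈ U) :
    orbitMap G U u₀ z = toOrbit G U ⟨z, h⟩ := dif_pos h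

theorem orbitMap_comp_val (u₀ : U) : (fun z : U => orbitMap G U u₀ z) = toOrbit G U := by
  funext z; exact orbitMap_of_mem u₀ z.2

section
variable {n : ℕ} [ChartedSpace (Euc n) (OrbitSpace G U)]

theorem diff_orbitMap (h : IsOrbitManifold G U d n) (u₀ : U) (z : U) :
    diff d n (orbitMap G U u₀) z = diff d n (toOrbit G U) z := by
  have h1 : ContMDiffAt (𝓡 d) (𝓡 n) ∞ (orbitMap G U u₀) z := by
    rw [← contMDiffAt_subtype_iff, orbitMap_comp_val]
    exact h.smooth.contMDiffAt
  have h2 := diff_comp (contMDiffAt_diffble h1)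
    (contMDiffAt_diffble (contMDiff_subtype_val (U := U)).contMDiffAt)
  rw [diff_subtype_val, ContinuousLinearMap.comp_id] at h2
  rw [← h2]
  exact congrArg (fun f => diff d n f z) (orbitMap_comp_val u₀)

/-- An orbit manifold is a quotient of `U`. -/
theorem IsOrbitManifold.isQuot (h : IsOrbitManifold G U d n)
    (hU : ∀ (g : G), ∀ z ∈ U, g • z ∈ U) (u₀ : U) :
    IsQuot G d n (U : Set M) (orbitMap G U u₀) where
  isOpen := U.isOpen
  smul_mem := hU
  smooth z hz := by
    have := contMDiffAt_subtype_iff (I := 𝓡 d) (I' := 𝓡 n) (n := ∞) (U := U)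
      (f := orbitMap G U u₀) (x := ⟨z, hz⟩)
    rw [← this, orbitMap_comp_val]
    exact h.smooth.contMDiffAt
  submersion z hz := by
    have := diff_orbitMap h u₀ ⟨z, hz⟩
    rw [this]
    exact h.submersion _
  eq_iff z hz w hw := by
    rw [orbitMap_of_mem u₀ hz, orbitMap_of_mem u₀ hw, toOrbit_eq_iff]
  onto b := by
    obtain ⟨z, rfl⟩ := toOrbit_surjective b
    exact ⟨z, z.2, orbitMap_of_mem u₀ z.2⟩

end

end OrbitManifold

/-! ### Coordinates on the bundle of planes -/

section Projections

variable {d e : ℕ}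

/-- For the orthogonal projection `P` onto a subspace on which `A` is injective, this operator is
invertible: it is `P A† A P` on the subspace and the identity on the complement. -/
def gram (A : Euc d →L[ℝ] Euc e) (P : Euc d →L[ℝ] Euc d) : Euc d →L[ℝ] Euc d :=
  P ∘L (ContinuousLinearMap.adjoint A) ∘L A ∘L P + (1 - P)

/-- The left inverse of `A` on the range of the orthogonal projection `P`, when `A` is injective
there. -/
def pinv (A : Euc d →L[ℝ] Euc e) (P : Euc d →L[ℝ] Euc d) : Euc e →L[ℝ] Euc d :=
  Ring.inverse (gram A P) ∘L P ∘L ContinuousLinearMap.adjoint A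

/-- The orthogonal projection onto the image under `A` of the range of the orthogonal projection
`P`, when `A` is injective there. -/
def gproj (A : Euc d →L[ℝ] Euc e) (P : Euc d →L[ℝ] Euc d) : Euc e →L[ℝ] Euc e :=
  A ∘L P ∘L pinv A P

/-- The adjoint, as a bounded linear map. -/
def adjL (d e : ℕ) : (Euc d →L[ℝ] Euc e) →L[ℝ] (Euc e →L[ℝ] Euc d) :=
  LinearMap.mkContinuous
    { toFun := fun A => ContinuousLinearMap.adjoint A
      map_add' := fun A B => map_add _ A B
      map_smul' := fun c A => by simp } 1 (fun A => by simp)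

variable {K : Submodule ℝ (Euc d)} {A : Euc d →L[ℝ] Euc e}

theorem gram_isUnit (hA : ∀ v ∈ K, A v = 0 → v = 0) : IsUnit (gram A K.starProjection) := by
  set P := K.starProjection
  have hP : ∀ v ∈ K, P v = v := fun v hv => Submodule.starProjection_eq_self_iff.2 hv
  have hPm : ∀ v, P v ∈ K := fun v => Submodule.starProjection_apply_mem K v
  have hsymm : ∀ u v, inner ℝ (P u) v = inner ℝ u (P v) :=
    fun u v => Submodule.inner_starProjection_left_eq_right K u v
  have hinj : Function.Injective (gram A P) := by
    rw [injective_iff_map_eq_zero]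
    intro v hv
    have h1 : inner ℝ (gram A P v) v = (0 : ℝ) := by rw [hv, inner_zero_left]
    have h2 : inner ℝ (gram A P v) v =
        inner ℝ (A (P v)) (A (P v)) + inner ℝ (v - P v) (v - P v) := by
      simp only [gram, add_apply, ContinuousLinearMap.comp_apply,
        sub_apply, one_apply_eq_self, inner_add_left, hsymm,
        ContinuousLinearMap.adjoint_inner_left]
      congr 1
      rw [inner_sub_right]
      have : inner ℝ (v - P v) (P v) = (0 : ℝ) := by
        rw [← hsymm, map_sub, hP _ (hPm v), sub_self, inner_zero_left]
      rw [this, sub_zero]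
    rw [h1] at h2
    have h3 : inner ℝ (A (P v)) (A (P v)) = (0 : ℝ) := by
      have := real_inner_self_nonneg (x := A (P v))
      have := real_inner_self_nonneg (x := v - P v)
      linarith
    have h4 : inner ℝ (v - P v) (v - P v) = (0 : ℝ) := by linarith
    have h5 := hA _ (hPm v) (inner_self_eq_zero.1 h3)
    have h6 := inner_self_eq_zero.1 h4
    rwa [h5, sub_zero] at h6
  let E : Euc d ≃L[ℝ] Euc d :=
    (LinearEquiv.ofInjectiveEndo (gram A P).toLinearMap hinj).toContinuousLinearEquiv
  have : gram A P = E := ContinuousLinearMap.ext fun v => rfl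
  rw [this]
  exact ⟨ContinuousLinearEquiv.toUnit E, rfl⟩

theorem gram_apply_of_mem {v : Euc d} (hv : v ∈ K) :
    gram A K.starProjection v = K.starProjection (ContinuousLinearMap.adjoint A (A v)) := by
  have : K.starProjection v = v := Submodule.starProjection_eq_self_iff.2 hv
  simp [gram, this]

theorem inverse_gram_apply (hA : ∀ v ∈ K, A v = 0 → v = 0) (v : Euc d) :
    Ring.inverse (gram A K.starProjection) (gram A K.starProjection v) = v := by
  have := Ring.inverse_mul_cancel _ (gram_isUnit hA)
  exact DFunLike.congr_fun this v

theorem gram_inverse_apply (hA : ∀ v ∈ K, A v = 0 → v = 0) (v : Euc d) :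
    gram A K.starProjection (Ring.inverse (gram A K.starProjection) v) = v := by
  have := Ring.mul_inverse_cancel _ (gram_isUnit hA)
  exact DFunLike.congr_fun this v

/-- `pinv` inverts `A` on the subspace. -/
theorem pinv_apply (hA : ∀ v ∈ K, A v = 0 → v = 0) {v : Euc d} (hv : v ∈ K) :
    pinv A K.starProjection (A v) = v := by
  simp only [pinv, ContinuousLinearMap.comp_apply]
  rw [← gram_apply_of_mem hv, inverse_gram_apply hA]

/-- The orthogonal projection onto the image of a subspace is an algebraic expression in `A` and the
projection onto the subspace. This is what makes operations on planes smooth. -/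
theorem gproj_eq (hA : ∀ v ∈ K, A v = 0 → v = 0) :
    gproj A K.starProjection = (K.map A.toLinearMap).starProjection := by
  ext1 w
  symm
  apply Submodule.eq_starProjection_of_mem_of_inner_eq_zero
  · exact ⟨_, Submodule.starProjection_apply_mem K _, rfl⟩
  · rintro _ ⟨v, hv, rfl⟩
    have hPv : K.starProjection v = v := Submodule.starProjection_eq_self_iff.2 hv
    set x := pinv A K.starProjection w with hx
    have h1 : gram A K.starProjection x = K.starProjection (ContinuousLinearMap.adjoint A w) := by
      rw [hx]
      simp only [pinv, ContinuousLinearMap.comp_apply]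
      exact gram_inverse_apply hA _
    have h2 := congrArg (fun y => inner ℝ y v) h1
    simp only [gram, add_apply, ContinuousLinearMap.comp_apply,
      sub_apply, one_apply_eq_self, inner_add_left,
      Submodule.inner_starProjection_left_eq_right, hPv,
      ContinuousLinearMap.adjoint_inner_left, inner_sub_left, sub_self, add_zero] at h2
    change inner ℝ (w - A (K.starProjection x)) (A v) = 0
    rw [inner_sub_left, h2, sub_self]

theorem contDiffAt_gram (q : (Euc d →L[ℝ] Euc e) × (Euc d →L[ℝ] Euc d)) :
    ContDiffAt ℝ ∞ (fun q : (Euc d →L[ℝ] Euc e) × (Euc d →L[ℝ] Euc d) => gram q.1 q.2) q := by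
  have h1 : ContDiffAt ℝ ∞ (fun q : (Euc d →L[ℝ] Euc e) × (Euc d →L[ℝ] Euc d) => q.1) q :=
    contDiffAt_fst
  have h2 : ContDiffAt ℝ ∞ (fun q : (Euc d →L[ℝ] Euc e) × (Euc d →L[ℝ] Euc d) => q.2) q :=
    contDiffAt_snd
  have h3 : ContDiffAt ℝ ∞ (fun q : (Euc d →L[ℝ] Euc e) × (Euc d →L[ℝ] Euc d) =>
      adjL d e q.1) q := (adjL d e).contDiff.contDiffAt.comp q h1
  exact (h2.clm_comp (h3.clm_comp (h1.clm_comp h2))).add (contDiffAt_const.sub h2)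

theorem contDiffAt_pinv {q : (Euc d →L[ℝ] Euc e) × (Euc d →L[ℝ] Euc d)}
    (hq : IsUnit (gram q.1 q.2)) :
    ContDiffAt ℝ ∞ (fun q : (Euc d →L[ℝ] Euc e) × (Euc d →L[ℝ] Euc d) => pinv q.1 q.2) q := by
  have h1 : ContDiffAt ℝ ∞ (fun q : (Euc d →L[ℝ] Euc e) × (Euc d →L[ℝ] Euc d) => q.1) q :=
    contDiffAt_fst
  have h2 : ContDiffAt ℝ ∞ (fun q : (Euc d →L[ℝ] Euc e) × (Euc d →L[ℝ] Euc d) => q.2) q :=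
    contDiffAt_snd
  have h3 : ContDiffAt ℝ ∞ (fun q : (Euc d →L[ℝ] Euc e) × (Euc d →L[ℝ] Euc d) =>
      adjL d e q.1) q := (adjL d e).contDiff.contDiffAt.comp q h1
  obtain ⟨u, hu⟩ := hq
  have h4 : ContDiffAt ℝ ∞ Ring.inverse (gram q.1 q.2) := hu ▸ contDiffAt_ringInverse ℝ u
  exact (ContDiffAt.comp q h4 (contDiffAt_gram q)).clm_comp (h2.clm_comp h3)

theorem contDiffAt_gproj {q : (Euc d →L[ℝ] Euc e) × (Euc d →L[ℝ] Euc d)}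
    (hq : IsUnit (gram q.1 q.2)) :
    ContDiffAt ℝ ∞ (fun q : (Euc d →L[ℝ] Euc e) × (Euc d →L[ℝ] Euc d) => gproj q.1 q.2) q :=
  contDiffAt_fst.clm_comp (contDiffAt_snd.clm_comp (contDiffAt_pinv hq))

end Projections

section PlaneCoord

variable {M : Type*} {d : ℕ} [TopologicalSpace M] [ChartedSpace (Euc d) M] [IsManifold (𝓡 d) ∞ M]
variable {N : Type*} {e : ℕ} [TopologicalSpace N] [ChartedSpace (Euc e) N] [IsManifold (𝓡 e) ∞ N]

/-- The action of a linear map on a plane in coordinates: `σ` is the map in the chart at the source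
and the chart at the target. -/
theorem planeCoord_map {x₀ : M} {y₀ : N} {Q : Plane M d} {y : N} {σ : Euc d →L[ℝ] Euc e}
    (hx : Q.base ∈ (chartAt (Euc d) x₀).source) (hy : y ∈ (chartAt (Euc e) y₀).source)
    (hσ : ∀ v ∈ Q.plane, σ v = 0 → v = 0) {σ' : Euc d →L[ℝ] Euc e}
    (hσ' : σ' = (diff e e (extChartAt (𝓡 e) y₀) y).comp (σ.comp
      (diff d d (extChartAt (𝓡 d) x₀).symm (extChartAt (𝓡 d) x₀ Q.base)))) :
    planeCoord y₀ ⟨y, Q.plane.map σ.toLinearMap⟩ =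
      (extChartAt (𝓡 e) y₀ y, gproj σ' (planeCoord x₀ Q).2) ∧
    IsUnit (gram σ' (planeCoord x₀ Q).2) := by
  have h1 : ∀ v ∈ Q.plane.map (diff d d (extChartAt (𝓡 d) x₀) Q.base).toLinearMap,
      σ' v = 0 → v = 0 := by
    rintro _ ⟨v, hv, rfl⟩ h
    have h2 : σ' (diff d d (extChartAt (𝓡 d) x₀) Q.base v) =
        diff e e (extChartAt (𝓡 e) y₀) y (σ v) := by
      rw [hσ']
      simp only [ContinuousLinearMap.comp_apply]
      rw [diff_chart_symm_apply hx]
    have h3 : diff e e (extChartAt (𝓡 e) y₀) y (σ v) = 0 := h2.symm.trans h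
    have h4 := diff_chart_symm_apply hy (σ v)
    rw [h3, map_zero] at h4
    rw [hσ v hv h4.symm, map_zero]
  refine ⟨?_, gram_isUnit h1⟩
  simp only [planeCoord]
  rw [gproj_eq h1]
  congr 2
  rw [← Submodule.map_comp, ← Submodule.map_comp]
  congr 1
  ext1 v
  simp only [LinearMap.comp_apply, ContinuousLinearMap.coe_coe, hσ', ContinuousLinearMap.comp_apply]
  rw [diff_chart_symm_apply hx]

/-- The action of a map of manifolds on planes, in coordinates. -/
def planePush (F : Euc d → Euc e) (q : Euc d × (Euc d →L[ℝ] Euc d)) :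
    Euc e × (Euc e →L[ℝ] Euc e) := (F q.1, gproj (fderiv ℝ F q.1) q.2)

theorem contDiffAt_planePush {F : Euc d → Euc e} {q : Euc d × (Euc d →L[ℝ] Euc d)}
    (hF : ContDiffAt ℝ ∞ F q.1) (hq : IsUnit (gram (fderiv ℝ F q.1) q.2)) :
    ContDiffAt ℝ ∞ (planePush F) q := by
  have h1 : ContDiffAt ℝ ∞ (fun q : Euc d × (Euc d →L[ℝ] Euc d) => F q.1) q :=
    ContDiffAt.comp q hF contDiffAt_fst
  have h2 : ContDiffAt ℝ ∞ (fun q : Euc d × (Euc d →L[ℝ] Euc d) => fderiv ℝ F q.1) q :=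
    ContDiffAt.comp (g := fderiv ℝ F) q (hF.fderiv_right (by simp)) contDiffAt_fst
  exact h1.prodMk (ContDiffAt.comp (g := fun q : (Euc d →L[ℝ] Euc e) × (Euc d →L[ℝ] Euc d) =>
    gproj q.1 q.2) q (contDiffAt_gproj hq) (h2.prodMk contDiffAt_snd))

/-- In coordinates, the image of a plane under the differential of a map is a smooth function of the
plane, near a plane on which the differential is injective. -/
theorem planeCoord_push {x₀ : M} {y₀ : N} {Q : Plane M d} {f : M → N}
    (hx : Q.base ∈ (chartAt (Euc d) x₀).source) (hy : f Q.base ∈ (chartAt (Euc e) y₀).source)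
    (hf : ContMDiffAt (𝓡 d) (𝓡 e) ∞ f Q.base) (hσ : ∀ v ∈ Q.plane, diff d e f Q.base v = 0 → v = 0) :
    planeCoord y₀ ⟨f Q.base, Q.plane.map (diff d e f Q.base).toLinearMap⟩ =
      planePush (inCharts d e x₀ y₀ f) (planeCoord x₀ Q) ∧
    ContDiffAt ℝ ∞ (planePush (inCharts d e x₀ y₀ f)) (planeCoord x₀ Q) := by
  have h0 : (planeCoord x₀ Q).1 = extChartAt (𝓡 d) x₀ Q.base := rfl
  have h := planeCoord_map hx hy hσ (inCharts_fderiv hx hy (contMDiffAt_diffble hf))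
  constructor
  · rw [h.1, planePush, h0, inCharts_apply hx]
  · apply contDiffAt_planePush
    · rw [h0]; exact inCharts_contDiffAt hx hy hf
    · rw [h0]; exact h.2

/-- The change of coordinates of planes. -/
theorem planeCoord_change {x₀ x₁ : M} {Q : Plane M d} (h₀ : Q.base ∈ (chartAt (Euc d) x₀).source)
    (h₁ : Q.base ∈ (chartAt (Euc d) x₁).source) :
    planeCoord x₁ Q = planePush (inCharts d d x₀ x₁ id) (planeCoord x₀ Q) ∧
    ContDiffAt ℝ ∞ (planePush (inCharts d d x₀ x₁ (id : M → M))) (planeCoord x₀ Q) := by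
  have h := planeCoord_push (f := id) h₀ h₁ contMDiffAt_id
    (by intro v _ hv; rw [diff_id] at hv; exact hv)
  refine ⟨?_, h.2⟩
  rw [← h.1, diff_id]
  congr 1
  ext1
  · rfl
  · exact (Submodule.map_id _).symm

/-- The neighbourhood filter of a plane in coordinates. -/
def planeNhds (x₀ : M) (Q : Plane M d) : Filter (Plane M d) :=
  Filter.comap (planeCoord x₀) (𝓝 (planeCoord x₀ Q)) ⊓
    Filter.principal {Q' | Q'.base ∈ (chartAt (Euc d) x₀).source}

theorem planeNhds_le {x₀ x₁ : M} {Q : Plane M d} (h₀ : Q.base ∈ (chartAt (Euc d) x₀).source)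
    (h₁ : Q.base ∈ (chartAt (Euc d) x₁).source) : planeNhds x₀ Q ≤ planeNhds x₁ Q := by
  have ht : Filter.Tendsto (planeCoord x₀) (planeNhds x₀ Q) (𝓝 (planeCoord x₀ Q)) :=
    Filter.tendsto_comap.mono_left inf_le_left
  have hs : ∀ᶠ Q' in planeNhds x₀ Q, Q'.base ∈ (chartAt (Euc d) x₀).source :=
    Filter.mem_inf_of_right (Filter.mem_principal_self _)
  have hs' : ∀ᶠ Q' in planeNhds x₀ Q, Q'.base ∈ (chartAt (Euc d) x₁).source := by
    have h1 := eventually_chart_symm h₀ (chart_source_mem_nhds h₁)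
    have h2 : Filter.Tendsto (fun Q' : Plane M d => extChartAt (𝓡 d) x₀ Q'.base) (planeNhds x₀ Q)
        (𝓝 (extChartAt (𝓡 d) x₀ Q.base)) :=
      (continuous_fst.tendsto _).comp ht
    filter_upwards [h2.eventually h1, hs] with Q' h3 h4
    rwa [(extChartAt (𝓡 d) x₀).left_inv (by simpa using h4)] at h3
  refine le_inf ?_ (Filter.le_principal_iff.2 hs')
  rw [← Filter.tendsto_iff_comap]
  obtain ⟨h3, h4⟩ := planeCoord_change h₀ h₁
  rw [h3]
  refine (h4.continuousAt.tendsto.comp ht).congr' ?_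
  filter_upwards [hs, hs'] with Q' a b
  exact (planeCoord_change a b).1.symm

theorem planeNhds_eq {x₀ x₁ : M} {Q : Plane M d} (h₀ : Q.base ∈ (chartAt (Euc d) x₀).source)
    (h₁ : Q.base ∈ (chartAt (Euc d) x₁).source) : planeNhds x₀ Q = planeNhds x₁ Q :=
  le_antisymm (planeNhds_le h₀ h₁) (planeNhds_le h₁ h₀)

theorem mem_planeNhds {x₀ : M} {Q : Plane M d} {S : Set (Plane M d)} :
    S ∈ planeNhds x₀ Q ↔ ∃ V : Set (Euc d × (Euc d →L[ℝ] Euc d)), IsOpen V ∧ planeCoord x₀ Q ∈ V ∧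
      ∀ Q' : Plane M d, Q'.base ∈ (chartAt (Euc d) x₀).source → planeCoord x₀ Q' ∈ V → Q' ∈ S := by
  rw [planeNhds, Filter.mem_inf_principal, Filter.mem_comap]
  constructor
  · rintro ⟨T, hT, hTS⟩
    obtain ⟨V, hVT, hVo, hV⟩ := mem_nhds_iff.1 hT
    exact ⟨V, hVo, hV, fun Q' h1 h2 => hTS (hVT h2) h1⟩
  · rintro ⟨V, hVo, hV, h⟩
    exact ⟨V, hVo.mem_nhds hV, fun Q' h1 h2 => h Q' h2 h1⟩

/-- The topology of the bundle of planes can be computed in any chart at the base point, although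
its open sets are defined by conditions in all charts. -/
theorem nhds_plane {x₀ : M} {Q : Plane M d} (h₀ : Q.base ∈ (chartAt (Euc d) x₀).source) :
    𝓝 Q = planeNhds x₀ Q := by
  rw [planeNhds_eq h₀ (mem_chart_source _ Q.base)]
  have hopen : ∀ O : Set (Plane M d), IsOpen O ↔ ∀ Q ∈ O, O ∈ planeNhds Q.base Q := by
    intro O
    refine forall₂_congr fun Q _ => mem_planeNhds.symm
  apply le_antisymm
  · intro S hS
    rw [mem_nhds_iff]
    refine ⟨{Q' | S ∈ planeNhds Q'.base Q'}, ?_, ?_, hS⟩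
    · intro Q' (hQ' : S ∈ planeNhds Q'.base Q')
      obtain ⟨V, hVo, hV, h⟩ := mem_planeNhds.1 hQ'
      exact h Q' (mem_chart_source _ _) hV
    · rw [hopen]
      intro Q' (hQ' : S ∈ planeNhds Q'.base Q')
      obtain ⟨V, hVo, hV, h⟩ := mem_planeNhds.1 hQ'
      refine mem_planeNhds.2 ⟨V, hVo, hV, fun Q'' h1 h2 => ?_⟩
      change S ∈ planeNhds Q''.base Q''
      rw [planeNhds_eq (mem_chart_source _ Q''.base) h1]
      exact mem_planeNhds.2 ⟨V, hVo, h2, h⟩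
  · intro S hS
    obtain ⟨O, hOS, hO, hQ⟩ := mem_nhds_iff.1 hS
    exact Filter.mem_of_superset ((hopen O).1 hO Q hQ) hOS

theorem continuousAt_planeCoord {x₀ : M} {Q : Plane M d}
    (h₀ : Q.base ∈ (chartAt (Euc d) x₀).source) : ContinuousAt (planeCoord x₀) Q := by
  rw [ContinuousAt, nhds_plane h₀]
  exact Filter.tendsto_comap.mono_left inf_le_left

theorem plane_eventually_source {x₀ : M} {Q : Plane M d}
    (h₀ : Q.base ∈ (chartAt (Euc d) x₀).source) :
    ∀ᶠ Q' in 𝓝 Q, Q'.base ∈ (chartAt (Euc d) x₀).source := by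
  rw [nhds_plane h₀]
  exact Filter.mem_inf_of_right (Filter.mem_principal_self _)

theorem tendsto_plane_iff {α : Type*} {l : Filter α} {f : α → Plane M d} {x₀ : M} {Q : Plane M d}
    (h₀ : Q.base ∈ (chartAt (Euc d) x₀).source) :
    Filter.Tendsto f l (𝓝 Q) ↔
      Filter.Tendsto (fun a => planeCoord x₀ (f a)) l (𝓝 (planeCoord x₀ Q)) ∧
        ∀ᶠ a in l, (f a).base ∈ (chartAt (Euc d) x₀).source := by
  rw [nhds_plane h₀, planeNhds, Filter.tendsto_inf, Filter.tendsto_comap_iff,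
    Filter.tendsto_principal]
  rfl

theorem continuous_plane_base : Continuous (Plane.base : Plane M d → M) := by
  rw [continuous_iff_continuousAt]
  intro Q
  have h1 := continuousAt_planeCoord (mem_chart_source (Euc d) Q.base)
  have h2 := plane_eventually_source (mem_chart_source (Euc d) Q.base)
  have h3 : ContinuousAt (fun Q' : Plane M d => (extChartAt (𝓡 d) Q.base).symm
      (extChartAt (𝓡 d) Q.base Q'.base)) Q :=
    ContinuousAt.comp (g := (extChartAt (𝓡 d) Q.base).symm)
      (f := fun Q' : Plane M d => extChartAt (𝓡 d) Q.base Q'.base)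
      (continuousAt_extChartAt_symm _) (continuous_fst.continuousAt.comp h1)
  refine h3.congr ?_
  filter_upwards [h2] with Q' hQ'
  exact (extChartAt (𝓡 d) Q.base).left_inv (by simpa using hQ')

end PlaneCoord

/-! ### Pullback of differential forms -/

section Covectors

variable {d e : ℕ}

/-- A covector, as an alternating form of degree one. -/
def oneForm : (Euc d →L[ℝ] ℝ) ≃ₗᵢ[ℝ] AltForm d 1 :=
  ContinuousAlternatingMap.ofSubsingletonLIE (0 : Fin 1)

theorem oneForm_apply (a : Euc d →L[ℝ] ℝ) (v : Fin 1 → Euc d) : oneForm a v = a (v 0) := rfl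

theorem oneForm_comp (a : Euc d →L[ℝ] ℝ) (L : Euc e →L[ℝ] Euc d) :
    (oneForm a).compContinuousLinearMap L = oneForm (a.comp L) := rfl

/-- The covector of an alternating form of degree one. -/
def covec (η : AltForm d 1) : Euc d →L[ℝ] ℝ := oneForm.symm η

theorem oneForm_covec (η : AltForm d 1) : oneForm (covec η) = η := oneForm.apply_symm_apply η

theorem covec_oneForm (a : Euc d →L[ℝ] ℝ) : covec (oneForm a) = a := oneForm.symm_apply_apply a

theorem covec_apply (η : AltForm d 1) (v : Euc d) : covec η v = η ![v] := by
  conv_rhs => rw [← oneForm_covec η]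
  rfl

theorem covec_comp (η : AltForm d 1) (L : Euc e →L[ℝ] Euc d) :
    covec (η.compContinuousLinearMap L) = (covec η).comp L := by
  ext v
  rw [covec_apply, ContinuousLinearMap.comp_apply, covec_apply,
    ContinuousAlternatingMap.compContinuousLinearMap_apply]
  congr 1
  funext i
  fin_cases i
  rfl

theorem contDiffAt_covec_iff {E : Type*} [NormedAddCommGroup E] [NormedSpace ℝ E]
    {f : E → AltForm d 1} {x : E} :
    ContDiffAt ℝ ∞ (fun u => covec (f u)) x ↔ ContDiffAt ℝ ∞ f x :=
  oneForm.symm.toContinuousLinearEquiv.comp_contDiffAt_iff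

end Covectors

section Pullback

variable {M : Type*} {d : ℕ} [TopologicalSpace M] [ChartedSpace (Euc d) M] [IsManifold (𝓡 d) ∞ M]
variable {N : Type*} {e : ℕ} [TopologicalSpace N] [ChartedSpace (Euc e) N] [IsManifold (𝓡 e) ∞ N]

variable (d e) in
/-- The pullback of a field of forms. -/
def pullForm (F : N → M) {n : ℕ} (η : M → AltForm d n) (z : N) : AltForm e n :=
  (η (F z)).compContinuousLinearMap (diff e d F z)

/-- The pullback in charts at `z₀` and `x₀`, which need not be the preferred charts at `z` and
`F z`. -/
theorem inChart_pullForm {F : N → M} {n : ℕ} (η : M → AltForm d n) {z₀ z : N} {x₀ : M}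
    (hz : z ∈ (chartAt (Euc e) z₀).source) (hx : F z ∈ (chartAt (Euc d) x₀).source)
    (hF : ∀ᶠ z' in 𝓝 z, ContMDiffAt (𝓡 e) (𝓡 d) ∞ F z') :
    inChart z₀ (pullForm d e F η) =ᶠ[𝓝 (extChartAt (𝓡 e) z₀ z)] fun u =>
      (inChart x₀ η (inCharts e d z₀ x₀ F u)).compContinuousLinearMap
        (fderiv ℝ (inCharts e d z₀ x₀ F) u) := by
  have h1 : ∀ᶠ z' in 𝓝 z, F z' ∈ (chartAt (Euc d) x₀).source :=
    hF.self_of_nhds.continuousAt.eventually (chart_source_mem_nhds hx)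
  have h2 := eventually_chart_symm hz (h1.and hF)
  filter_upwards [h2, extChartAt_target_mem_nhds_of_mem hz] with u ⟨h3, h4⟩ hu
  set z' := (extChartAt (𝓡 e) z₀).symm u with hz'
  have hz's : z' ∈ (chartAt (Euc e) z₀).source := by
    rw [← extChartAt_source (𝓡 e)]
    exact (extChartAt (𝓡 e) z₀).map_target hu
  have huz : u = extChartAt (𝓡 e) z₀ z' := ((extChartAt (𝓡 e) z₀).right_inv hu).symm
  have h5 := inCharts_fderiv hz's h3 (contMDiffAt_diffble h4)
  have h6 := inCharts_apply (d := e) (e := d) (y₀ := x₀) (f := F) hz's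
  have h7 : (extChartAt (𝓡 d) x₀).symm (extChartAt (𝓡 d) x₀ (F z')) = F z' :=
    (extChartAt (𝓡 d) x₀).left_inv (by simpa using h3)
  rw [huz, h5, h6]
  simp only [inChart, pullForm]
  rw [← huz, ← hz', h7]
  ext v
  simp only [ContinuousAlternatingMap.compContinuousLinearMap_apply]
  congr 1
  funext i
  simp only [Function.comp_apply, ContinuousLinearMap.comp_apply]
  rw [diff_chart_symm_apply h3]

theorem pullForm_id {n : ℕ} (η : M → AltForm d n) : pullForm d d id η = η := by
  funext z
  simp only [pullForm, diff_id]
  rfl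

theorem inChart_pull_contDiffAt {F : N → M} (η : M → AltForm d 1) {z₀ z : N} {x₀ : M}
    (hz : z ∈ (chartAt (Euc e) z₀).source) (hx : F z ∈ (chartAt (Euc d) x₀).source)
    (hF : ∀ᶠ z' in 𝓝 z, ContMDiffAt (𝓡 e) (𝓡 d) ∞ F z')
    (hη : ContDiffAt ℝ ∞ (inChart x₀ η) (extChartAt (𝓡 d) x₀ (F z))) :
    ContDiffAt ℝ ∞ (inChart z₀ (pullForm d e F η)) (extChartAt (𝓡 e) z₀ z) := by
  have h0 := inCharts_contDiffAt hz hx hF.self_of_nhds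
  refine ContDiffAt.congr_of_eventuallyEq ?_ (inChart_pullForm η hz hx hF)
  rw [← contDiffAt_covec_iff]
  simp only [covec_comp]
  refine ContDiffAt.clm_comp ?_ (h0.fderiv_right (by simp))
  rw [← inCharts_apply (d := e) (e := d) (y₀ := x₀) (f := F) hz] at hη
  exact ContDiffAt.comp (g := fun u => covec (inChart x₀ η u)) _ (contDiffAt_covec_iff.2 hη) h0

/-- Smoothness of a field of covectors can be checked in any of the preferred charts. -/
theorem smoothFormAt_iff {η : M → AltForm d 1} {x₀ z : M} (hz : z ∈ (chartAt (Euc d) x₀).source) :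
    SmoothFormAt η z ↔ ContDiffAt ℝ ∞ (inChart x₀ η) (extChartAt (𝓡 d) x₀ z) := by
  have hid : ∀ᶠ z' in 𝓝 z, ContMDiffAt (𝓡 d) (𝓡 d) ∞ (id : M → M) z' :=
    .of_forall fun _ => contMDiffAt_id
  constructor
  · intro h
    have := inChart_pull_contDiffAt (F := id) η hz (mem_chart_source _ z) hid h
    rwa [pullForm_id] at this
  · intro h
    have := inChart_pull_contDiffAt (F := id) η (mem_chart_source _ z) hz hid h
    rwa [pullForm_id] at this

theorem SmoothFormAt.pullForm {F : N → M} {η : M → AltForm d 1} {z : N}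
    (hF : ∀ᶠ z' in 𝓝 z, ContMDiffAt (𝓡 e) (𝓡 d) ∞ F z') (hη : SmoothFormAt η (F z)) :
    SmoothFormAt (pullForm d e F η) z :=
  inChart_pull_contDiffAt η (mem_chart_source _ z) (mem_chart_source _ _) hF hη

/-- The exterior derivative is natural. -/
theorem extd_pullForm {F : N → M} {n : ℕ} {η : M → AltForm d n} {z : N}
    (hF : ∀ᶠ z' in 𝓝 z, ContMDiffAt (𝓡 e) (𝓡 d) ∞ F z') (hη : SmoothFormAt η (F z)) :
    extd (pullForm d e F η) z = (extd η (F z)).compContinuousLinearMap (diff e d F z) := by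
  have hz := mem_chart_source (Euc e) z
  have hx := mem_chart_source (Euc d) (F z)
  have h0 := inCharts_contDiffAt hz hx hF.self_of_nhds
  have h1 := inCharts_apply (d := e) (e := d) (y₀ := F z) (f := F) hz
  simp only [extd]
  rw [(inChart_pullForm η hz hx hF).extDeriv_eq]
  rw [extDeriv_pullback (r := ∞) _ h0 (by simpa using ENat.LEInfty.out), h1,
    inCharts_fderiv_self (contMDiffAt_diffble hF.self_of_nhds)]
  rw [h1]
  exact hη.differentiableAt (by simp)

theorem SmoothFormAt.sub {n : ℕ} {η η' : M → AltForm d n} {z : M} (hη : SmoothFormAt η z)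
    (hη' : SmoothFormAt η' z) : SmoothFormAt (fun y => η y - η' y) z :=
  ContDiffAt.sub hη hη'

theorem extd_sub {n : ℕ} {η η' : M → AltForm d n} {z : M} (hη : SmoothFormAt η z)
    (hη' : SmoothFormAt η' z) : extd (fun y => η y - η' y) z = extd η z - extd η' z := by
  have h1 := ContDiffAt.differentiableAt hη (by simp)
  have h2 := ContDiffAt.differentiableAt hη' (by simp)
  have h3 : inChart z (fun y => η y - η' y) = inChart z η + (-1 : ℝ) • inChart z η' := by
    funext u
    ext v
    simp [inChart, sub_eq_add_neg]
  simp only [extd]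
  rw [h3, extDeriv_add h1 (h2.const_smul _), extDeriv_smul, neg_one_smul, sub_eq_add_neg]

end Pullback

/-! ### Contact forms of a first order PDE system -/

section PDESystem

variable {M : Type*} {d : ℕ} [TopologicalSpace M] [ChartedSpace (Euc d) M] [IsManifold (𝓡 d) ∞ M]
variable {N : Type*} {e : ℕ} [TopologicalSpace N] [ChartedSpace (Euc e) N] [IsManifold (𝓡 e) ∞ N]
variable {k : ℕ} {φ : N → Plane M d}

theorem IsPDESystem.continuous_base (hφ : IsPDESystem e k φ) : Continuous fun z => (φ z).base :=
  continuous_plane_base.comp hφ.isEmbedding.continuous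

theorem IsPDESystem.contMDiff_base (hφ : IsPDESystem e k φ) (z : N) :
    ContMDiffAt (𝓡 e) (𝓡 d) ∞ (fun z => (φ z).base) z := by
  have hx := mem_chart_source (Euc d) (φ z).base
  have h1 : ContMDiffAt (𝓡 e) (𝓡 d) ∞ (fun z' => (planeCoord (φ z).base (φ z')).1) z :=
    contDiff_fst.contMDiff.contMDiffAt.comp z (hφ.smooth z)
  have h2 : ContMDiffAt (𝓡 d) (𝓡 d) ∞ (extChartAt (𝓡 d) (φ z).base).symm
      ((planeCoord (φ z).base (φ z)).1) :=
    contMDiffAt_chart_symm ((extChartAt (𝓡 d) (φ z).base).map_source (by simp))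
  refine (ContMDiffAt.comp z h2 h1).congr_of_eventuallyEq ?_
  filter_upwards [hφ.continuous_base.continuousAt.eventually (chart_source_mem_nhds hx)] with z' hz'
  exact ((extChartAt (𝓡 d) (φ z).base).left_inv (by simpa using hz')).symm

/-- Smoothness, which is part of the definition of a PDE system in the preferred charts, holds in
all charts at the base point. -/
theorem IsPDESystem.contMDiff_coord (hφ : IsPDESystem e k φ) {x₀ : M} {z : N}
    (hx : (φ z).base ∈ (chartAt (Euc d) x₀).source) :
    ContMDiffAt (𝓡 e) 𝓘(ℝ, Euc d × (Euc d →L[ℝ] Euc d)) ∞ (planeCoord x₀ ∘ φ) z := by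
  have hx' := mem_chart_source (Euc d) (φ z).base
  have h1 := (planeCoord_change hx' hx).2
  refine (ContMDiffAt.comp z h1.contMDiffAt (hφ.smooth z)).congr_of_eventuallyEq ?_
  filter_upwards [hφ.continuous_base.continuousAt.eventually (chart_source_mem_nhds hx),
    hφ.continuous_base.continuousAt.eventually (chart_source_mem_nhds hx')] with z' h2 h3
  exact (planeCoord_change h3 h2).1

variable (e) in
/-- The contact distribution: the vectors that are projected into the plane `φ z`. -/
def contactDist (φ : N → Plane M d) (z : N) : Submodule ℝ (Euc e) :=
  (φ z).plane.comap (diff e d (fun z => (φ z).base) z).toLinearMap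

theorem mem_contactDist {z : N} {v : Euc e} :
    v ∈ contactDist e φ z ↔ diff e d (fun z => (φ z).base) z v ∈ (φ z).plane := Iff.rfl

/-- The orthogonal projection with kernel the contact distribution, in the preferred chart at
`z₀`. -/
def contactProj (e : ℕ) [ChartedSpace (Euc e) N] (φ : N → Plane M d) (z₀ : N) (u : Euc e) :
    Euc e →L[ℝ] Euc e :=
  gproj (ContinuousLinearMap.adjoint
      (fderiv ℝ (inCharts e d z₀ (φ z₀).base (fun z => (φ z).base)) u))
    (1 - (planeCoord (φ z₀).base (φ ((extChartAt (𝓡 e) z₀).symm u))).2)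

theorem isUnit_gram_compl {K : Submodule ℝ (Euc d)} {A : Euc d →L[ℝ] Euc e}
    (hA : ∀ v, A v = 0 → v = 0) : IsUnit (gram A (1 - K.starProjection)) := by
  rw [← Submodule.starProjection_orthogonal']
  exact gram_isUnit fun v _ => hA v

/-- The adjoint of a surjective map is injective. -/
theorem adjoint_eq_zero {A : Euc e →L[ℝ] Euc d} (hA : Function.Surjective A) {v : Euc d}
    (hv : ContinuousLinearMap.adjoint A v = 0) : v = 0 := by
  obtain ⟨w, hw⟩ := hA v
  have h := ContinuousLinearMap.adjoint_inner_left A w v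
  rw [hv, inner_zero_left, hw] at h
  exact inner_self_eq_zero.1 h.symm

/-- The projection with kernel `A⁻¹ K`, for surjective `A`. -/
theorem gproj_adjoint {K : Submodule ℝ (Euc d)} {A : Euc e →L[ℝ] Euc d}
    (hA : Function.Surjective A) :
    gproj (ContinuousLinearMap.adjoint A) (1 - K.starProjection) =
      ((Kᗮ).map (ContinuousLinearMap.adjoint A).toLinearMap).starProjection ∧
    ∀ v, gproj (ContinuousLinearMap.adjoint A) (1 - K.starProjection) v = 0 ↔ A v ∈ K := by
  have h1 := gproj_eq (K := Kᗮ) (A := ContinuousLinearMap.adjoint A) (fun v _ => adjoint_eq_zero hA)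
  rw [Submodule.starProjection_orthogonal'] at h1
  refine ⟨h1, fun v => ?_⟩
  rw [h1, Submodule.starProjection_apply_eq_zero_iff, Submodule.mem_orthogonal]
  constructor
  · intro h
    rw [← Submodule.orthogonal_orthogonal K, Submodule.mem_orthogonal]
    intro y hy
    rw [← ContinuousLinearMap.adjoint_inner_left]
    exact h _ ⟨y, hy, rfl⟩
  · rintro h _ ⟨y, hy, rfl⟩
    change inner ℝ (ContinuousLinearMap.adjoint A y) v = 0
    rw [ContinuousLinearMap.adjoint_inner_left, real_inner_comm]
    exact hy _ h

/-- In a chart, the projections along the contact distribution form a smooth field of idempotents;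
the last clause identifies the complementary projections. -/
theorem IsPDESystem.contactProj_spec (hφ : IsPDESystem e k φ) (z₀ : N) :
    ∀ᶠ u in 𝓝 (extChartAt (𝓡 e) z₀ z₀),
      ContDiffAt ℝ ∞ (contactProj e φ z₀) u ∧
      (∀ v, contactProj e φ z₀ u (contactProj e φ z₀ u v) = contactProj e φ z₀ u v) ∧
      (∀ v, contactProj e φ z₀ u v = 0 ↔
        diff e e (extChartAt (𝓡 e) z₀).symm u v ∈ contactDist e φ ((extChartAt (𝓡 e) z₀).symm u)) ∧
      1 - contactProj e φ z₀ u = ((contactDist e φ ((extChartAt (𝓡 e) z₀).symm u)).map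
        (diff e e (extChartAt (𝓡 e) z₀) ((extChartAt (𝓡 e) z₀).symm u)).toLinearMap).starProjection := by
  have hz₀ := mem_chart_source (Euc e) z₀
  have h1 := eventually_chart_symm hz₀
    (hφ.continuous_base.continuousAt.eventually (chart_source_mem_nhds (mem_chart_source (Euc d) (φ z₀).base)))
  filter_upwards [h1, extChartAt_target_mem_nhds_of_mem hz₀] with u h3 hu
  set z' := (extChartAt (𝓡 e) z₀).symm u with hz'
  have hz's : z' ∈ (chartAt (Euc e) z₀).source := by
    rw [← extChartAt_source (𝓡 e)]
    exact (extChartAt (𝓡 e) z₀).map_target hu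
  have huz : u = extChartAt (𝓡 e) z₀ z' := ((extChartAt (𝓡 e) z₀).right_inv hu).symm
  have hb := hφ.contMDiff_base z'
  have h5 := inCharts_fderiv hz's h3 (contMDiffAt_diffble hb)
  have h6 := inCharts_contDiffAt hz's h3 hb
  rw [← huz] at h5 h6
  have hsurj : Function.Surjective
      (fderiv ℝ (inCharts e d z₀ (φ z₀).base (fun z => (φ z).base)) u) := by
    rw [h5]
    intro y
    obtain ⟨v, hv⟩ := hφ.submersion z' (diff d d (extChartAt (𝓡 d) (φ z₀).base).symm
      (extChartAt (𝓡 d) (φ z₀).base (φ z').base) y)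
    refine ⟨diff e e (extChartAt (𝓡 e) z₀) z' v, ?_⟩
    simp only [ContinuousLinearMap.comp_apply]
    rw [huz, diff_chart_symm_apply hz's, hv, diff_chart_apply_symm h3]
  set K : Submodule ℝ (Euc d) := (φ z').plane.map
    (diff d d (extChartAt (𝓡 d) (φ z₀).base) (φ z').base).toLinearMap with hK
  have hP : (planeCoord (φ z₀).base (φ z')).2 = K.starProjection := rfl
  obtain ⟨h7, h8⟩ := gproj_adjoint (K := K) hsurj
  have hproj : contactProj e φ z₀ u = _ := h7
  have hker : ∀ v, contactProj e φ z₀ u v = 0 ↔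
      diff e e (extChartAt (𝓡 e) z₀).symm u v ∈ contactDist e φ z' := by
    intro v
    refine (h8 v).trans ?_
    rw [mem_contactDist, h5]
    simp only [ContinuousLinearMap.comp_apply]
    constructor
    · rintro ⟨w, hw, hwv⟩
      have := congrArg (diff d d (extChartAt (𝓡 d) (φ z₀).base).symm
        (extChartAt (𝓡 d) (φ z₀).base (φ z').base)) hwv
      rw [ContinuousLinearMap.coe_coe, diff_chart_symm_apply h3, diff_chart_symm_apply h3] at this
      rw [← this]
      exact hw
    · intro h
      exact ⟨_, h, rfl⟩
  refine ⟨?_, ?_, hker, ?_⟩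
  · have h9 : ContDiffAt ℝ ∞ (fun u => planeCoord (φ z₀).base (φ ((extChartAt (𝓡 e) z₀).symm u))) u := by
      rw [← contMDiffAt_iff_contDiffAt]
      exact ContMDiffAt.comp u (hφ.contMDiff_coord h3) (contMDiffAt_chart_symm hu)
    have h10 : ContDiffAt ℝ ∞ (fun u => ContinuousLinearMap.adjoint
        (fderiv ℝ (inCharts e d z₀ (φ z₀).base (fun z => (φ z).base)) u)) u :=
      (adjL e d).contDiff.contDiffAt.comp u (h6.fderiv_right (by simp))
    have h11 : ContDiffAt ℝ ∞ (fun u =>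
        1 - (planeCoord (φ z₀).base (φ ((extChartAt (𝓡 e) z₀).symm u))).2) u :=
      contDiffAt_const.sub (contDiffAt_snd.comp u h9)
    refine ContDiffAt.comp (g := fun q : (Euc d →L[ℝ] Euc e) × (Euc d →L[ℝ] Euc d) =>
      gproj q.1 q.2) u (contDiffAt_gproj ?_) (h10.prodMk h11)
    change IsUnit (gram _ (1 - (planeCoord (φ z₀).base (φ z')).2))
    rw [hP]
    exact isUnit_gram_compl fun v => adjoint_eq_zero hsurj
  · intro v
    rw [hproj]
    exact Submodule.starProjection_eq_self_iff.2 (Submodule.starProjection_apply_mem _ _)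
  · rw [hproj, ← Submodule.starProjection_orthogonal']
    congr 1
    ext v
    rw [← Submodule.starProjection_apply_eq_zero_iff, ← hproj, hker]
    constructor
    · intro hv
      refine ⟨_, hv, ?_⟩
      have := DFunLike.congr_fun (diff_chart_comp_symm hu) v
      exact this
    · rintro ⟨w, hw, rfl⟩
      rw [ContinuousLinearMap.coe_coe, huz, diff_chart_symm_apply hz's]
      exact hw

variable (e) in
/-- The field `θ` is a contact form near `z`. -/
def IsContactAt (φ : N → Plane M d) (θ : N → AltForm e 1) (z : N) : Prop :=
  ∀ᶠ z' in 𝓝 z, SmoothFormAt θ z' ∧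
    ∀ v, diff e d (fun z => (φ z).base) z' v ∈ (φ z').plane → θ z' ![v] = 0

/-- Every covector that annihilates the contact distribution is the value of a contact form. -/
theorem IsPDESystem.exists_contact (hφ : IsPDESystem e k φ) {z : N} {ξ : Euc e →L[ℝ] ℝ}
    (hξ : ∀ v ∈ contactDist e φ z, ξ v = 0) :
    ∃ θ, IsContactAt e φ θ z ∧ θ z = oneForm ξ := by
  have hz := mem_chart_source (Euc e) z
  have hspec := hφ.contactProj_spec z
  let θ : N → AltForm e 1 := fun z' => oneForm
    ((ξ.comp (contactProj e φ z (extChartAt (𝓡 e) z z'))).comp (diff e e (extChartAt (𝓡 e) z) z'))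
  have hθ : ∀ u ∈ (extChartAt (𝓡 e) z).target,
      covec (inChart z θ u) = ξ.comp (contactProj e φ z u) := by
    intro u hu
    simp only [inChart, θ]
    rw [(extChartAt (𝓡 e) z).right_inv hu, oneForm_comp, covec_oneForm,
      ContinuousLinearMap.comp_assoc, diff_chart_comp_symm hu, ContinuousLinearMap.comp_id]
  refine ⟨θ, ?_, ?_⟩
  · filter_upwards [eventually_chart hz hspec, chart_source_mem_nhds hz] with z' h1 hz'
    have hz'' : z' ∈ (extChartAt (𝓡 e) z).source := by rwa [extChartAt_source]
    obtain ⟨h2, -, h4, -⟩ := h1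
    constructor
    · rw [smoothFormAt_iff hz', ← contDiffAt_covec_iff]
      refine ContDiffAt.congr_of_eventuallyEq (f := fun u => ξ.comp (contactProj e φ z u))
        (contDiffAt_const.clm_comp h2) ?_
      filter_upwards [extChartAt_target_mem_nhds_of_mem hz'] with u hu using hθ u hu
    · intro v hv
      have h5 := (h4 (diff e e (extChartAt (𝓡 e) z) z' v)).2 (by
        rw [diff_chart_symm_apply hz', (extChartAt (𝓡 e) z).left_inv hz'']
        exact hv)
      change ξ (contactProj e φ z _ (diff e e (extChartAt (𝓡 e) z) z' v)) = 0
      rw [h5, map_zero]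
  · obtain ⟨-, h3, h4, -⟩ := hspec.self_of_nhds
    have hz'' : z ∈ (extChartAt (𝓡 e) z).source := mem_extChartAt_source z
    change oneForm _ = _
    congr 1
    rw [diff_extChartAt_self, ContinuousLinearMap.comp_id]
    ext v
    have h5 := (h4 (v - contactProj e φ z (extChartAt (𝓡 e) z z) v)).1 (by
      rw [map_sub, h3, sub_self])
    rw [(extChartAt (𝓡 e) z).left_inv hz'', diff_chart_symm_self] at h5
    have h6 := hξ _ h5
    rw [ContinuousLinearMap.id_apply, map_sub, sub_eq_zero] at h6
    exact h6.symm

/-- Modulo the contact forms, the exterior derivative of a contact form at a point depends only on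
the value at this point. -/
theorem IsPDESystem.extd_eq_zero (hφ : IsPDESystem e k φ) {z : N} {θ : N → AltForm e 1}
    (hθ : IsContactAt e φ θ z) (h0 : θ z = 0) {v w : Euc e} (hv : v ∈ contactDist e φ z)
    (hw : w ∈ contactDist e φ z) : extd θ z ![v, w] = 0 := by
  have hz := mem_chart_source (Euc e) z
  have hz'' : z ∈ (extChartAt (𝓡 e) z).source := mem_extChartAt_source z
  set u₀ := extChartAt (𝓡 e) z z with hu₀
  let h : Euc e → (Euc e →L[ℝ] ℝ) := fun u => covec (inChart z θ u)
  have hs : ContDiffAt ℝ ∞ (inChart z θ) u₀ := hθ.self_of_nhds.1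
  have hsh : DifferentiableAt ℝ h u₀ :=
    (contDiffAt_covec_iff.2 hs).differentiableAt (by simp)
  have hspec := hφ.contactProj_spec z
  have h_proj : DifferentiableAt ℝ (contactProj e φ z) u₀ :=
    hspec.self_of_nhds.1.differentiableAt (by simp)
  have hh0 : h u₀ = 0 := by
    simp only [h, inChart]
    rw [(extChartAt (𝓡 e) z).left_inv hz'', h0]
    exact oneForm.symm.map_zero
  -- contact forms factor through the projection along the contact distribution; as `h u₀ = 0`, the
  -- derivative of `h u (contactProj u w)` at `u₀` only involves `contactProj u₀ w`, which vanishes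
  -- for `w` in the distribution
  have heq : ∀ w, (fun u => h u w) =ᶠ[𝓝 u₀] fun u => h u (contactProj e φ z u w) := by
    intro w
    filter_upwards [hspec, eventually_chart_symm hz hθ] with u h1 h2
    obtain ⟨-, h3, h4, -⟩ := h1
    have h5 := (h4 (w - contactProj e φ z u w)).1 (by rw [map_sub, h3, sub_self])
    have h6 := h2.2 _ h5
    rw [← covec_apply] at h6
    have h7 : h u (w - contactProj e φ z u w) = 0 := by
      simp only [h, inChart, covec_comp]
      exact h6
    rwa [map_sub, sub_eq_zero] at h7
  have hD : ∀ w ∈ contactDist e φ z, ∀ v, fderiv ℝ (fun u => h u w) u₀ v = 0 := by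
    intro w hw v
    have h1 : contactProj e φ z u₀ w = 0 := by
      rw [hspec.self_of_nhds.2.2.1, (extChartAt (𝓡 e) z).left_inv hz'', diff_chart_symm_self]
      exact hw
    rw [(heq w).fderiv_eq]
    have h2 : HasFDerivAt (fun u => contactProj e φ z u w)
        ((fderiv ℝ (contactProj e φ z) u₀).flip w) u₀ := by
      have := h_proj.hasFDerivAt.clm_apply (hasFDerivAt_const w u₀)
      simpa using this
    rw [(hsh.hasFDerivAt.clm_apply h2).fderiv]
    simp [hh0, h1]
  have hform : ∀ (x : Fin 1 → Euc e), (fun u => inChart z θ u x) = fun u => h u (x 0) := by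
    intro x
    funext u
    simp only [h, covec_apply]
    congr 1
    funext i
    fin_cases i
    rfl
  rw [extd, extDeriv_apply (hs.differentiableAt (by simp))]
  apply Finset.sum_eq_zero
  intro i _
  rw [hform]
  have : (i.removeNth ![v, w]) 0 ∈ contactDist e φ z := by
    fin_cases i
    · exact hw
    · exact hv
  rw [hD _ this, smul_zero]

end PDESystem

section Generate

variable {d : ℕ}

theorem GradedIdeal.subset_generate {S : ∀ n, Set (AltForm d n)} {n : ℕ} {η : AltForm d n}
    (h : η ∈ S n) : η ∈ (GradedIdeal.generate S).deg n := by
  simp only [GradedIdeal.generate, Submodule.mem_iInf]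
  exact fun J => J.2 n h

theorem GradedIdeal.generate_le {S : ∀ n, Set (AltForm d n)} {J : GradedIdeal d}
    (h : ∀ n, S n ⊆ J.deg n) (n : ℕ) : (GradedIdeal.generate S).deg n ≤ J.deg n :=
  iInf_le (fun J : {J : GradedIdeal d // ∀ m, S m ⊆ J.deg m} => J.1.deg n) ⟨J, h⟩

end Generate

section Contact
variable {M : Type*} {d : ℕ} [TopologicalSpace M] [ChartedSpace (Euc d) M] [IsManifold (𝓡 d) ∞ M]
variable {N : Type*} {e : ℕ} [TopologicalSpace N] [ChartedSpace (Euc e) N] [IsManifold (𝓡 e) ∞ N]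
variable {k : ℕ} {φ : N → Plane M d} {z : N} {θ : N → AltForm e 1}

theorem IsContactAt.mem_one (h : IsContactAt e φ θ z) : θ z ∈ (contactIdeal e φ z).deg 1 :=
  GradedIdeal.subset_generate ⟨θ, h, rfl⟩

theorem IsContactAt.extd_mem_two (h : IsContactAt e φ θ z) :
    extd θ z ∈ (contactIdeal e φ z).deg 2 :=
  GradedIdeal.subset_generate (n := 2) ⟨θ, h, rfl⟩

/-- The contact ideal is the smallest ideal that contains the contact forms and their exterior
derivatives. -/
theorem contactIdeal_le {J : GradedIdeal e}
    (h : ∀ θ, IsContactAt e φ θ z → θ z ∈ J.deg 1 ∧ extd θ z ∈ J.deg 2) (n : ℕ) :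
    (contactIdeal e φ z).deg n ≤ J.deg n := by
  refine GradedIdeal.generate_le (fun n => ?_) n
  match n with
  | 0 => exact Set.empty_subset _
  | 1 => rintro _ ⟨θ, hθ, rfl⟩; exact (h θ hθ).1
  | 2 => rintro _ ⟨θ, hθ, rfl⟩; exact (h θ hθ).2
  | (n + 3) => exact Set.empty_subset _

theorem IsContactAt.apply_eq_zero (h : IsContactAt e φ θ z) {v : Euc e}
    (hv : v ∈ contactDist e φ z) : covec (θ z) v = 0 := by
  rw [covec_apply]
  exact h.self_of_nhds.2 v hv

theorem IsPDESystem.oneForm_mem (hφ : IsPDESystem e k φ) {ξ : Euc e →L[ℝ] ℝ}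
    (hξ : ∀ v ∈ contactDist e φ z, ξ v = 0) : oneForm ξ ∈ (contactIdeal e φ z).deg 1 := by
  obtain ⟨θ, hθ, h⟩ := hφ.exists_contact hξ
  rw [← h]
  exact hθ.mem_one

theorem exists_covector_separating {K : Submodule ℝ (Euc e)} {v : Euc e} (hv : v ∉ K) :
    ∃ ξ : Euc e →L[ℝ] ℝ, (∀ w ∈ K, ξ w = 0) ∧ ξ v ≠ 0 := by
  have h1 : Kᗮ.starProjection v ≠ 0 := by
    rw [Ne, Submodule.starProjection_apply_eq_zero_iff, Submodule.orthogonal_orthogonal]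
    exact hv
  refine ⟨innerSL ℝ (Kᗮ.starProjection v), fun w hw => ?_, ?_⟩
  · rw [innerSL_apply_apply, real_inner_comm]
    exact (Submodule.starProjection_apply_mem Kᗮ v) w hw
  · rw [innerSL_apply_apply]
    intro h
    apply h1
    have h2 : Kᗮ.starProjection (Kᗮ.starProjection v) = Kᗮ.starProjection v :=
      Submodule.starProjection_eq_self_iff.2 (Submodule.starProjection_apply_mem _ _)
    rw [← h2, Submodule.inner_starProjection_left_eq_right] at h
    exact inner_self_eq_zero.1 h

/-- A plane that annihilates the contact ideal lies in the contact distribution. -/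
theorem IsPDESystem.le_contactDist (hφ : IsPDESystem e k φ) {P : Submodule ℝ (Euc e)}
    (hP : ∀ η ∈ (contactIdeal e φ z).deg 1, η.compContinuousLinearMap P.subtypeL = 0) :
    P ≤ contactDist e φ z := by
  intro v hv
  by_contra hvD
  obtain ⟨ξ, h1, h2⟩ := exists_covector_separating hvD
  have h3 := DFunLike.congr_fun (hP _ (hφ.oneForm_mem h1)) (fun _ => ⟨v, hv⟩)
  exact h2 h3

end Contact

/-! ### Lifting planes from a quotient -/

section Lift

variable {G : Type*} {dG : ℕ} [Group G] [TopologicalSpace G] [ChartedSpace (Euc dG) G]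
  [LieGroup (𝓡 dG) ∞ G]
variable {L : Type*} {c : ℕ} [TopologicalSpace L] [ChartedSpace (Euc c) L] [IsManifold (𝓡 c) ∞ L]
variable {M : Type*} {d : ℕ} [TopologicalSpace M] [ChartedSpace (Euc d) M] [IsManifold (𝓡 d) ∞ M]
  [MulAction G M] [ContMDiffSMul (𝓡 dG) (𝓡 d) ∞ G M]
variable {B : Type*} {n : ℕ} [TopologicalSpace B] [ChartedSpace (Euc n) B] [IsManifold (𝓡 n) ∞ B]
variable {U : Set M} {p : M → B} {k : ℕ} {χ : M → Plane L c}

variable (d n) in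
/-- The image of a plane under the differential of a map. -/
def mapPlane (p : M → B) (Q : Plane M d) : Plane B n :=
  ⟨p Q.base, Q.plane.map (diff d n p Q.base).toLinearMap⟩

/-- The distribution of the PDE system `χ` meets the fibres of `p` trivially over `U`. -/
def IsTransversal (d n : ℕ) [ChartedSpace (Euc d) M] [ChartedSpace (Euc n) B] (χ : M → Plane L c)
    (U : Set M) (p : M → B) : Prop :=
  ∀ x ∈ U, ∀ v ∈ contactDist d χ x, diff d n p x v = 0 → v = 0

/-- The right inverse of the differential of `p` with values in the distribution of `χ`, in the
preferred charts at `x₀` and `p x₀`. -/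
def liftOp (d n : ℕ) [ChartedSpace (Euc d) M] [ChartedSpace (Euc n) B] (χ : M → Plane L c)
    (p : M → B) (x₀ : M) (u : Euc d) : Euc n →L[ℝ] Euc d :=
  pinv (fderiv ℝ (inCharts d n x₀ (p x₀) p) u) (1 - contactProj d χ x₀ u)

/-- The lift operator is smooth, and it inverts the differential of `p` on the distribution of `χ`.
-/
theorem IsTransversal.liftOp_spec (ht : IsTransversal d n χ U p) {x₀ x : M} (hx : x ∈ U)
    (hxs : x ∈ (chartAt (Euc d) x₀).source) (hps : p x ∈ (chartAt (Euc n) (p x₀)).source)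
    (hp : ContMDiffAt (𝓡 d) (𝓡 n) ∞ p x)
    (hc1 : ContDiffAt ℝ ∞ (contactProj d χ x₀) (extChartAt (𝓡 d) x₀ x))
    (hc2 : 1 - contactProj d χ x₀ (extChartAt (𝓡 d) x₀ x) = ((contactDist d χ x).map
        (diff d d (extChartAt (𝓡 d) x₀) x).toLinearMap).starProjection) :
    ContDiffAt ℝ ∞ (liftOp d n χ p x₀) (extChartAt (𝓡 d) x₀ x) ∧
    ∀ v ∈ contactDist d χ x, liftOp d n χ p x₀ (extChartAt (𝓡 d) x₀ x)
      (diff n n (extChartAt (𝓡 n) (p x₀)) (p x) (diff d n p x v)) =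
        diff d d (extChartAt (𝓡 d) x₀) x v := by
  have hA := inCharts_fderiv hxs hps (contMDiffAt_diffble hp)
  have hphat := inCharts_contDiffAt hxs hps hp
  have hAval : ∀ v, fderiv ℝ (inCharts d n x₀ (p x₀) p) (extChartAt (𝓡 d) x₀ x)
      (diff d d (extChartAt (𝓡 d) x₀) x v) =
      diff n n (extChartAt (𝓡 n) (p x₀)) (p x) (diff d n p x v) := by
    intro v
    rw [hA]
    simp only [ContinuousLinearMap.comp_apply]
    rw [diff_chart_symm_apply hxs]
  have hAinj : ∀ v ∈ (contactDist d χ x).map (diff d d (extChartAt (𝓡 d) x₀) x).toLinearMap,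
      fderiv ℝ (inCharts d n x₀ (p x₀) p) (extChartAt (𝓡 d) x₀ x) v = 0 → v = 0 := by
    rintro _ ⟨v, hv, rfl⟩ h0
    rw [ContinuousLinearMap.coe_coe, hAval] at h0
    have h1 := diff_chart_symm_apply hps (diff d n p x v)
    rw [h0, map_zero] at h1
    rw [ht _ hx v hv h1.symm, map_zero]
  constructor
  · have h1 : ContDiffAt ℝ ∞ (fun u => (fderiv ℝ (inCharts d n x₀ (p x₀) p) u,
        1 - contactProj d χ x₀ u)) (extChartAt (𝓡 d) x₀ x) :=
      (hphat.fderiv_right (m := ∞) (by simp)).prodMk (contDiffAt_const.sub hc1)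
    have h2 : IsUnit (gram (fderiv ℝ (inCharts d n x₀ (p x₀) p) (extChartAt (𝓡 d) x₀ x))
        (1 - contactProj d χ x₀ (extChartAt (𝓡 d) x₀ x))) := by
      rw [hc2]
      exact gram_isUnit hAinj
    exact ContDiffAt.comp (extChartAt (𝓡 d) x₀ x)
      (contDiffAt_pinv (q := (fderiv ℝ (inCharts d n x₀ (p x₀) p) (extChartAt (𝓡 d) x₀ x),
        1 - contactProj d χ x₀ (extChartAt (𝓡 d) x₀ x))) h2) h1
  · intro v hv
    rw [← hAval, liftOp, hc2]
    exact pinv_apply hAinj ⟨v, hv, rfl⟩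

/-- The lift of planes along the local section `s` of `p`, in coordinates. -/
def planeLift (d n : ℕ) [ChartedSpace (Euc d) M] [ChartedSpace (Euc n) B] (χ : M → Plane L c)
    (p : M → B) (x₀ : M) (s : B → M) (q : Euc n × (Euc n →L[ℝ] Euc n)) :
    Euc d × (Euc d →L[ℝ] Euc d) :=
  (inCharts n d (p x₀) x₀ s q.1, gproj (liftOp d n χ p x₀ (inCharts n d (p x₀) x₀ s q.1)) q.2)

/-- For planes in the distribution of `χ` the lift recovers the plane from its image, and it is
smooth at this image. -/
theorem planeLift_spec {x₀ x : M} {b : B} {s : B → M} (hx : s b = x) (hb : p x = b)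
    (hbs : ContMDiffAt (𝓡 n) (𝓡 d) ∞ s b)
    (hxs : x ∈ (chartAt (Euc d) x₀).source) (hps : b ∈ (chartAt (Euc n) (p x₀)).source)
    (h1 : ContDiffAt ℝ ∞ (liftOp d n χ p x₀) (extChartAt (𝓡 d) x₀ x))
    (h2 : ∀ v ∈ contactDist d χ x, liftOp d n χ p x₀ (extChartAt (𝓡 d) x₀ x)
      (diff n n (extChartAt (𝓡 n) (p x₀)) b (diff d n p x v)) =
        diff d d (extChartAt (𝓡 d) x₀) x v)
    {P : Submodule ℝ (Euc d)} (hP : P ≤ contactDist d χ x) :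
    planeLift d n χ p x₀ s (planeCoord (p x₀) (mapPlane d n p ⟨x, P⟩)) = planeCoord x₀ ⟨x, P⟩ ∧
    ContDiffAt ℝ ∞ (planeLift d n χ p x₀ s) (planeCoord (p x₀) (mapPlane d n p ⟨x, P⟩)) := by
  obtain ⟨σ', hσ'⟩ : ∃ σ', σ' = liftOp d n χ p x₀ (extChartAt (𝓡 d) x₀ x) := ⟨_, rfl⟩
  rw [← hσ'] at h2
  -- the lift at `b` is the map `σ`, written in charts
  let σ : Euc n →L[ℝ] Euc d := (diff d d (extChartAt (𝓡 d) x₀).symm (extChartAt (𝓡 d) x₀ x)).comp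
    (σ'.comp (diff n n (extChartAt (𝓡 n) (p x₀)) b))
  have hσ : ∀ v ∈ contactDist d χ x, σ (diff d n p x v) = v := by
    intro v hv
    simp only [σ, ContinuousLinearMap.comp_apply]
    rw [h2 v hv, diff_chart_symm_apply hxs]
  have hS' : σ' = (diff d d (extChartAt (𝓡 d) x₀) x).comp (σ.comp
      (diff n n (extChartAt (𝓡 n) (p x₀)).symm (extChartAt (𝓡 n) (p x₀) b))) := by
    ext1 v
    simp only [σ, ContinuousLinearMap.comp_apply]
    rw [diff_chart_apply_symm hxs, diff_chart_apply_symm hps]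
  clear_value σ
  have hσinj : ∀ v ∈ P.map (diff d n p x).toLinearMap, σ v = 0 → v = 0 := by
    rintro _ ⟨v, hv, rfl⟩ h0
    rw [ContinuousLinearMap.coe_coe, hσ v (hP hv)] at h0
    rw [h0, map_zero]
  have hσmap : (P.map (diff d n p x).toLinearMap).map σ.toLinearMap = P := by
    ext v
    constructor
    · rintro ⟨_, ⟨w, hw, rfl⟩, rfl⟩
      change σ (diff d n p x w) ∈ P
      rw [hσ w (hP hw)]
      exact hw
    · intro hv
      exact ⟨_, ⟨v, hv, rfl⟩, hσ v (hP hv)⟩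
  have hbase : (mapPlane d n p ⟨x, P⟩).base = b := hb
  obtain ⟨h3, h4⟩ := planeCoord_map (x₀ := p x₀) (y₀ := x₀)
    (Q := mapPlane d n p ⟨x, P⟩) (y := x) (by rw [hbase]; exact hps) hxs hσinj
    (σ' := σ') (by rw [hbase]; exact hS')
  obtain ⟨q, hq⟩ : ∃ q, q = planeCoord (p x₀) (mapPlane d n p ⟨x, P⟩) := ⟨_, rfl⟩
  rw [← hq] at h3 h4 ⊢
  have hq1 : q.1 = extChartAt (𝓡 n) (p x₀) b := by rw [hq, ← hb]; rfl
  have hval : inCharts n d (p x₀) x₀ s q.1 = extChartAt (𝓡 d) x₀ x := by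
    rw [hq1, inCharts_apply hps, hx]
  constructor
  · rw [planeLift, hval, ← hσ', ← h3]
    congr 1
    exact Plane.ext rfl hσmap
  · have h5 : ContDiffAt ℝ ∞ (fun q : Euc n × (Euc n →L[ℝ] Euc n) =>
        inCharts n d (p x₀) x₀ s q.1) q := by
      refine ContDiffAt.comp (g := inCharts n d (p x₀) x₀ s) q ?_ contDiffAt_fst
      rw [hq1]
      exact inCharts_contDiffAt hps (by rwa [hx]) hbs
    have h6 : ContDiffAt ℝ ∞ (fun q : Euc n × (Euc n →L[ℝ] Euc n) =>
        liftOp d n χ p x₀ (inCharts n d (p x₀) x₀ s q.1)) q := by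
      refine ContDiffAt.comp (g := liftOp d n χ p x₀) q ?_ h5
      rw [hval]
      exact h1
    refine h5.prodMk (ContDiffAt.comp (g := fun q : (Euc n →L[ℝ] Euc d) × (Euc n →L[ℝ] Euc n) =>
      gproj q.1 q.2) q (contDiffAt_gproj ?_) (h6.prodMk contDiffAt_snd))
    change IsUnit (gram (liftOp d n χ p x₀ (inCharts n d (p x₀) x₀ s q.1)) q.2)
    rw [hval, ← hσ']
    exact h4

/-- Planes in the image of a distribution that is transversal to the fibres of `p` are lifted
smoothly to the distribution, along a local section of `p`. -/
theorem IsQuot.exists_plane_lift (h : IsQuot G d n U p) (hχ : IsPDESystem d k χ)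
    (ht : IsTransversal d n χ U p) {x₀ : M} (hx₀ : x₀ ∈ U) :
    ∃ (s : B → M) (Λ : Euc n × (Euc n →L[ℝ] Euc n) → Euc d × (Euc d →L[ℝ] Euc d)), s (p x₀) = x₀ ∧
      ∀ᶠ b in 𝓝 (p x₀), s b ∈ U ∧ ContMDiffAt (𝓡 n) (𝓡 d) ∞ s b ∧ p (s b) = b ∧
        b ∈ (chartAt (Euc n) (p x₀)).source ∧ s b ∈ (chartAt (Euc d) x₀).source ∧
        ∀ P ≤ contactDist d χ (s b),
          Λ (planeCoord (p x₀) (mapPlane d n p ⟨s b, P⟩)) = planeCoord x₀ ⟨s b, P⟩ ∧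
          ContDiffAt ℝ ∞ Λ (planeCoord (p x₀) (mapPlane d n p ⟨s b, P⟩)) := by
  obtain ⟨s, hs0, hs⟩ := h.exists_section hx₀
  have hb₀ := mem_chart_source (Euc n) (p x₀)
  have hx₀' := mem_chart_source (Euc d) x₀
  refine ⟨s, planeLift d n χ p x₀ s, hs0, ?_⟩
  have hcont : Filter.Tendsto s (𝓝 (p x₀)) (𝓝 x₀) := by
    have := hs.self_of_nhds.2.1.continuousAt
    rwa [ContinuousAt, hs0] at this
  have hspec := eventually_chart hx₀' (hχ.contactProj_spec x₀)
  filter_upwards [hs, chart_source_mem_nhds hb₀, hcont.eventually hspec,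
    hcont.eventually (chart_source_mem_nhds hx₀')] with b ⟨hbU, hbs, hpb⟩ hbsrc hsp hssrc
  refine ⟨hbU, hbs, hpb, hbsrc, hssrc, fun P hP => ?_⟩
  have hssrc' : s b ∈ (extChartAt (𝓡 d) x₀).source := by rwa [extChartAt_source]
  obtain ⟨hc1, -, -, hc2⟩ := hsp
  rw [(extChartAt (𝓡 d) x₀).left_inv hssrc'] at hc2
  obtain ⟨h1, h2⟩ := ht.liftOp_spec hbU hssrc (by rwa [hpb]) (h.smooth _ hbU) hc1 hc2
  rw [hpb] at h2
  exact planeLift_spec rfl hpb hbs hssrc hbsrc h1 h2 hP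

end Lift

/-! ### Linear algebra of graded ideals -/

section LinearAlgebra

variable {d e : ℕ}

/-- A right inverse of a surjective linear map can be chosen compatibly with subspaces. -/
theorem exists_rightInverse_compatible {f : Euc e →L[ℝ] Euc d} (hf : Function.Surjective f)
    {K : Submodule ℝ (Euc e)} {K' : Submodule ℝ (Euc d)}
    (hK : ∀ u ∈ K', ∃ v ∈ K, f v = u) :
    ∃ σ : Euc d →L[ℝ] Euc e, (∀ u, f (σ u) = u) ∧ ∀ u ∈ K', σ u ∈ K := by
  obtain ⟨σ₂, hσ₂⟩ := f.toLinearMap.exists_rightInverse_of_surjective (LinearMap.range_eq_top.2 hf)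
  let g : K →ₗ[ℝ] Euc d := f.toLinearMap.domRestrict K
  obtain ⟨r, hr⟩ := g.rangeRestrict.exists_rightInverse_of_surjective g.range_rangeRestrict
  have hP : ∀ u, K'.starProjection.toLinearMap u ∈ LinearMap.range g := by
    intro u
    obtain ⟨v, hv, hvu⟩ := hK _ (Submodule.starProjection_apply_mem K' u)
    exact ⟨⟨v, hv⟩, hvu⟩
  let σ₁ : Euc d →ₗ[ℝ] K := r.comp (K'.starProjection.toLinearMap.codRestrict _ hP)
  have h1 : ∀ u, f (σ₁ u) = K'.starProjection u := by
    intro u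
    exact congrArg Subtype.val (LinearMap.congr_fun hr
      (K'.starProjection.toLinearMap.codRestrict _ hP u))
  refine ⟨LinearMap.toContinuousLinearMap
    (K.subtype.comp σ₁ + σ₂.comp (1 - K'.starProjection.toLinearMap)), fun u => ?_, fun u hu => ?_⟩
  · change f (σ₁ u + σ₂ (u - K'.starProjection u)) = u
    rw [map_add, h1]
    have h2 : f (σ₂ (u - K'.starProjection u)) = u - K'.starProjection u := LinearMap.congr_fun hσ₂ _
    rw [h2, add_sub_cancel]
  · change (σ₁ u : Euc e) + σ₂ (u - K'.starProjection u) ∈ K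
    rw [Submodule.starProjection_eq_self_iff.2 hu, sub_self, map_zero, add_zero]
    exact (σ₁ u).2

theorem wedge_oneForm_apply (α β : Euc d →L[ℝ] ℝ) (v : Fin 2 → Euc d) :
    wedge α (oneForm β) v = α (v 0) * β (v 1) - α (v 1) * β (v 0) := by
  rw [wedge, ContinuousAlternatingMap.alternatizeUncurryFin_apply, Fin.sum_univ_two]
  simp [oneForm_apply, Fin.removeNth, Fin.tail, sub_eq_add_neg]

/-- A form of degree two that vanishes on a subspace belongs to every ideal that contains the
annihilator of this subspace. -/
theorem GradedIdeal.mem_two_of_annihilator {J : GradedIdeal d} {K : Submodule ℝ (Euc d)}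
    (hJ : ∀ ξ : Euc d →L[ℝ] ℝ, (∀ v ∈ K, ξ v = 0) → oneForm ξ ∈ J.deg 1)
    {κ : AltForm d 2} (hκ : ∀ u ∈ K, ∀ v ∈ K, κ ![u, v] = 0) : κ ∈ J.deg 2 := by
  set q := K.starProjection with hq
  let b := EuclideanSpace.basisFun (Fin d) ℝ
  let α : Fin d → (Euc d →L[ℝ] ℝ) := fun i => (innerSL ℝ (b i)).comp (1 - q)
  let A : Euc d → (Euc d →L[ℝ] ℝ) := fun u => covec (κ.curryLeft u)
  have hA : ∀ u v, A u v = κ ![u, v] := by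
    intro u v
    simp only [A, covec_apply]
    rfl
  have hAadd : ∀ u u' v, A (u - u') v = A u v - A u' v := by
    intro u u' v
    simp only [A, covec_apply, map_sub]
    rfl
  have hAsymm : ∀ u v, A u v = - A v u := by
    intro u v
    rw [hA, hA]
    have := κ.map_swap ![v, u] (i := 0) (j := 1) (by simp)
    refine Eq.trans ?_ this
    change κ ![u, v] = κ _
    congr 1
    funext i
    fin_cases i <;> rfl
  -- the form is `∑ᵢ αᵢ ∧ βᵢ`, where the `αᵢ` are the coordinates of the projection with kernel `K`
  let β : Fin d → (Euc d →L[ℝ] ℝ) := fun i => (1 / 2 : ℝ) • (A (b i)).comp (1 + q)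
  have hsum : ∀ u w, ∑ i, α i u * A (b i) w = A (u - q u) w := by
    intro u w
    have h1 : u - q u = ∑ i, α i u • b i := by
      conv_lhs => rw [← b.sum_repr' (u - q u)]
      rfl
    have h2 : A (∑ i, α i u • b i) w = ∑ i, α i u * A (b i) w := by
      simp only [A, covec_apply, map_sum, map_smul]
      rw [ContinuousAlternatingMap.sum_apply]
      rfl
    rw [h1, h2]
  have heq : κ = - ∑ i, wedge (β i) (oneForm (α i)) := by
    ext v
    have hv : κ v = A (v 0) (v 1) := by
      rw [hA]
      congr 1
      funext i
      fin_cases i <;> rfl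
    have h0 : A (q (v 0)) (q (v 1)) = 0 := by
      rw [hA]
      exact hκ _ (Submodule.starProjection_apply_mem _ _) _ (Submodule.starProjection_apply_mem _ _)
    have h1 : (∑ i, wedge (β i) (oneForm (α i))) v =
        (1 / 2) * A (v 1 - q (v 1)) (v 0 + q (v 0)) - (1 / 2) * A (v 0 - q (v 0)) (v 1 + q (v 1)) := by
      rw [ContinuousAlternatingMap.sum_apply, ← hsum, ← hsum, Finset.mul_sum, Finset.mul_sum,
        ← Finset.sum_sub_distrib]
      refine Finset.sum_congr rfl fun i _ => ?_
      rw [wedge_oneForm_apply]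
      have hβ : ∀ u, β i u = 1 / 2 * A (b i) (u + q u) := fun u => rfl
      rw [hβ, hβ]
      ring
    rw [ContinuousAlternatingMap.neg_apply, h1, hv, hAadd, hAadd]
    simp only [map_add]
    rw [hAsymm (v 1) (v 0), hAsymm (v 1) (q (v 0)), hAsymm (q (v 1)) (v 0),
      hAsymm (q (v 1)) (q (v 0)), h0]
    ring
  rw [heq]
  refine (J.deg 2).neg_mem ((J.deg 2).sum_mem fun i _ => J.wedge_mem 1 _ _ (hJ _ fun v hv => ?_))
  change innerSL ℝ (b i) (v - q v) = 0
  rw [hq, Submodule.starProjection_eq_self_iff.2 hv, sub_self, map_zero]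

/-- The forms whose pullback under a linear map belongs to a given ideal. -/
def GradedIdeal.pull (J : GradedIdeal d) (σ : Euc d →L[ℝ] Euc e) : GradedIdeal e where
  deg m :=
    { carrier := {η | η.compContinuousLinearMap σ ∈ J.deg m}
      add_mem' := fun ha hb => (J.deg m).add_mem ha hb
      zero_mem' := (J.deg m).zero_mem
      smul_mem' := fun c _ ha => (J.deg m).smul_mem c ha }
  wedge_mem m α η h := by
    change (wedge α η).compContinuousLinearMap σ ∈ J.deg (m + 1)
    rw [wedge_comp]
    exact J.wedge_mem m _ _ h

theorem GradedIdeal.mem_pull {J : GradedIdeal d} {σ : Euc d →L[ℝ] Euc e} {m : ℕ}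
    {η : AltForm e m} : η ∈ (J.pull σ).deg m ↔ η.compContinuousLinearMap σ ∈ J.deg m := Iff.rfl

end LinearAlgebra

/-! ### The reduced PDE system -/

section Reduction

variable {G : Type*} {dG : ℕ} [Group G] [TopologicalSpace G] [ChartedSpace (Euc dG) G]
  [LieGroup (𝓡 dG) ∞ G]
variable {L : Type*} {c : ℕ} [TopologicalSpace L] [ChartedSpace (Euc c) L] [IsManifold (𝓡 c) ∞ L]
variable {M : Type*} {d : ℕ} [TopologicalSpace M] [ChartedSpace (Euc d) M] [IsManifold (𝓡 d) ∞ M]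
  [MulAction G M] [ContMDiffSMul (𝓡 dG) (𝓡 d) ∞ G M]
variable {N : Type*} {e : ℕ} [TopologicalSpace N] [ChartedSpace (Euc e) N] [IsManifold (𝓡 e) ∞ N]
  [MulAction G N] [ContMDiffSMul (𝓡 dG) (𝓡 e) ∞ G N]
variable {B : Type*} {n : ℕ} [TopologicalSpace B] [ChartedSpace (Euc n) B] [IsManifold (𝓡 n) ∞ B]
variable {B' : Type*} {n' : ℕ} [TopologicalSpace B'] [ChartedSpace (Euc n') B']
  [IsManifold (𝓡 n') ∞ B']
variable {U : Set M} {p : M → B} {U' : Set N} {p' : N → B'} {k : ℕ} {χ : M → Plane L c}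
  {φ : N → Plane M d} {ψ : B' → Plane B n}

/-- The PDE systems `χ` on `M` and `φ` on `N` are consecutive members of a prolongation tower, and
`ψ` is the map of quotients that `φ` induces: the planes `φ w` are integral elements of the contact
ideal of `χ` (`integral`), `G` acts on `N` by the prolonged action (`smul_eq`), `p : U → B` and
`p' : U' → B'` are quotients by `G` (`quot`, `quot'`), where `U'` is the preimage of `U` (`mem_iff`),
the contact distribution of `χ` is transversal to the orbits (`transversal`), and `ψ` assigns to the
orbit of `w` the image of the plane `φ w` (`induced`). -/
structure IsReduction (G : Type*) [Group G] [MulAction G M] [MulAction G N] (k : ℕ)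
    (χ : M → Plane L c) (φ : N → Plane M d) (U : Set M) (p : M → B) (U' : Set N) (p' : N → B')
    (ψ : B' → Plane B n) (n' : ℕ) (e : ℕ) [ChartedSpace (Euc n') B'] [ChartedSpace (Euc e) N] :
    Prop where
  system : IsPDESystem d k χ
  prolonged : IsPDESystem e k φ
  smul_eq : ∀ (g : G) (w : N), φ (g • w) = ⟨g • (φ w).base,
    (φ w).plane.map (diff d d (fun x : M => g • x) (φ w).base).toLinearMap⟩
  integral : ∀ w, φ w ∈ integralElements k (contactIdeal d χ)
  quot : IsQuot G d n U p
  quot' : IsQuot G e n' U' p'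
  mem_iff : ∀ w, w ∈ U' ↔ (φ w).base ∈ U
  transversal : IsTransversal d n χ U p
  induced : ∀ w ∈ U', ψ (p' w) = mapPlane d n p (φ w)

theorem IsReduction.le_dist (h : IsReduction G k χ φ U p U' p' ψ n' e) (w : N) :
    (φ w).plane ≤ contactDist d χ (φ w).base :=
  h.system.le_contactDist ((h.integral w).2 1)

theorem IsReduction.base_smul (h : IsReduction G k χ φ U p U' p' ψ n' e) (g : G) (w : N) :
    (φ (g • w)).base = g • (φ w).base := by rw [h.smul_eq]

/-- By transversality, planes in the contact distribution are determined by their images in the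
quotient. -/
theorem IsReduction.mapPlane_injective (h : IsReduction G k χ φ U p U' p' ψ n' e) {x : M}
    (hx : x ∈ U) {P P' : Submodule ℝ (Euc d)} (hP : P ≤ contactDist d χ x)
    (hP' : P' ≤ contactDist d χ x) (heq : mapPlane d n p ⟨x, P⟩ = mapPlane d n p ⟨x, P'⟩) :
    P = P' := by
  have key : ∀ P P' : Submodule ℝ (Euc d), P ≤ contactDist d χ x → P' ≤ contactDist d χ x →
      mapPlane d n p ⟨x, P⟩ = mapPlane d n p ⟨x, P'⟩ → P ≤ P' := by
    intro P P' hP hP' heq v hv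
    have h1 : diff d n p x v ∈ (mapPlane d n p ⟨x, P'⟩).plane := by
      rw [← heq]
      exact ⟨v, hv, rfl⟩
    obtain ⟨w, hw, hwv⟩ := h1
    have h2 := h.transversal x hx (v - w) ((contactDist d χ x).sub_mem (hP hv) (hP' hw)) (by
      rw [map_sub, sub_eq_zero]
      exact hwv.symm)
    rw [sub_eq_zero] at h2
    rw [h2]
    exact hw
  exact le_antisymm (key P P' hP hP' heq) (key P' P hP' hP heq.symm)

/-- If two planes of the prolonged system have the same image, their base points are related by a
group element; after translation by this element the two planes lie in the contact distribution at
one point, and coincide. -/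
theorem IsReduction.injective (h : IsReduction G k χ φ U p U' p' ψ n' e) :
    Function.Injective ψ := by
  intro b₁ b₂ heq
  obtain ⟨w₁, hw₁, rfl⟩ := h.quot'.onto b₁
  obtain ⟨w₂, hw₂, rfl⟩ := h.quot'.onto b₂
  have h1 : p (φ w₁).base = p (φ w₂).base := by
    have := congrArg Plane.base heq
    rwa [h.induced w₁ hw₁, h.induced w₂ hw₂] at this
  obtain ⟨g, hg⟩ := (h.quot.eq_iff _ ((h.mem_iff w₁).1 hw₁) _ ((h.mem_iff w₂).1 hw₂)).1 h1
  have hgw : g • w₁ ∈ U' := h.quot'.smul_mem g w₁ hw₁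
  have h2 : p' (g • w₁) = p' w₁ := h.quot'.smul_eq g hw₁
  rw [← h2] at heq ⊢
  rw [h.induced _ hgw, h.induced _ hw₂] at heq
  have hb : (φ (g • w₁)).base = (φ w₂).base := by rw [h.base_smul, hg]
  have hle := h.le_dist (g • w₁)
  have hQ : φ (g • w₁) = ⟨(φ w₂).base, (φ (g • w₁)).plane⟩ := Plane.ext hb rfl
  rw [hb] at hle
  have h3 : (φ (g • w₁)).plane = (φ w₂).plane := by
    refine h.mapPlane_injective ((h.mem_iff w₂).1 hw₂) hle (h.le_dist w₂) ?_
    rw [← hQ]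
    exact heq
  rw [h.prolonged.isEmbedding.injective (Plane.ext hb h3)]

/-- The coordinate expression of the induced map is smooth. -/
theorem IsReduction.smooth (h : IsReduction G k χ φ U p U' p' ψ n' e) {w : N} (hw : w ∈ U') :
    ContMDiffAt (𝓡 n') 𝓘(ℝ, Euc n × (Euc n →L[ℝ] Euc n)) ∞
      (planeCoord (ψ (p' w)).base ∘ ψ) (p' w) ∧
    (∀ᶠ b' in 𝓝 (p' w), (ψ b').base ∈ (chartAt (Euc n) (ψ (p' w)).base).source) ∧
    ContMDiffAt (𝓡 n') (𝓡 n) ∞ (fun b' => (ψ b').base) (p' w) := by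
  have hx₀U := (h.mem_iff w).1 hw
  have hb₀ : (ψ (p' w)).base = p (φ w).base := by rw [h.induced w hw]; rfl
  obtain ⟨s, hs0, hs⟩ := h.quot'.exists_section hw
  have hscont : Filter.Tendsto s (𝓝 (p' w)) (𝓝 w) := by
    have := hs.self_of_nhds.2.1.continuousAt
    rwa [ContinuousAt, hs0] at this
  have hbcont : Filter.Tendsto (fun b' => (φ (s b')).base) (𝓝 (p' w)) (𝓝 (φ w).base) :=
    h.prolonged.continuous_base.continuousAt.tendsto.comp hscont
  have hpcont : ContinuousAt p (φ w).base := (h.quot.smooth _ hx₀U).continuousAt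
  have hψs : ∀ᶠ b' in 𝓝 (p' w), ψ b' = mapPlane d n p (φ (s b')) := by
    filter_upwards [hs] with b' h1
    rw [← h.induced _ h1.1, h1.2.2]
  have hsrc := mem_chart_source (Euc n) (p (φ w).base)
  have hps : ∀ᶠ b' in 𝓝 (p' w), p (φ (s b')).base ∈ (chartAt (Euc n) (p (φ w).base)).source :=
    (hpcont.tendsto.comp hbcont).eventually (chart_source_mem_nhds hsrc)
  have hxs : ∀ᶠ b' in 𝓝 (p' w), (φ (s b')).base ∈ (chartAt (Euc d) (φ w).base).source :=
    hbcont.eventually (chart_source_mem_nhds (mem_chart_source _ _))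
  have hinj : ∀ w' ∈ U', ∀ v ∈ (φ w').plane, diff d n p (φ w').base v = 0 → v = 0 :=
    fun w' hw' v hv => h.transversal _ ((h.mem_iff w').1 hw') v (h.le_dist w' hv)
  rw [hb₀]
  have hpush := planeCoord_push (Q := φ w) (mem_chart_source (Euc d) (φ w).base) hsrc
    (h.quot.smooth _ hx₀U) (hinj w hw)
  refine ⟨?_, ?_, ?_⟩
  · have h1 : ContMDiffAt (𝓡 n') 𝓘(ℝ, Euc d × (Euc d →L[ℝ] Euc d)) ∞
        ((planeCoord (φ w).base ∘ φ) ∘ s) (p' w) := by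
      refine ContMDiffAt.comp (p' w) ?_ hs.self_of_nhds.2.1
      rw [hs0]
      exact h.prolonged.smooth w
    have h2 : ContMDiffAt 𝓘(ℝ, Euc d × (Euc d →L[ℝ] Euc d)) 𝓘(ℝ, Euc n × (Euc n →L[ℝ] Euc n)) ∞
        (planePush (inCharts d n (φ w).base (p (φ w).base) p))
        (((planeCoord (φ w).base ∘ φ) ∘ s) (p' w)) := by
      simp only [Function.comp_apply, hs0]
      exact hpush.2.contMDiffAt
    refine (ContMDiffAt.comp (p' w) h2 h1).congr_of_eventuallyEq ?_
    filter_upwards [hψs, hps, hxs, hs] with b' h3 h4 h5 h6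
    simp only [Function.comp_apply]
    rw [h3]
    exact (planeCoord_push (Q := φ (s b')) h5 h4
      (h.quot.smooth _ ((h.mem_iff _).1 h6.1)) (hinj _ h6.1)).1
  · filter_upwards [hψs, hps] with b' h3 h4
    rw [h3]
    exact h4
  · have h1 : ContMDiffAt (𝓡 n') (𝓡 n) ∞ (p ∘ (fun w => (φ w).base) ∘ s) (p' w) := by
      refine ContMDiffAt.comp (I' := 𝓡 d) (p' w) ?_ (ContMDiffAt.comp (I' := 𝓡 e) (p' w) ?_ hs.self_of_nhds.2.1)
      · simp only [Function.comp_apply, hs0]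
        exact h.quot.smooth _ hx₀U
      · rw [hs0]
        exact h.prolonged.contMDiff_base w
    refine h1.congr_of_eventuallyEq ?_
    filter_upwards [hψs] with b' h3
    rw [h3]
    rfl

theorem IsReduction.continuous (h : IsReduction G k χ φ U p U' p' ψ n' e) : Continuous ψ := by
  rw [continuous_iff_continuousAt]
  intro b'
  obtain ⟨w, hw, rfl⟩ := h.quot'.onto b'
  rw [ContinuousAt, tendsto_plane_iff (mem_chart_source (Euc n) _)]
  exact ⟨(h.smooth hw).1.continuousAt, (h.smooth hw).2.1⟩

theorem IsReduction.mapPlane_smul (h : IsReduction G k χ φ U p U' p' ψ n' e) {w : N} (hw : w ∈ U')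
    (g : G) : mapPlane d n p (φ (g • w)) = mapPlane d n p (φ w) := by
  rw [← h.induced _ hw, ← h.induced _ (h.quot'.smul_mem g w hw), h.quot'.smul_eq g hw]

/-- The plane `ψ b'` near `ψ (p' w)` is lifted along a section to a plane of `φ` near `φ w`. As `φ`
is an embedding, the point of `N` that belongs to the lifted plane is near `w`, so `b'` is
near `p' w`. -/
theorem IsReduction.isInducing (h : IsReduction G k χ φ U p U' p' ψ n' e) :
    Topology.IsInducing ψ := by
  rw [Topology.isInducing_iff_nhds]
  intro b'
  apply le_antisymm (h.continuous.tendsto b').le_comap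
  obtain ⟨w, hw, rfl⟩ := h.quot'.onto b'
  have hx₀U := (h.mem_iff w).1 hw
  obtain ⟨s, Λ, hs0, hs⟩ := h.quot.exists_plane_lift h.system h.transversal hx₀U
  set l := Filter.comap ψ (𝓝 (ψ (p' w)))
  have hb₀ : (ψ (p' w)) = mapPlane d n p (φ w) := h.induced w hw
  have hbl : Filter.Tendsto (fun b' => (ψ b').base) l (𝓝 (p (φ w).base)) := by
    have h1 := (continuous_plane_base (M := B) (d := n)).tendsto (ψ (p' w))
    rw [show (ψ (p' w)).base = p (φ w).base by rw [hb₀]; rfl] at h1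
    exact h1.comp Filter.tendsto_comap
  have hcl : Filter.Tendsto (fun b' => planeCoord (p (φ w).base) (ψ b')) l
      (𝓝 (planeCoord (p (φ w).base) (ψ (p' w)))) := by
    refine (continuousAt_planeCoord ?_).tendsto.comp Filter.tendsto_comap
    rw [hb₀]
    exact mem_chart_source _ _
  -- the values of the lift at the planes of `ψ` are planes of `φ`
  have hlift : ∀ b', (ψ b').base ∈ {b | s b ∈ U ∧ p (s b) = b} → ∃ w' ∈ U', p' w' = b' ∧
      (φ w').base = s (ψ b').base := by
    rintro b' ⟨h1, h2⟩
    obtain ⟨w', hw', rfl⟩ := h.quot'.onto b'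
    have h3 : p (φ w').base = p (s (ψ (p' w')).base) := by
      rw [h2, h.induced w' hw']; rfl
    obtain ⟨g, hg⟩ := (h.quot.eq_iff _ ((h.mem_iff _).1 hw') _ h1).1 h3
    exact ⟨g • w', h.quot'.smul_mem g _ hw', h.quot'.smul_eq g hw', by rw [h.base_smul, hg]⟩
  have hΛ0 := hs.self_of_nhds.2.2.2.2.2
  rw [hs0] at hΛ0
  obtain ⟨hΛ1, hΛ2⟩ := hΛ0 _ (h.le_dist w)
  have hΛl : Filter.Tendsto (fun b' => Λ (planeCoord (p (φ w).base) (ψ b'))) l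
      (𝓝 (planeCoord (φ w).base (φ w))) := by
    rw [← hΛ1]
    refine hΛ2.continuousAt.tendsto.comp ?_
    rw [hb₀] at hcl
    exact hcl
  intro S hS
  have h1 : p' ⁻¹' S ∈ 𝓝 w := (h.quot'.smooth w hw).continuousAt.preimage_mem_nhds hS
  rw [h.prolonged.isEmbedding.isInducing.nhds_eq_comap] at h1
  obtain ⟨T, hT, hTS⟩ := h1
  rw [nhds_plane (mem_chart_source (Euc d) (φ w).base)] at hT
  obtain ⟨V, hVo, hV, hVT⟩ := mem_planeNhds.1 hT
  filter_upwards [hΛl.eventually (hVo.mem_nhds hV), hbl.eventually hs] with b' h2 h3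
  obtain ⟨w', hw', rfl, hw'b⟩ := hlift b' ⟨h3.1, h3.2.2.1⟩
  have h4 := h3.2.2.2.2.2 (φ w').plane (by rw [← hw'b]; exact h.le_dist w')
  have h5 : (⟨s (ψ (p' w')).base, (φ w').plane⟩ : Plane M d) = φ w' := Plane.ext hw'b.symm rfl
  rw [h5, ← h.induced w' hw'] at h4
  have h6 : w' ∈ p' ⁻¹' S := by
    refine hTS (hVT (φ w') ?_ ?_)
    · rw [hw'b]; exact h3.2.2.2.2.1
    · rw [← h4.1]; exact h2
  exact h6

/-- A plane that is transversal to the fibres keeps its dimension. -/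
theorem finrank_mapPlane {Q : Plane M d} (hQ : ∀ v ∈ Q.plane, diff d n p Q.base v = 0 → v = 0) :
    Module.finrank ℝ (mapPlane d n p Q).plane = Module.finrank ℝ Q.plane := by
  have h1 : Function.Injective ((diff d n p Q.base).toLinearMap.domRestrict Q.plane) := by
    rw [injective_iff_map_eq_zero]
    exact fun v hv => Subtype.ext (hQ v v.2 hv)
  rw [← LinearMap.finrank_range_of_inj h1, LinearMap.range_domRestrict]
  rfl

/-- Near a point of the quotient there is a smooth map to `N` that splits `p'` and whose projection
to `M` lies on the section `s` of `p`. -/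
theorem IsReduction.exists_normalized_section (h : IsReduction G k χ φ U p U' p' ψ n' e)
    (hdim : n + dG = d) (hfree : ∀ (g : G), ∀ z ∈ U, g • z = z → g = 1) {w : N} (hw : w ∈ U')
    {s : B → M} (hs0 : s (p (φ w).base) = (φ w).base)
    (hs : ∀ᶠ b in 𝓝 (p (φ w).base), s b ∈ U ∧ ContMDiffAt (𝓡 n) (𝓡 d) ∞ s b ∧ p (s b) = b) :
    ∃ μ : B' → N, μ (p' w) = w ∧ ContMDiffAt (𝓡 n') (𝓡 e) ∞ μ (p' w) ∧
      ∀ᶠ b' in 𝓝 (p' w), μ b' ∈ U' ∧ p' (μ b') = b' ∧ (φ (μ b')).base = s (ψ b').base := by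
  have hx₀U := (h.mem_iff w).1 hw
  obtain ⟨γ, hγ, hγs⟩ := exists_group_component h.quot hdim hfree hs
  obtain ⟨s', hs0', hs'⟩ := h.quot'.exists_section hw
  rw [hs0] at hγ hγs
  have hcont : Filter.Tendsto s' (𝓝 (p' w)) (𝓝 w) := by
    have := hs'.self_of_nhds.2.1.continuousAt
    rwa [ContinuousAt, hs0'] at this
  have hbcont : Filter.Tendsto (fun b' => (φ (s' b')).base) (𝓝 (p' w)) (𝓝 (φ w).base) :=
    h.prolonged.continuous_base.continuousAt.tendsto.comp hcont
  have hγ1 : γ (φ w).base = 1 := by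
    have := hγs.self_of_nhds
    rw [hs0] at this
    exact hfree _ _ hx₀U this
  refine ⟨fun b' => (γ (φ (s' b')).base)⁻¹ • s' b', ?_, ?_, ?_⟩
  · change (γ (φ (s' (p' w))).base)⁻¹ • s' (p' w) = w
    rw [hs0', hγ1, inv_one, one_smul]
  · refine contMDiffAt_smul_of (dG := dG) ?_ hs'.self_of_nhds.2.1
    have h1 : ContMDiffAt (𝓡 n') (𝓡 d) ∞ (fun b' => (φ (s' b')).base) (p' w) := by
      refine ContMDiffAt.comp (I' := 𝓡 e) (g := fun w => (φ w).base) (p' w) ?_ hs'.self_of_nhds.2.1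
      exact h.prolonged.contMDiff_base _
    have h2 : ContMDiffAt (𝓡 n') (𝓡 dG) ∞ (fun b' => γ (φ (s' b')).base) (p' w) := by
      refine ContMDiffAt.comp (I' := 𝓡 d) (g := γ) (p' w) ?_ h1
      rw [hs0']
      exact hγ
    exact h2.inv
  · filter_upwards [hs', hbcont.eventually hγs] with b' h1 h2
    refine ⟨h.quot'.smul_mem _ _ h1.1, by rw [h.quot'.smul_eq _ h1.1, h1.2.2], ?_⟩
    have h3 : ψ b' = mapPlane d n p (φ (s' b')) := by rw [← h.induced _ h1.1, h1.2.2]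
    have h4 : (ψ b').base = p (φ (s' b')).base := by rw [h3]; rfl
    rw [h.base_smul, inv_smul_eq_iff, h4, h2]

/-- Along a section `μ` of `p'` that is normalized over `s`, the lift `Λ` of planes satisfies
`φ ∘ μ = Λ ∘ ψ` in coordinates, and the left side is an immersion. -/
theorem IsReduction.immersion (h : IsReduction G k χ φ U p U' p' ψ n' e)
    (hdim : n + dG = d) (hfree : ∀ (g : G), ∀ z ∈ U, g • z = z → g = 1) (b' : B') :
    Function.Injective (mfderiv (𝓡 n') 𝓘(ℝ, Euc n × (Euc n →L[ℝ] Euc n))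
      (planeCoord (ψ b').base ∘ ψ) b') := by
  obtain ⟨w, hw, rfl⟩ := h.quot'.onto b'
  have hx₀U := (h.mem_iff w).1 hw
  have hb₀ : ψ (p' w) = mapPlane d n p (φ w) := h.induced w hw
  have hb₀' : (ψ (p' w)).base = p (φ w).base := by rw [hb₀]; rfl
  obtain ⟨s, Λ, hs0, hs⟩ := h.quot.exists_plane_lift h.system h.transversal hx₀U
  obtain ⟨μ, hμ0, hμ, hμ'⟩ := h.exists_normalized_section hdim hfree hw hs0
    (hs.mono fun b hb => ⟨hb.1, hb.2.1, hb.2.2.1⟩)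
  obtain ⟨hsm, -, hsb⟩ := h.smooth hw
  have hΛ0 := hs.self_of_nhds.2.2.2.2.2
  rw [hs0] at hΛ0
  have hΛ2 := (hΛ0 _ (h.le_dist w)).2
  rw [hb₀'] at hsm ⊢
  have hbl : Filter.Tendsto (fun b' => (ψ b').base) (𝓝 (p' w)) (𝓝 (p (φ w).base)) := by
    rw [← hb₀']
    exact hsb.continuousAt
  have heq : (planeCoord (φ w).base ∘ φ) ∘ μ =ᶠ[𝓝 (p' w)] Λ ∘ (planeCoord (p (φ w).base) ∘ ψ) := by
    filter_upwards [hμ', hbl.eventually hs] with b' h1 h2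
    have h3 := h2.2.2.2.2.2 (φ (μ b')).plane (by rw [← h1.2.2]; exact h.le_dist _)
    have h5 : (⟨s (ψ b').base, (φ (μ b')).plane⟩ : Plane M d) = φ (μ b') :=
      Plane.ext h1.2.2.symm rfl
    rw [h5, ← h.induced _ h1.1, h1.2.1] at h3
    exact h3.1.symm
  have hΛd : MDifferentiableAt 𝓘(ℝ, Euc n × (Euc n →L[ℝ] Euc n))
      𝓘(ℝ, Euc d × (Euc d →L[ℝ] Euc d)) Λ ((planeCoord (p (φ w).base) ∘ ψ) (p' w)) := by
    simp only [Function.comp_apply, hb₀]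
    exact (hΛ2.contMDiffAt).mdifferentiableAt (by simp)
  have hφd : MDifferentiableAt (𝓡 e) 𝓘(ℝ, Euc d × (Euc d →L[ℝ] Euc d))
      (planeCoord (φ w).base ∘ φ) (μ (p' w)) := by
    rw [hμ0]
    exact (h.prolonged.smooth w).mdifferentiableAt (by simp)
  have h1 := mfderiv_comp (p' w) hΛd (hsm.mdifferentiableAt (by simp))
  have h2 := mfderiv_comp (p' w) hφd (contMDiffAt_diffble hμ)
  rw [heq.mfderiv_eq, h1, hμ0] at h2
  have h3 := diff_comp (f := μ) (g := p') (by rw [hμ0]; exact contMDiffAt_diffble (h.quot'.smooth w hw))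
    (contMDiffAt_diffble hμ)
  have h4 : diff n' n' (p' ∘ μ) (p' w) = ContinuousLinearMap.id ℝ (Euc n') := by
    rw [← diff_id (M := B') (d := n') (p' w)]
    exact diff_congr (hμ'.mono fun b' hb => hb.2.1)
  rw [h4] at h3
  rw [injective_iff_map_eq_zero]
  intro v hv
  have h5 := DFunLike.congr_fun h2 v
  have h6 : mfderiv (𝓡 e) 𝓘(ℝ, Euc d × (Euc d →L[ℝ] Euc d)) (planeCoord (φ w).base ∘ φ) w
      (diff n' e μ (p' w) v) = 0 := by
    refine h5.symm.trans ?_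
    exact (congrArg (mfderiv 𝓘(ℝ, Euc n × (Euc n →L[ℝ] Euc n)) 𝓘(ℝ, Euc d × (Euc d →L[ℝ] Euc d)) Λ
      ((planeCoord (p (φ w).base) ∘ ψ) (p' w))) hv).trans (map_zero _)
  have h7 : diff n' e μ (p' w) v = 0 := (h.prolonged.immersion w) (h6.trans (map_zero _).symm)
  have h8 := DFunLike.congr_fun h3 v
  exact h8.trans ((congrArg (diff e n' p' (μ (p' w))) h7).trans (map_zero _))

/-- The quotient of a prolonged PDE system is a PDE system. -/
theorem IsReduction.isPDESystem (h : IsReduction G k χ φ U p U' p' ψ n' e)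
    (hdim : n + dG = d) (hfree : ∀ (g : G), ∀ z ∈ U, g • z = z → g = 1) : IsPDESystem n' k ψ where
  finrank_eq b' := by
    obtain ⟨w, hw, rfl⟩ := h.quot'.onto b'
    rw [h.induced w hw, ← h.prolonged.finrank_eq w]
    exact finrank_mapPlane fun v hv => h.transversal _ ((h.mem_iff w).1 hw) v (h.le_dist w hv)
  isEmbedding := ⟨h.isInducing, h.injective⟩
  smooth b' := by
    obtain ⟨w, hw, rfl⟩ := h.quot'.onto b'
    exact (h.smooth hw).1
  immersion := h.immersion hdim hfree
  surjective b := by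
    obtain ⟨x, hx, rfl⟩ := h.quot.onto b
    obtain ⟨w, rfl⟩ := h.prolonged.surjective x
    have hw := (h.mem_iff w).2 hx
    exact ⟨p' w, by simp only [h.induced w hw]; rfl⟩
  submersion b' := by
    obtain ⟨w, hw, rfl⟩ := h.quot'.onto b'
    have h1 := diff_comp (f := p') (g := fun b' => (ψ b').base)
      (contMDiffAt_diffble (h.smooth hw).2.2) (contMDiffAt_diffble (h.quot'.smooth w hw))
    have h2 := diff_comp (f := fun w => (φ w).base) (g := p)
      (contMDiffAt_diffble (h.quot.smooth _ ((h.mem_iff w).1 hw)))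
      (contMDiffAt_diffble (h.prolonged.contMDiff_base w))
    have h3 : (fun b' => (ψ b').base) ∘ p' =ᶠ[𝓝 w] p ∘ fun w => (φ w).base := by
      filter_upwards [h.quot'.eventually_mem hw] with w' hw'
      simp only [Function.comp_apply, h.induced w' hw']
      rfl
    rw [diff_congr h3, h2] at h1
    intro v
    obtain ⟨x, hx⟩ := h.quot.submersion _ ((h.mem_iff w).1 hw) v
    obtain ⟨y, hy⟩ := h.prolonged.submersion w x
    refine ⟨diff e n' p' w y, ?_⟩
    have h4 := DFunLike.congr_fun h1 y
    simp only [ContinuousLinearMap.comp_apply] at h4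
    rw [← h4, hy, hx]

/-! ### The reduced ideal -/

/-- The largest ideal on the quotient of `U` by `p` whose pullback lies in `J`. -/
def quotIdeal (d n : ℕ) [ChartedSpace (Euc d) M] [ChartedSpace (Euc n) B] (U : Set M) (p : M → B)
    (J : M → GradedIdeal d) (b : B) : GradedIdeal n where
  deg m :=
    { carrier := {η | ∀ z ∈ U, p z = b →
        η.compContinuousLinearMap (diff d n p z) ∈ (J z).deg m}
      add_mem' := fun {a b} ha hb z hz hzb => (J z).deg m |>.add_mem (ha z hz hzb) (hb z hz hzb)
      zero_mem' := fun z _ _ => ((J z).deg m).zero_mem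
      smul_mem' := fun c a ha z hz hzb => ((J z).deg m).smul_mem c (ha z hz hzb) }
  wedge_mem m α η h z hz hzb := by
    rw [wedge_comp]
    exact (J z).wedge_mem m _ _ (h z hz hzb)

/-- Equivariant maps intertwine the infinitesimal actions. -/
theorem diff_infAction_of_equivariant {f : N → M} (hf : ∀ (g : G) (w : N), f (g • w) = g • f w)
    {w : N} (hs : ContMDiffAt (𝓡 e) (𝓡 d) ∞ f w) (ξ : Euc dG) :
    diff e d f w (infAction dG e G w ξ) = infAction dG d G (f w) ξ := by
  have h1 := diff_comp (f := fun g : G => g • w) (g := f) (x := (1 : G)) (d := dG) (e := e) (e' := d)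
    (by simpa using contMDiffAt_diffble hs)
    (contMDiffAt_diffble (contMDiff_orb (dG := dG) w).contMDiffAt)
  have h2 : f ∘ (fun g : G => g • w) = fun g : G => g • f w := funext fun g => hf g w
  rw [h2, one_smul] at h1
  exact (DFunLike.congr_fun h1 ξ).symm

/-- The two projections from `N` to the quotient `B` of `M` have the same differential. -/
theorem IsReduction.diff_base (h : IsReduction G k χ φ U p U' p' ψ n' e) {w : N} (hw : w ∈ U')
    (v : Euc e) : diff n' n (fun b' => (ψ b').base) (p' w) (diff e n' p' w v) =
      diff d n p (φ w).base (diff e d (fun w => (φ w).base) w v) := by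
  have h1 := diff_comp (f := p') (g := fun b' => (ψ b').base)
    (contMDiffAt_diffble (h.smooth hw).2.2) (contMDiffAt_diffble (h.quot'.smooth w hw))
  have h2 := diff_comp (f := fun w => (φ w).base) (g := p)
    (contMDiffAt_diffble (h.quot.smooth _ ((h.mem_iff w).1 hw)))
    (contMDiffAt_diffble (h.prolonged.contMDiff_base w))
  have h3 : (fun b' => (ψ b').base) ∘ p' =ᶠ[𝓝 w] p ∘ fun w => (φ w).base := by
    filter_upwards [h.quot'.eventually_mem hw] with w' hw'
    simp only [Function.comp_apply, h.induced w' hw']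
    rfl
  rw [diff_congr h3, h2] at h1
  exact (DFunLike.congr_fun h1 v).symm

theorem IsReduction.diff_mem_contactDist (h : IsReduction G k χ φ U p U' p' ψ n' e) {w : N}
    (hw : w ∈ U') {v : Euc e} (hv : v ∈ contactDist e φ w) :
    diff e n' p' w v ∈ contactDist n' ψ (p' w) := by
  rw [mem_contactDist, h.diff_base hw, h.induced w hw]
  exact ⟨_, hv, rfl⟩

/-- The differential of `p'` maps the contact distribution onto the contact distribution. -/
theorem IsReduction.exists_mem_contactDist (h : IsReduction G k χ φ U p U' p' ψ n' e)
    (hdim : n + dG = d) (hfree : ∀ (g : G), ∀ z ∈ U, g • z = z → g = 1) {w : N} (hw : w ∈ U')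
    {u : Euc n'} (hu : u ∈ contactDist n' ψ (p' w)) :
    ∃ v ∈ contactDist e φ w, diff e n' p' w v = u := by
  have hx := (h.mem_iff w).1 hw
  obtain ⟨v, rfl⟩ := h.quot'.submersion w hw u
  rw [mem_contactDist, h.diff_base hw, h.induced w hw] at hu
  obtain ⟨q, hq, hqv⟩ := hu
  obtain ⟨ξ, hξ⟩ := h.quot.exists_infAction hdim hx (fun g => hfree g _ hx)
    (v := diff e d (fun w => (φ w).base) w v - q) (by
      rw [map_sub, sub_eq_zero]
      exact hqv.symm)
  have h1 := diff_infAction_of_equivariant (f := fun w => (φ w).base) (h.base_smul)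
    (h.prolonged.contMDiff_base w) ξ
  refine ⟨v - infAction dG e G w ξ, ?_, ?_⟩
  · rw [mem_contactDist, map_sub, h1, hξ, sub_sub_cancel]
    exact hq
  · rw [map_sub, h.quot'.diff_infAction hw, sub_zero]

/-- The contact forms of the quotient are pulled back to contact forms. -/
theorem IsReduction.pullForm_contact (h : IsReduction G k χ φ U p U' p' ψ n' e) {w : N}
    (hw : w ∈ U') {θ : B' → AltForm n' 1} (hθ : IsContactAt n' ψ θ (p' w)) :
    IsContactAt e φ (pullForm n' e p' θ) w := by
  filter_upwards [(h.quot'.smooth w hw).continuousAt.eventually hθ, h.quot'.eventually_mem hw]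
    with w' h1 hw'
  refine ⟨h1.1.pullForm (h.quot'.eventually_smooth hw'), fun v hv => ?_⟩
  rw [← covec_apply, pullForm, covec_comp, ContinuousLinearMap.comp_apply, covec_apply]
  exact h1.2 _ (h.diff_mem_contactDist hw' hv)

/-- The contact forms of `χ` are pulled back to contact forms of its prolongation `φ`. -/
theorem IsReduction.pullForm_base_contact (h : IsReduction G k χ φ U p U' p' ψ n' e) {w : N}
    {α : M → AltForm d 1} (hα : IsContactAt d χ α (φ w).base) :
    IsContactAt e φ (pullForm d e (fun w => (φ w).base) α) w := by
  filter_upwards [h.prolonged.continuous_base.continuousAt.eventually hα] with w' h1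
  refine ⟨h1.1.pullForm (.of_forall fun w'' => h.prolonged.contMDiff_base w''), fun v hv => ?_⟩
  rw [← covec_apply, pullForm, covec_comp, ContinuousLinearMap.comp_apply, covec_apply]
  exact h1.2 _ (h.le_dist w' hv)

theorem IsContactAt.sub {θ θ' : N → AltForm e 1} {w : N} (hθ : IsContactAt e φ θ w)
    (hθ' : IsContactAt e φ θ' w) : IsContactAt e φ (fun y => θ y - θ' y) w := by
  filter_upwards [hθ, hθ'] with w' h1 h2
  refine ⟨h1.1.sub h2.1, fun v hv => ?_⟩
  rw [ContinuousAlternatingMap.sub_apply, h1.2 v hv, h2.2 v hv, sub_zero]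

/-- On the contact distribution, the exterior derivative of a contact form agrees with the pullback
of the exterior derivative of a contact form of the quotient. -/
theorem IsReduction.exists_contact_extd (h : IsReduction G k χ φ U p U' p' ψ n' e)
    (hψ : IsPDESystem n' k ψ) {w : N} (hw : w ∈ U') {θ : N → AltForm e 1}
    (hθ : IsContactAt e φ θ w) :
    ∃ θ₂, IsContactAt n' ψ θ₂ (p' w) ∧ ∀ v₁ ∈ contactDist e φ w, ∀ v₂ ∈ contactDist e φ w,
      extd θ w ![v₁, v₂] = extd θ₂ (p' w) ![diff e n' p' w v₁, diff e n' p' w v₂] := by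
  have hx := (h.mem_iff w).1 hw
  set D := contactDist d χ (φ w).base
  -- the value of `θ` is the pullback of a covector `ξ` on `M`
  obtain ⟨r, hr, -⟩ := exists_rightInverse_compatible (h.prolonged.submersion w)
    (K := ⊤) (K' := ⊥)
    (fun u hu => ⟨0, trivial, by rw [(Submodule.mem_bot ℝ).1 hu, map_zero]⟩)
  let ξ : Euc d →L[ℝ] ℝ := (covec (θ w)).comp r
  have hξ : ∀ v, ξ (diff e d (fun w => (φ w).base) w v) = covec (θ w) v := by
    intro v
    have h1 : r (diff e d (fun w => (φ w).base) w v) - v ∈ contactDist e φ w := by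
      rw [mem_contactDist, map_sub, hr, sub_self]
      exact Submodule.zero_mem _
    have h2 := hθ.apply_eq_zero h1
    rw [map_sub, sub_eq_zero] at h2
    exact h2
  have hξ0 : ∀ q ∈ (φ w).plane, ξ q = 0 := by
    intro q hq
    obtain ⟨v, rfl⟩ := h.prolonged.submersion w q
    rw [hξ]
    exact hθ.apply_eq_zero hq
  -- on the distribution of `χ`, `ξ` is the pullback of a covector on the quotient
  obtain ⟨τ, hτ⟩ := ((diff d n p (φ w).base).toLinearMap.domRestrict
    D).exists_leftInverse_of_injective (by
      rw [LinearMap.ker_eq_bot']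
      exact fun v hv => Subtype.ext (h.transversal _ hx v v.2 hv))
  have hτ' : ∀ v ∈ D, (τ (diff d n p (φ w).base v) : Euc d) = v := fun v hv =>
    congrArg Subtype.val (LinearMap.congr_fun hτ ⟨v, hv⟩)
  let ξ' : Euc n →L[ℝ] ℝ := ξ.comp (LinearMap.toContinuousLinearMap (D.subtype.comp τ))
  have hξ' : ∀ v ∈ D, ξ' (diff d n p (φ w).base v) = ξ v := by
    intro v hv
    change ξ (τ (diff d n p (φ w).base v) : Euc d) = ξ v
    rw [hτ' v hv]
  obtain ⟨θ₂, hθ₂, hθ₂v⟩ := hψ.exists_contact (z := p' w)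
    (ξ := ξ'.comp (diff n' n (fun b' => (ψ b').base) (p' w))) (by
      intro u hu
      rw [mem_contactDist, h.induced w hw] at hu
      obtain ⟨q, hq, hqu⟩ := hu
      rw [ContinuousLinearMap.comp_apply, ← hqu, ContinuousLinearMap.coe_coe,
        hξ' q (h.le_dist w hq), hξ0 q hq])
  obtain ⟨α, hα, hαv⟩ := h.system.exists_contact (z := (φ w).base)
    (ξ := ξ - ξ'.comp (diff d n p (φ w).base)) (by
      intro v hv
      change ξ v - ξ' (diff d n p (φ w).base v) = 0
      rw [hξ' v hv, sub_self])
  have hc1 := h.pullForm_contact hw hθ₂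
  have hc2 := h.pullForm_base_contact hα
  have hc := (hθ.sub hc1).sub hc2
  refine ⟨θ₂, hθ₂, fun v₁ hv₁ v₂ hv₂ => ?_⟩
  -- the contact form `θ - p'^* θ₂ - π^* α`, with `π` the projection of `N` to `M`, vanishes at
  -- `w`, so its exterior derivative vanishes on the contact distribution
  have h0 := h.prolonged.extd_eq_zero hc (by
    rw [pullForm, pullForm, hθ₂v, hαv, oneForm_comp, oneForm_comp, ← oneForm_covec (θ w), ← map_sub,
      ← map_sub]
    refine (congrArg oneForm ?_).trans oneForm.map_zero
    ext v
    change covec (θ w) v - ξ' (diff n' n (fun b' => (ψ b').base) (p' w) (diff e n' p' w v)) -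
      (ξ (diff e d (fun w => (φ w).base) w v) -
        ξ' (diff d n p (φ w).base (diff e d (fun w => (φ w).base) w v))) = 0
    rw [h.diff_base hw, hξ]
    ring) hv₁ hv₂
  have hs1 := hθ.self_of_nhds.1
  have hs2 := hc1.self_of_nhds.1
  rw [extd_sub (hs1.sub hs2) hc2.self_of_nhds.1, extd_sub hs1 hs2,
    extd_pullForm (h.quot'.eventually_smooth hw) hθ₂.self_of_nhds.1,
    extd_pullForm (.of_forall fun w'' => h.prolonged.contMDiff_base w'') hα.self_of_nhds.1] at h0
  -- `dα` vanishes on the plane `φ w`, because this plane is an integral element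
  have h1 := DFunLike.congr_fun ((h.integral w).2 2 _ hα.extd_mem_two)
    ![⟨_, mem_contactDist.1 hv₁⟩, ⟨_, mem_contactDist.1 hv₂⟩]
  have h2 : extd α (φ w).base ![diff e d (fun w => (φ w).base) w v₁,
      diff e d (fun w => (φ w).base) w v₂] = 0 := by
    refine Eq.trans ?_ h1
    rw [ContinuousAlternatingMap.compContinuousLinearMap_apply]
    congr 1
    funext i
    fin_cases i <;> rfl
  rw [ContinuousAlternatingMap.sub_apply, ContinuousAlternatingMap.sub_apply,
    ContinuousAlternatingMap.compContinuousLinearMap_apply,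
    ContinuousAlternatingMap.compContinuousLinearMap_apply] at h0
  have h3 : (⇑(diff e d (fun w => (φ w).base) w) ∘ ![v₁, v₂]) =
      ![diff e d (fun w => (φ w).base) w v₁, diff e d (fun w => (φ w).base) w v₂] := by
    funext i
    fin_cases i <;> rfl
  have h4 : (⇑(diff e n' p' w) ∘ ![v₁, v₂]) = ![diff e n' p' w v₁, diff e n' p' w v₂] := by
    funext i
    fin_cases i <;> rfl
  rw [h3, h2, h4, sub_zero, sub_eq_zero] at h0
  exact h0

/-- A right inverse of the differential of `p'` that pulls the contact ideal back to the contact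
ideal of the quotient. -/
theorem IsReduction.exists_splitting (h : IsReduction G k χ φ U p U' p' ψ n' e)
    (hψ : IsPDESystem n' k ψ)
    (hdim : n + dG = d) (hfree : ∀ (g : G), ∀ z ∈ U, g • z = z → g = 1) {w : N} (hw : w ∈ U') :
    ∃ σ : Euc n' →L[ℝ] Euc e, (∀ u, diff e n' p' w (σ u) = u) ∧
      ∀ m, ∀ η ∈ (contactIdeal e φ w).deg m,
        η.compContinuousLinearMap σ ∈ (contactIdeal n' ψ (p' w)).deg m := by
  obtain ⟨σ, hσ, hσD⟩ := exists_rightInverse_compatible (h.quot'.submersion w hw)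
    (K := contactDist e φ w) (K' := contactDist n' ψ (p' w))
    (fun u hu => h.exists_mem_contactDist hdim hfree hw hu)
  refine ⟨σ, hσ, fun m η hη => ?_⟩
  refine contactIdeal_le (J := (contactIdeal n' ψ (p' w)).pull σ) (fun θ hθ => ⟨?_, ?_⟩) m hη
  · rw [GradedIdeal.mem_pull, ← oneForm_covec (θ w), oneForm_comp]
    exact hψ.oneForm_mem fun u hu => hθ.apply_eq_zero (hσD u hu)
  · obtain ⟨θ₂, hθ₂, heq⟩ := h.exists_contact_extd hψ hw hθ
    rw [GradedIdeal.mem_pull, ← sub_add_cancel ((extd θ w).compContinuousLinearMap σ)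
      (extd θ₂ (p' w))]
    refine Submodule.add_mem _ ?_ hθ₂.extd_mem_two
    refine GradedIdeal.mem_two_of_annihilator (K := contactDist n' ψ (p' w))
      (fun ξ hξ => hψ.oneForm_mem hξ) fun u hu v hv => ?_
    rw [ContinuousAlternatingMap.sub_apply, ContinuousAlternatingMap.compContinuousLinearMap_apply]
    have h4 : (⇑σ ∘ ![u, v]) = ![σ u, σ v] := by
      funext i
      fin_cases i <;> rfl
    rw [h4, heq _ (hσD u hu) _ (hσD v hv), hσ, hσ, sub_self]

/-- The reduced ideal of a prolonged system is the contact ideal. -/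
theorem IsReduction.quotIdeal_eq (h : IsReduction G k χ φ U p U' p' ψ n' e)
    (hψ : IsPDESystem n' k ψ)
    (hdim : n + dG = d) (hfree : ∀ (g : G), ∀ z ∈ U, g • z = z → g = 1) :
    quotIdeal e n' U' p' (contactIdeal e φ) = contactIdeal n' ψ := by
  funext b'
  obtain ⟨w, hw, rfl⟩ := h.quot'.onto b'
  ext m η
  constructor
  · intro hη
    obtain ⟨σ, hσ, hσ'⟩ := h.exists_splitting hψ hdim hfree hw
    have h1 := hσ' m _ (hη w hw rfl)
    convert h1 using 1
    ext v
    rw [ContinuousAlternatingMap.compContinuousLinearMap_apply,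
      ContinuousAlternatingMap.compContinuousLinearMap_apply]
    congr 1
    funext i
    exact (hσ (v i)).symm
  · refine fun hη => contactIdeal_le (J := quotIdeal e n' U' p' (contactIdeal e φ) (p' w))
      (fun θ hθ => ⟨?_, ?_⟩) m hη
    · intro w' hw' heq
      rw [← heq] at hθ ⊢
      exact (h.pullForm_contact hw' hθ).mem_one
    · intro w' hw' heq
      rw [← heq] at hθ ⊢
      rw [← extd_pullForm (h.quot'.eventually_smooth hw') hθ.self_of_nhds.1]
      exact (h.pullForm_contact hw' hθ).extd_mem_two

/-! ### Integral elements of the reduced system -/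

variable {N₂ : Type*} {e₂ : ℕ} [TopologicalSpace N₂] [ChartedSpace (Euc e₂) N₂]
  [IsManifold (𝓡 e₂) ∞ N₂] [MulAction G N₂] [ContMDiffSMul (𝓡 dG) (𝓡 e₂) ∞ G N₂]
variable {B₂ : Type*} {n₂ : ℕ} [TopologicalSpace B₂] [ChartedSpace (Euc n₂) B₂]
  [IsManifold (𝓡 n₂) ∞ B₂]
variable {U₂ : Set N₂}
  {p₂ : N₂ → B₂} {φ₂ : N₂ → Plane N e} {ψ₂ : B₂ → Plane B' n'}

/-- Integral elements are mapped to integral elements of the reduced system. -/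
theorem IsReduction.mapPlane_integral (h : IsReduction G k χ φ U p U' p' ψ n' e)
    (h₂ : IsReduction G k φ φ₂ U' p' U₂ p₂ ψ₂ n₂ e₂) (hψ : IsPDESystem n' k ψ)
    (hdim : n + dG = d) (hfree : ∀ (g : G), ∀ z ∈ U, g • z = z → g = 1)
    {w : N} (hw : w ∈ U') {P : Submodule ℝ (Euc e)}
    (hP : (⟨w, P⟩ : Plane N e) ∈ integralElements k (contactIdeal e φ)) :
    mapPlane e n' p' ⟨w, P⟩ ∈ integralElements k (contactIdeal n' ψ) := by
  have hle : P ≤ contactDist e φ w := h.prolonged.le_contactDist (hP.2 1)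
  refine ⟨?_, fun m η hη => ?_⟩
  · rw [finrank_mapPlane fun v hv => h₂.transversal w hw v (hle hv)]
    exact hP.1
  · have h1 : η ∈ (quotIdeal e n' U' p' (contactIdeal e φ) (p' w)).deg m := by
      rw [h.quotIdeal_eq hψ hdim hfree]
      exact hη
    have h2 := hP.2 m _ (h1 w hw rfl)
    ext v
    have h3 : ∀ i, ∃ x : P, diff e n' p' w x = (v i : Euc n') := by
      intro i
      obtain ⟨x, hx, hxv⟩ := (v i).2
      exact ⟨⟨x, hx⟩, hxv⟩
    choose x hx using h3
    refine Eq.trans ?_ (DFunLike.congr_fun h2 x)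
    simp only [ContinuousAlternatingMap.compContinuousLinearMap_apply]
    congr 1
    funext i
    exact (hx i).symm

/-- Integral elements of the reduced system lift to integral elements. -/
theorem IsReduction.exists_integral_lift (h : IsReduction G k χ φ U p U' p' ψ n' e)
    (hψ : IsPDESystem n' k ψ)
    (hdim : n + dG = d) (hfree : ∀ (g : G), ∀ z ∈ U, g • z = z → g = 1)
    {w : N} (hw : w ∈ U') {Q : Plane B' n'} (hQb : Q.base = p' w)
    (hQ : Q ∈ integralElements k (contactIdeal n' ψ)) :
    ∃ P, (⟨w, P⟩ : Plane N e) ∈ integralElements k (contactIdeal e φ) ∧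
      mapPlane e n' p' ⟨w, P⟩ = Q := by
  obtain ⟨b, K⟩ := Q
  obtain rfl : b = p' w := hQb
  obtain ⟨σ, hσ, hσ'⟩ := h.exists_splitting hψ hdim hfree hw
  refine ⟨K.map σ.toLinearMap, ⟨?_, fun m η hη => ?_⟩, ?_⟩
  · have hinj : Function.Injective σ.toLinearMap := fun u v huv => by
      rw [← hσ u, ← hσ v]
      exact congrArg _ huv
    change Module.finrank ℝ (K.map σ.toLinearMap) = k
    rw [← hQ.1]
    exact (LinearEquiv.finrank_eq (Submodule.equivMapOfInjective _ hinj K)).symm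
  · have h1 := hQ.2 m _ (hσ' m η hη)
    ext v
    have h3 : ∀ i, ∃ x : K, σ x = (v i : Euc e) := by
      intro i
      obtain ⟨x, hx, hxv⟩ := (v i).2
      exact ⟨⟨x, hx⟩, hxv⟩
    choose x hx using h3
    refine Eq.trans ?_ (DFunLike.congr_fun h1 x)
    simp only [ContinuousAlternatingMap.compContinuousLinearMap_apply]
    congr 1
    funext i
    exact (hx i).symm
  · refine Plane.ext rfl ?_
    change (K.map σ.toLinearMap).map (diff e n' p' w).toLinearMap = K
    rw [← Submodule.map_comp]
    have : (diff e n' p' w).toLinearMap.comp σ.toLinearMap = LinearMap.id :=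
      LinearMap.ext fun u => hσ u
    rw [this, Submodule.map_id]

/-- An integral element belongs to the prolongation if and only if its image belongs to the quotient
of the prolongation. -/
theorem IsReduction.mem_range_of_mapPlane (h : IsReduction G k χ φ U p U' p' ψ n' e)
    (h₂ : IsReduction G k φ φ₂ U' p' U₂ p₂ ψ₂ n₂ e₂)
    {w : N} (hw : w ∈ U') {P : Submodule ℝ (Euc e)}
    (hP : (⟨w, P⟩ : Plane N e) ∈ integralElements k (contactIdeal e φ)) :
    mapPlane e n' p' ⟨w, P⟩ ∈ Set.range ψ₂ ↔ (⟨w, P⟩ : Plane N e) ∈ Set.range φ₂ := by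
  constructor
  · rintro ⟨b₂, hb₂⟩
    obtain ⟨w₂, hw₂, rfl⟩ := h₂.quot'.onto b₂
    rw [h₂.induced w₂ hw₂] at hb₂
    obtain ⟨g, hg⟩ := (h.quot'.eq_iff _ ((h₂.mem_iff w₂).1 hw₂) _ hw).1 (congrArg Plane.base hb₂)
    rw [← h₂.mapPlane_smul hw₂ g] at hb₂
    have hb : (φ₂ (g • w₂)).base = w := by rw [h₂.base_smul, hg]
    have hle := h₂.le_dist (g • w₂)
    have hQ : φ₂ (g • w₂) = ⟨w, (φ₂ (g • w₂)).plane⟩ := Plane.ext hb rfl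
    rw [hb] at hle
    refine ⟨g • w₂, hQ.trans (Plane.ext rfl ?_)⟩
    refine h₂.mapPlane_injective hw hle (h.prolonged.le_contactDist (hP.2 1)) ?_
    rw [← hQ]
    exact hb₂
  · rintro ⟨w₂, hw₂⟩
    have h1 : w₂ ∈ U₂ := (h₂.mem_iff w₂).2 (by rw [hw₂]; exact hw)
    exact ⟨p₂ w₂, by rw [h₂.induced w₂ h1, hw₂]⟩

/-- The integral elements of the reduced system that are missing in the quotient of the prolongation
are the images of those that are missing in the prolongation. -/
theorem IsReduction.removed_eq (h : IsReduction G k χ φ U p U' p' ψ n' e)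
    (h₂ : IsReduction G k φ φ₂ U' p' U₂ p₂ ψ₂ n₂ e₂) (hψ : IsPDESystem n' k ψ)
    (hdim : n + dG = d) (hfree : ∀ (g : G), ∀ z ∈ U, g • z = z → g = 1) :
    removed k (contactIdeal n' ψ) ψ₂ = {Q | ∃ w ∈ U', ∃ P : Submodule ℝ (Euc e),
      (⟨w, P⟩ : Plane N e) ∈ removed k (contactIdeal e φ) φ₂ ∧ Q = mapPlane e n' p' ⟨w, P⟩} := by
  ext Q
  constructor
  · rintro ⟨hQ, hQr⟩
    obtain ⟨w, hw, hwQ⟩ := h.quot'.onto Q.base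
    obtain ⟨P, hP, rfl⟩ := h.exists_integral_lift hψ hdim hfree hw hwQ.symm hQ
    exact ⟨w, hw, P, ⟨hP, fun hr => hQr ((h.mem_range_of_mapPlane h₂ hw hP).2 hr)⟩, rfl⟩
  · rintro ⟨w, hw, P, ⟨hP, hPr⟩, rfl⟩
    exact ⟨h.mapPlane_integral h₂ hψ hdim hfree hw hP,
      fun hr => hPr ((h.mem_range_of_mapPlane h₂ hw hP).1 hr)⟩

/-- Near a plane of the quotient of the prolongation, all integral elements of the reduced system
belong to this quotient. -/
theorem IsReduction.eventually_not_removed (h : IsReduction G k χ φ U p U' p' ψ n' e)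
    (h₂ : IsReduction G k φ φ₂ U' p' U₂ p₂ ψ₂ n₂ e₂) (hψ : IsPDESystem n' k ψ)
    (hφ₂ : IsProlongation e₂ k (contactIdeal e φ) φ₂)
    (hdim : n + dG = d) (hfree : ∀ (g : G), ∀ z ∈ U, g • z = z → g = 1) (b₂ : B₂) :
    ∀ᶠ Q in 𝓝 (ψ₂ b₂), Q ∉ removed k (contactIdeal n' ψ) ψ₂ := by
  obtain ⟨w₂, hw₂, rfl⟩ := h₂.quot'.onto b₂
  have hw := (h₂.mem_iff w₂).1 hw₂
  have hb₀ : ψ₂ (p₂ w₂) = mapPlane e n' p' (φ₂ w₂) := h₂.induced w₂ hw₂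
  obtain ⟨s, Λ, hs0, hs⟩ := h₂.quot.exists_plane_lift h₂.system h₂.transversal hw
  have hΛ0 := hs.self_of_nhds.2.2.2.2.2
  rw [hs0] at hΛ0
  obtain ⟨hΛ1, hΛ2⟩ := hΛ0 _ (h₂.le_dist w₂)
  obtain ⟨C, hC, hCeq⟩ := hφ₂.removed_closed
  have hnC : φ₂ w₂ ∈ Cᶜ := by
    intro hmem
    have : φ₂ w₂ ∈ removed k (contactIdeal e φ) φ₂ := by
      rw [hCeq]
      exact ⟨h₂.integral w₂, hmem⟩
    exact this.2 ⟨w₂, rfl⟩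
  have hCn := hC.isOpen_compl.mem_nhds hnC
  rw [nhds_plane (mem_chart_source (Euc e) (φ₂ w₂).base)] at hCn
  obtain ⟨V, hVo, hV, hVC⟩ := mem_planeNhds.1 hCn
  rw [hb₀]
  have hbl : Filter.Tendsto Plane.base (𝓝 (mapPlane e n' p' (φ₂ w₂))) (𝓝 (p' (φ₂ w₂).base)) :=
    (continuous_plane_base (M := B') (d := n')).tendsto (mapPlane e n' p' (φ₂ w₂))
  have hΛl : Filter.Tendsto (fun Q => Λ (planeCoord (p' (φ₂ w₂).base) Q))
      (𝓝 (mapPlane e n' p' (φ₂ w₂))) (𝓝 (planeCoord (φ₂ w₂).base (φ₂ w₂))) := by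
    rw [← hΛ1]
    exact hΛ2.continuousAt.tendsto.comp (continuousAt_planeCoord (mem_chart_source _ _)).tendsto
  -- an integral element near `ψ₂ (p₂ w₂)` is lifted along the section to an integral element near
  -- `φ₂ w₂`, which has not been removed, as it does not belong to the closed set `C`
  filter_upwards [hbl.eventually hs, hΛl.eventually (hVo.mem_nhds hV)] with Q h1 h2 h3
  obtain ⟨P, hP, hPQ⟩ := h.exists_integral_lift hψ hdim hfree h1.1 h1.2.2.1.symm h3.1
  have h4 := (h1.2.2.2.2.2 P (h.prolonged.le_contactDist (hP.2 1))).1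
  rw [hPQ] at h4
  have h5 : (⟨s Q.base, P⟩ : Plane N e) ∈ Cᶜ := hVC _ h1.2.2.2.2.1 (by rw [← h4]; exact h2)
  refine h3.2 ?_
  rw [← hPQ, h.mem_range_of_mapPlane h₂ h1.1 hP]
  by_contra hr
  have h6 : (⟨s Q.base, P⟩ : Plane N e) ∈ removed k (contactIdeal e φ) φ₂ := ⟨hP, hr⟩
  rw [hCeq] at h6
  exact h5 h6.2

/-- The quotient of the prolongation is the prolongation of the reduced system. -/
theorem IsReduction.isProlongation (h : IsReduction G k χ φ U p U' p' ψ n' e)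
    (h₂ : IsReduction G k φ φ₂ U' p' U₂ p₂ ψ₂ n₂ e₂) (hψ : IsPDESystem n' k ψ)
    (hψ₂ : IsPDESystem n₂ k ψ₂) (hφ₂ : IsProlongation e₂ k (contactIdeal e φ) φ₂)
    (hdim : n + dG = d) (hfree : ∀ (g : G), ∀ z ∈ U, g • z = z → g = 1) :
    IsProlongation n₂ k (contactIdeal n' ψ) ψ₂ where
  toIsPDESystem := hψ₂
  integral b₂ := by
    obtain ⟨w₂, hw₂, rfl⟩ := h₂.quot'.onto b₂
    rw [h₂.induced w₂ hw₂]
    exact h.mapPlane_integral h₂ hψ hdim hfree ((h₂.mem_iff w₂).1 hw₂) (h₂.integral w₂)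
  removed_closed := by
    refine ⟨closure (removed k (contactIdeal n' ψ) ψ₂), isClosed_closure, ?_⟩
    ext Q
    refine ⟨fun hQ => ⟨hQ.1, subset_closure hQ⟩, fun hQ => ⟨hQ.1, ?_⟩⟩
    rintro ⟨b₂, rfl⟩
    obtain ⟨Q, h1, h2⟩ := ((mem_closure_iff_frequently.1 hQ.2).and_eventually
      (h.eventually_not_removed h₂ hψ hφ₂ hdim hfree b₂)).exists
    exact h2 h1

end Reduction

/-! ### The regular domains of a tower -/

section TowerBasics

variable {M : ℕ → Type*} {d : ℕ → ℕ} [∀ r, TopologicalSpace (M r)]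
  [∀ r, ChartedSpace (Euc (d r)) (M r)]
  {φ : ∀ r, M (r + 1) → Plane (M r) (d r)}

theorem LiesOver.le {s : ℕ} {S : Set (M s)} {r : ℕ} {z : M r} (h : LiesOver φ S r z) : s ≤ r := by
  induction h with
  | base z _ => exact le_rfl
  | step r z _ ih => exact Nat.le_succ_of_le ih

theorem liesOver_succ_iff {s : ℕ} {S : Set (M s)} {r : ℕ} (hr : s ≤ r) {z : M (r + 1)} :
    LiesOver φ S (r + 1) z ↔ LiesOver φ S r (φ r z).base := by
  refine ⟨fun h => ?_, LiesOver.step r z⟩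
  cases h with
  | base _ _ => omega
  | step _ _ h => exact h

theorem liesOver_self_iff {s : ℕ} {S : Set (M s)} {z : M s} : LiesOver φ S s z ↔ z ∈ S := by
  refine ⟨fun h => ?_, LiesOver.base z⟩
  cases h with
  | base _ h => exact h
  | step r _ h => exact absurd h.le (by omega)

variable {G : Type*} [Group G] [∀ r, MulAction G (M r)]

theorem IsProlongedAction.base_smul (hact : IsProlongedAction G φ) (r : ℕ) (g : G) (z : M (r + 1)) :
    (φ r (g • z)).base = g • (φ r z).base := by rw [hact]

theorem LiesOver.smul (hact : IsProlongedAction G φ) {s : ℕ} {S : Set (M s)}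
    (hS : ∀ (g : G), ∀ z ∈ S, g • z ∈ S) (g : G) {r : ℕ} {z : M r} (h : LiesOver φ S r z) :
    LiesOver φ S r (g • z) := by
  induction h with
  | base z hz => exact .base _ (hS g z hz)
  | step r z _ ih =>
    refine .step _ _ ?_
    rwa [hact.base_smul]

/-- Freeness of the action passes to the points above. -/
theorem LiesOver.free (hact : IsProlongedAction G φ) {s : ℕ} {S : Set (M s)}
    (hS : ∀ (g : G), ∀ z ∈ S, g • z = z → g = 1) (g : G) {r : ℕ} {z : M r} (h : LiesOver φ S r z) :
    g • z = z → g = 1 := by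
  induction h with
  | base z hz => exact hS g z hz
  | step r z _ ih =>
    intro hg
    apply ih
    rw [← hact.base_smul, hg]

end TowerBasics

section Tower

variable {G : Type*} {dG : ℕ} [Group G] [TopologicalSpace G] [ChartedSpace (Euc dG) G]
  [LieGroup (𝓡 dG) ∞ G]
variable {M : ℕ → Type*} {d : ℕ → ℕ} [∀ r, TopologicalSpace (M r)]
  [∀ r, ChartedSpace (Euc (d r)) (M r)] [∀ r, IsManifold (𝓡 (d r)) ∞ (M r)]
  [∀ r, MulAction G (M r)] [∀ r, ContMDiffSMul (𝓡 dG) (𝓡 (d r)) ∞ G (M r)]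
  {φ : ∀ r, M (r + 1) → Plane (M r) (d r)} {k : ℕ}

section
variable {X : Type*} {a : ℕ} [TopologicalSpace X] [ChartedSpace (Euc a) X]
  [IsManifold (𝓡 a) ∞ X] [MulAction G X] [ContMDiffSMul (𝓡 dG) (𝓡 a) ∞ G X]

theorem smul_mem_interior {X : Type*} [TopologicalSpace X] [MulAction G X]
    (hc : ∀ g : G, Continuous fun x : X => g • x) {S : Set X} (hS : ∀ (g : G), ∀ z ∈ S, g • z ∈ S) (g : G) {z : X}
    (hz : z ∈ interior S) : g • z ∈ interior S := by
  have h1 : IsOpen ((fun x : X => g⁻¹ • x) ⁻¹' interior S) := isOpen_interior.preimage (hc g⁻¹)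
  refine mem_interior.2 ⟨_, fun y hy => ?_, h1, ?_⟩
  · have := hS g _ (interior_subset hy)
    rwa [smul_inv_smul] at this
  · change g⁻¹ • g • z ∈ interior S
    rwa [inv_smul_smul]

/-- The differential of an invariant function is invariant. -/
theorem diff_smul_of_invariant {Y : Type*} {b : ℕ} [TopologicalSpace Y] [ChartedSpace (Euc b) Y]
    {y : X → Y} {x : X} {g : G} (hg : ContMDiff (𝓡 a) (𝓡 a) ∞ fun x : X => g • x)
    (hy : MDifferentiableAt (𝓡 a) (𝓡 b) y (g • x))
    (h : ∀ᶠ x' in 𝓝 x, y (g • x') = y x') (v : Euc a) :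
    diff a b y (g • x) (diff a a (fun x : X => g • x) x v) = diff a b y x v := by
  have h1 := diff_comp (f := fun x : X => g • x) (g := y) (x := x) hy
    (contMDiffAt_diffble hg.contMDiffAt)
  have h2 : diff a b (y ∘ fun x : X => g • x) x = diff a b y x := diff_congr h
  rw [h2] at h1
  exact (DFunLike.congr_fun h1 v).symm

/-- Invariant horizontal coframes at `w` are invariant horizontal coframes at `g • w`. -/
theorem HasInvariantCoframe.smul {Z : Type*} [MulAction G Z] {χ : Z → Plane X a}
    (hχ : ∀ (g : G) (z : Z), χ (g • z) = ⟨g • (χ z).base,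
      (χ z).plane.map (diff a a (fun x : X => g • x) (χ z).base).toLinearMap⟩)
    {w : Z} (h : HasInvariantCoframe G k χ w) {g : G}
    (hg : ContMDiff (𝓡 a) (𝓡 a) ∞ fun x : X => g • x) : HasInvariantCoframe G k χ (g • w) := by
  obtain ⟨V, y, hV, hwV, hVinv, hy, hyinv, hu⟩ := h
  have hgV := hVinv g _ hwV
  have hd : ∀ v, diff a k y (g • (χ w).base) (diff a a (fun x : X => g • x) (χ w).base v) =
      diff a k y (χ w).base v := by
    refine diff_smul_of_invariant hg
      ((hy.contMDiffAt (hV.mem_nhds hgV)).mdifferentiableAt (by simp)) ?_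
    filter_upwards [hV.mem_nhds hwV] with x hx using hyinv g x hx
  refine ⟨V, y, hV, by rw [hχ]; exact hgV, hVinv, hy, hyinv, fun u => ?_⟩
  obtain ⟨v, ⟨hv, hvu⟩, huniq⟩ := hu u
  rw [hχ]
  refine ⟨diff a a (fun x : X => g • x) (χ w).base v, ⟨⟨v, hv, rfl⟩, (hd v).trans hvu⟩, ?_⟩
  rintro _ ⟨⟨v', hv', rfl⟩, hv'u⟩
  rw [huniq v' ⟨hv', (hd v').symm.trans hv'u⟩]
  rfl

/-- A horizontal coframe of invariants excludes infinitesimal symmetries in the plane. -/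
theorem HasInvariantCoframe.infAction_eq_zero {Z : Type*} {χ : Z → Plane X a} {w : Z}
    (h : HasInvariantCoframe G k χ w) {ξ : Euc dG}
    (hξ : infAction dG a G (χ w).base ξ ∈ (χ w).plane) : infAction dG a G (χ w).base ξ = 0 := by
  obtain ⟨V, y, hV, hwV, hVinv, hy, hyinv, hu⟩ := h
  have h1 := diff_comp (f := fun g : G => g • (χ w).base) (g := y) (x := (1 : G))
    (d := dG) (e := a) (e' := k)
    (by
      rw [one_smul]
      exact (hy.contMDiffAt (hV.mem_nhds hwV)).mdifferentiableAt (by simp))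
    (contMDiffAt_diffble (contMDiff_orb (dG := dG) _).contMDiffAt)
  have h2 : y ∘ (fun g : G => g • (χ w).base) = fun _ => y (χ w).base :=
    funext fun g => hyinv g _ hwV
  have h3 : diff dG k (y ∘ (fun g : G => g • (χ w).base)) (1 : G) = 0 := by
    rw [h2]
    exact mfderiv_const
  rw [h3, one_smul] at h1
  have h4 : diff a k y (χ w).base (infAction dG a G (χ w).base ξ) = 0 :=
    (DFunLike.congr_fun h1 ξ).symm
  exact (hu 0).unique ⟨hξ, h4⟩ ⟨Submodule.zero_mem _, map_zero _⟩

/-- Submersions are open maps. -/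
theorem isOpen_image_of_submersion {Y : Type*} {b : ℕ} [TopologicalSpace Y] [ChartedSpace (Euc b) Y]
    [IsManifold (𝓡 b) ∞ Y] {f : X → Y} (hf : ∀ x, ContMDiffAt (𝓡 a) (𝓡 b) ∞ f x)
    (hs : ∀ x, Function.Surjective (diff a b f x)) {S : Set X} (hS : IsOpen S) :
    IsOpen (f '' S) := by
  rw [isOpen_iff_mem_nhds]
  rintro _ ⟨x, hx, rfl⟩
  obtain ⟨s, hs0, hs'⟩ := exists_local_section (.of_forall hf) (hs x)
  have hc : ContinuousAt s (f x) := hs'.self_of_nhds.1.continuousAt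
  have h1 : ∀ᶠ y in 𝓝 (f x), s y ∈ S := hc (by rw [hs0]; exact hS.mem_nhds hx)
  filter_upwards [h1, hs'] with y h2 h3
  exact ⟨s y, h2, h3.2⟩

end

variable {s : ℕ} {W : Set (M s)} {m : ℕ}

theorem regularDomain_subset {r : ℕ} {z : M r} (hz : z ∈ regularDomain G k φ W m r) :
    LiesOver φ W r z ∧ LiesOver φ {w : M (m + 1) | HasInvariantCoframe G k (φ m) w} r z :=
  interior_subset (s := {z | LiesOver φ W r z ∧
    LiesOver φ {w : M (m + 1) | HasInvariantCoframe G k (φ m) w} r z}) hz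

theorem regularDomain_le {r : ℕ} {z : M r} (hz : z ∈ regularDomain G k φ W m r) : m + 1 ≤ r :=
  (regularDomain_subset hz).2.le

theorem smul_mem_regularDomain (dG : ℕ) [ChartedSpace (Euc dG) G] [LieGroup (𝓡 dG) ∞ G]
    [∀ r, ContMDiffSMul (𝓡 dG) (𝓡 (d r)) ∞ G (M r)] (hact : IsProlongedAction G φ)
    (hW : ∀ (g : G), ∀ z ∈ W, g • z ∈ W) (r : ℕ) (g : G) (z : M r)
    (hz : z ∈ regularDomain G k φ W m r) : g • z ∈ regularDomain G k φ W m r := by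
  refine smul_mem_interior
    (fun g => (contMDiff_smul_left (d := d r) dG g).continuous) (fun g z hz => ?_) g hz
  exact ⟨hz.1.smul hact hW g, hz.2.smul hact (fun g w hw => hw.smul (hact m)
    (contMDiff_smul_left (d := d m) dG g)) g⟩

/-- Above the order `m`, the regular domains are the preimages of each other. -/
theorem mem_regularDomain_succ (hφ : ∀ r, IsPDESystem (d (r + 1)) k (φ r)) (hs : s ≤ m) {r : ℕ}
    (hr : m + 1 ≤ r) (z : M (r + 1)) :
    z ∈ regularDomain G k φ W m (r + 1) ↔ (φ r z).base ∈ regularDomain G k φ W m r := by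
  have hpre : {z | LiesOver φ W (r + 1) z ∧
      LiesOver φ {w : M (m + 1) | HasInvariantCoframe G k (φ m) w} (r + 1) z} =
      (fun z => (φ r z).base) ⁻¹' {z | LiesOver φ W r z ∧
        LiesOver φ {w : M (m + 1) | HasInvariantCoframe G k (φ m) w} r z} := by
    ext z
    exact and_congr (liesOver_succ_iff (by omega)) (liesOver_succ_iff hr)
  change z ∈ interior _ ↔ (φ r z).base ∈ interior _
  rw [hpre]
  constructor
  -- the interior is not lost under projection, because the projections of the tower are open
  · intro hz
    have ho := isOpen_image_of_submersion (hφ r).contMDiff_base (hφ r).submersion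
      (isOpen_interior (s := (fun z => (φ r z).base) ⁻¹' {z | LiesOver φ W r z ∧
        LiesOver φ {w : M (m + 1) | HasInvariantCoframe G k (φ m) w} r z}))
    refine mem_interior.2 ⟨_, ?_, ho, ⟨z, hz, rfl⟩⟩
    rintro _ ⟨y, hy, rfl⟩
    exact interior_subset (s := (fun z => (φ r z).base) ⁻¹' _) hy
  · intro hz
    exact preimage_interior_subset_interior_preimage (hφ r).continuous_base hz

/-- Infinitesimal symmetries that are tangent to a plane of the tower vanish. At the lowest order
this is due to the horizontal coframe of invariants; above, symmetries are projected to symmetries,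
and integral elements into the planes below. -/
theorem infAction_eq_zero_of_mem_plane (hφ : ∀ r, IsPDESystem (d (r + 1)) k (φ r))
    (hint : ∀ r w, φ (r + 1) w ∈ integralElements k (contactIdeal (d (r + 1)) (φ r)))
    (hact : IsProlongedAction G φ) (hW : ∀ (g : G), ∀ z ∈ W, g • z = z → g = 1) (hs : s ≤ m)
    (j : ℕ) (x : M (m + j + 1)) (hx : x ∈ regularDomain G k φ W m (m + j + 1)) (ξ : Euc dG)
    (hξ : infAction dG (d (m + j)) G (φ (m + j) x).base ξ ∈ (φ (m + j) x).plane) : ξ = 0 := by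
  induction j with
  | zero =>
    have h1 := regularDomain_subset hx
    have h2 : HasInvariantCoframe G k (φ m) x := liesOver_self_iff.1 h1.2
    have h3 := h2.infAction_eq_zero hξ
    have h4 : LiesOver φ W m (φ m x).base := (liesOver_succ_iff hs).1 h1.1
    have h5 := infAction_injective (dG := dG) (d := d m) fun g => h4.free hact hW g
    exact h5 (h3.trans (map_zero _).symm)
  | succ j ih =>
    -- planes of the tower are projected into the planes one order below
    have hx' := (mem_regularDomain_succ hφ hs (r := m + j + 1) (by omega) x).1 hx
    refine ih _ hx' ?_
    have h1 := (hφ (m + j)).le_contactDist ((hint (m + j) x).2 1) hξ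
    rw [mem_contactDist] at h1
    have h2 := diff_infAction_of_equivariant (dG := dG) (f := fun w => (φ (m + j) w).base)
      (hact.base_smul (m + j)) ((hφ (m + j)).contMDiff_base (φ (m + j + 1) x).base) ξ
    exact h2 ▸ h1

/-- Two orbits above `W` lie in the domain of a common frame, or they are separated by disjoint
invariant open sets. -/
theorem exists_frame_or_disjoint [SecondCountableTopology G] {W : Opens (M s)}
    (hφ : ∀ r, IsPDESystem (d (r + 1)) k (φ r)) (hact : IsProlongedAction G φ)
    (hWinv : ∀ (g : G), ∀ z ∈ W, g • z ∈ W) (hfree : ∀ (g : G), ∀ z ∈ W, g • z = z → g = 1)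
    {n₀ : ℕ} [ChartedSpace (Euc n₀) (OrbitSpace G W)] (hW : IsOrbitManifold G W (d s) n₀)
    {r : ℕ} {z w : M r} (hz : LiesOver φ (W : Set (M s)) r z)
    (hw : LiesOver φ (W : Set (M s)) r w) :
    (∃ (O : Set (M r)) (ρ : M r → G), IsFrame G dG (d r) O ρ ∧ z ∈ O ∧ w ∈ O) ∨
      ∃ O O' : Set (M r), IsOpen O ∧ IsOpen O' ∧ (∀ (g : G), ∀ y ∈ O, g • y ∈ O) ∧
        (∀ (g : G), ∀ y ∈ O', g • y ∈ O') ∧ Disjoint O O' ∧ z ∈ O ∧ w ∈ O' := by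
  induction hz with
  | base z hz =>
    -- on `W` points of one orbit have a common frame, and different orbits are separated in the
    -- Hausdorff quotient
    rw [liesOver_self_iff] at hw
    have := hW.isManifold
    have := hW.t2
    have hq := hW.isQuot hWinv ⟨z, hz⟩
    set p := orbitMap G W ⟨z, hz⟩
    have hdim : n₀ + dG = d s := hq.dim_eq hfree hz
    by_cases hzw : p z = p w
    · left
      obtain ⟨O, ρ, hO, -, hzO⟩ := hq.exists_frame hdim hfree hz
      obtain ⟨g, rfl⟩ := (hq.eq_iff z hz w hw).1 hzw
      exact ⟨O, ρ, hO, hzO, hO.smul_mem g z hzO⟩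
    · right
      obtain ⟨A, A', hA, hA', hzA, hwA', hdis⟩ := t2_separation hzw
      have hopen : ∀ A, IsOpen A → IsOpen ((W : Set (M s)) ∩ p ⁻¹' A) := fun A hA =>
        ContinuousOn.isOpen_inter_preimage
          (fun y hy => (hq.smooth y hy).continuousAt.continuousWithinAt) W.isOpen hA
      have hinv : ∀ (A : Set _) (g : G), ∀ y ∈ (W : Set (M s)) ∩ p ⁻¹' A,
          g • y ∈ (W : Set (M s)) ∩ p ⁻¹' A := by
        rintro A g y ⟨hy, hyA⟩
        refine ⟨hWinv g y hy, ?_⟩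
        rw [Set.mem_preimage, hq.smul_eq g hy]
        exact hyA
      refine ⟨_, _, hopen A hA, hopen A' hA', hinv A, hinv A', ?_, ⟨hz, hzA⟩, ⟨hw, hwA'⟩⟩
      exact (hdis.preimage p).mono Set.inter_subset_right Set.inter_subset_right
  | step r z hz ih =>
    -- frames and invariant open sets are pulled back along the equivariant projection
    have hle := hz.le
    rw [liesOver_succ_iff hle] at hw
    have hc := (hφ r).continuous_base
    rcases ih hw with ⟨O, ρ, hO, hzO, hwO⟩ | ⟨O, O', h1, h2, h3, h4, h5, h6, h7⟩
    · left
      refine ⟨(fun z => (φ r z).base) ⁻¹' O, fun z => ρ (φ r z).base, ⟨hO.isOpen.preimage hc, ?_, ?_, ?_⟩,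
        hzO, hwO⟩
      · intro g y hy
        rw [Set.mem_preimage, hact.base_smul]
        exact hO.smul_mem g _ hy
      · intro y hy
        exact ContMDiffAt.comp (I' := 𝓡 (d r)) (g := ρ) y (hO.smooth _ hy)
          ((hφ r).contMDiff_base y)
      · intro g y hy
        rw [hact.base_smul]
        exact hO.equivariant g _ hy
    · right
      refine ⟨_, _, h1.preimage hc, h2.preimage hc, ?_, ?_, h5.preimage _, h6, h7⟩
      · intro g y hy
        rw [Set.mem_preimage, hact.base_smul]
        exact h3 g _ hy
      · intro g y hy
        rw [Set.mem_preimage, hact.base_smul]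
        exact h4 g _ hy

/-- The orbit spaces of the regular domains are Hausdorff manifolds. -/
theorem exists_isOrbitManifold_regularDomain [SecondCountableTopology G] [∀ r, T2Space (M r)]
    {W : Opens (M s)}
    (hφ : ∀ r, IsPDESystem (d (r + 1)) k (φ r)) (hact : IsProlongedAction G φ)
    (hWinv : ∀ (g : G), ∀ z ∈ W, g • z ∈ W) (hfree : ∀ (g : G), ∀ z ∈ W, g • z = z → g = 1)
    {n₀ : ℕ} [ChartedSpace (Euc n₀) (OrbitSpace G W)] (hW : IsOrbitManifold G W (d s) n₀) (r : ℕ) :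
    ∃ _ : ChartedSpace (Euc (d r - dG)) (OrbitSpace G (regularDomain G k φ (W : Set (M s)) m r)),
      IsOrbitManifold G (regularDomain G k φ (W : Set (M s)) m r) (d r) (d r - dG) := by
  have hinv := smul_mem_regularDomain (k := k) (m := m) dG hact hWinv r
  refine exists_isOrbitManifold (dG := dG) hinv fun z hz w hw => ?_
  rcases exists_frame_or_disjoint (dG := dG) hφ hact hWinv hfree hW (regularDomain_subset hz).1
    (regularDomain_subset hw).1 with ⟨O, ρ, hO, hzO, hwO⟩ | h
  · left
    refine ⟨O ∩ regularDomain G k φ (W : Set (M s)) m r, ρ, ⟨hO.isOpen.inter (Opens.isOpen _),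
      fun g y hy => ⟨hO.smul_mem g y hy.1, hinv g y hy.2⟩, fun y hy => hO.smooth y hy.1,
      fun g y hy => hO.equivariant g y hy.1⟩, Set.inter_subset_right, ⟨hzO, hz⟩, ⟨hwO, hw⟩⟩
  · exact Or.inr h

end Tower

/-! ### Reduction of a tower -/

section OrbitMap

variable {G : Type*} {dG : ℕ} [Group G] [TopologicalSpace G] [ChartedSpace (Euc dG) G]
  [LieGroup (𝓡 dG) ∞ G]
variable {X : Type*} {a : ℕ} [TopologicalSpace X] [ChartedSpace (Euc a) X]
  [IsManifold (𝓡 a) ∞ X] [MulAction G X]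
variable {U : Opens X} {n : ℕ} [ChartedSpace (Euc n) (OrbitSpace G U)]

/-- For a plane at a point of `U`, the image under the extended projection is `pushPlane`. -/
theorem mapPlane_orbitMap (h : IsOrbitManifold G U a n) (u₀ z : U) (P : Submodule ℝ (Euc a)) :
    mapPlane a n (orbitMap G U u₀) ⟨(z : X), P⟩ = pushPlane z P := by
  have := h.isManifold
  refine Plane.ext (orbitMap_of_mem u₀ z.2) ?_
  change P.map (diff a n (orbitMap G U u₀) z).toLinearMap = P.map (diff a n (toOrbit G U) z).toLinearMap
  rw [diff_orbitMap h]

/-- The largest ideal for the extended projection is the reduced ideal. -/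
theorem quotIdeal_orbitMap (h : IsOrbitManifold G U a n) (u₀ : U) (J : X → GradedIdeal a) :
    quotIdeal a n (U : Set X) (orbitMap G U u₀) J = reducedIdeal G U n J := by
  have := h.isManifold
  funext b
  ext m η
  constructor
  · intro hη z hz
    have := hη z z.2 ((orbitMap_of_mem u₀ z.2).trans hz)
    rwa [diff_orbitMap h] at this
  · intro hη z hz hzb
    have := hη ⟨z, hz⟩ ((orbitMap_of_mem u₀ hz).symm.trans hzb)
    rwa [← diff_orbitMap h u₀] at this

/-- Translates of a plane have the same image in the orbit space. -/
theorem pushPlane_smul (h : IsOrbitManifold G U a n) (hU : ∀ (g : G), ∀ z ∈ U, g • z ∈ U) (z : U)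
    {g : G} (hg : ContMDiff (𝓡 a) (𝓡 a) ∞ fun x : X => g • x) (P : Submodule ℝ (Euc a)) :
    pushPlane (G := G) (n := n) (⟨g • (z : X), hU g z z.2⟩ : U)
      (P.map (diff a a (fun x : X => g • x) (z : X)).toLinearMap) = pushPlane z P := by
  have := h.isManifold
  have hq := h.isQuot hU z
  rw [← mapPlane_orbitMap h z, ← mapPlane_orbitMap h z]
  refine Plane.ext (hq.smul_eq g z.2) ?_
  change (P.map (diff a a (fun x : X => g • x) (z : X)).toLinearMap).map
    (diff a n (orbitMap G U z) (g • (z : X))).toLinearMap = P.map (diff a n (orbitMap G U z) z).toLinearMap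
  rw [← Submodule.map_comp]
  congr 1
  ext1 v
  refine diff_smul_of_invariant hg
    (contMDiffAt_diffble (hq.smooth _ (hU g z z.2))) ?_ v
  filter_upwards [hq.eventually_mem z.2] with x hx using hq.smul_eq g hx

end OrbitMap

section Empty

variable {B B' : Type*} {n n' : ℕ} [TopologicalSpace B] [ChartedSpace (Euc n) B]
  [TopologicalSpace B'] [ChartedSpace (Euc n') B'] {k : ℕ}

/-- The degenerate case of an empty regular domain has to be treated separately, because the
extension of the projection to `M` by a constant requires a point of the domain. -/
theorem isPDESystem_of_isEmpty [IsEmpty B] [IsEmpty B'] (ψ : B' → Plane B n) :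
    IsPDESystem n' k ψ where
  finrank_eq := isEmptyElim
  isEmbedding := ⟨⟨Subsingleton.elim _ _⟩, Function.injective_of_subsingleton _⟩
  smooth := isEmptyElim
  immersion := isEmptyElim
  surjective := isEmptyElim
  submersion := isEmptyElim

theorem isProlongation_of_isEmpty [IsEmpty B] [IsEmpty B'] (J : B → GradedIdeal n)
    (ψ : B' → Plane B n) : IsProlongation n' k J ψ where
  toIsPDESystem := isPDESystem_of_isEmpty ψ
  integral := isEmptyElim
  removed_closed := ⟨∅, isClosed_empty, Set.ext fun Q => isEmptyElim Q.base⟩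

end Empty

section TowerReduction

variable {G : Type*} [Group G] [TopologicalSpace G]
variable {M : ℕ → Type*} {d : ℕ → ℕ} [∀ r, TopologicalSpace (M r)]
  [∀ r, ChartedSpace (Euc (d r)) (M r)] [∀ r, IsManifold (𝓡 (d r)) ∞ (M r)]
  [∀ r, MulAction G (M r)]
  {φ : ∀ r, M (r + 1) → Plane (M r) (d r)} {k : ℕ} {s m : ℕ} {W : Opens (M s)}
  {n : ℕ → ℕ}
  [∀ r, ChartedSpace (Euc (n r)) (OrbitSpace G (regularDomain G k φ (W : Set (M s)) m r))]

/-- The planes of the tower induce planes of the orbit spaces. -/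
theorem exists_isInduced (dG : ℕ) [ChartedSpace (Euc dG) G] [LieGroup (𝓡 dG) ∞ G]
    [∀ r, ContMDiffSMul (𝓡 dG) (𝓡 (d r)) ∞ G (M r)]
    (hφ : ∀ r, IsPDESystem (d (r + 1)) k (φ r)) (hact : IsProlongedAction G φ)
    (hWinv : ∀ (g : G), ∀ z ∈ W, g • z ∈ W) (hs : s ≤ m)
    (hO : ∀ r, IsOrbitManifold G (regularDomain G k φ (W : Set (M s)) m r) (d r) (n r))
    {r : ℕ} (hr : m + 1 ≤ r) :
    ∃ ψ : OrbitSpace G (regularDomain G k φ (W : Set (M s)) m (r + 1)) →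
      Plane (OrbitSpace G (regularDomain G k φ (W : Set (M s)) m r)) (n r), IsInduced (φ r) ψ := by
  have hmem := fun w : regularDomain G k φ (W : Set (M s)) m (r + 1) =>
    (mem_regularDomain_succ hφ hs hr (w : M (r + 1))).1 w.2
  have hinv := smul_mem_regularDomain (k := k) (m := m) dG hact hWinv r
  obtain ⟨c, hc⟩ := (toOrbit_surjective (G := G)
    (U := regularDomain G k φ (W : Set (M s)) m (r + 1))).hasRightInverse
  refine ⟨fun b => pushPlane ⟨_, hmem (c b)⟩ (φ r (c b)).plane, fun w => ⟨hmem w, ?_⟩⟩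
  have h1 := hc (toOrbit G _ w)
  obtain ⟨g, hg⟩ := toOrbit_eq_iff.1 h1.symm
  have h2 := pushPlane_smul (hO r) hinv ⟨_, hmem w⟩ (contMDiff_smul_left (d := d r) dG g)
    (φ r w).plane
  refine Eq.trans ?_ h2
  have h3 : φ r (c (toOrbit G _ w)) = ⟨g • (φ r w).base,
    (φ r w).plane.map (diff (d r) (d r) (fun x : M r => g • x) (φ r w).base).toLinearMap⟩ := by
    rw [← hact r g w, hg]
  have h4 : ∀ (Q : Plane (M r) (d r)) (hQ : Q.base ∈ regularDomain G k φ (W : Set (M s)) m r)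
      (Q' : Plane (M r) (d r)) (hQ' : Q'.base ∈ regularDomain G k φ (W : Set (M s)) m r), Q = Q' →
      pushPlane (G := G) (n := n r) ⟨Q.base, hQ⟩ Q.plane = pushPlane ⟨Q'.base, hQ'⟩ Q'.plane := by
    rintro Q hQ Q' hQ' rfl
    rfl
  exact h4 _ _ _ (hinv g _ (hmem w)) h3

theorem free_regularDomain (hact : IsProlongedAction G φ)
    (hfree : ∀ (g : G), ∀ z ∈ W, g • z = z → g = 1) {r : ℕ} (g : G) (z : M r)
    (hz : z ∈ regularDomain G k φ (W : Set (M s)) m r) : g • z = z → g = 1 :=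
  (regularDomain_subset hz).1.free hact hfree g

/-- The dimension of the orbit space of a non-empty regular domain. -/
theorem dim_regularDomain (dG : ℕ) [ChartedSpace (Euc dG) G] [LieGroup (𝓡 dG) ∞ G]
    [∀ r, ContMDiffSMul (𝓡 dG) (𝓡 (d r)) ∞ G (M r)] [SecondCountableTopology G]
    (hact : IsProlongedAction G φ)
    (hWinv : ∀ (g : G), ∀ z ∈ W, g • z ∈ W) (hfree : ∀ (g : G), ∀ z ∈ W, g • z = z → g = 1)
    (hO : ∀ r, IsOrbitManifold G (regularDomain G k φ (W : Set (M s)) m r) (d r) (n r)) {r : ℕ}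
    (u : regularDomain G k φ (W : Set (M s)) m r) : n r + dG = d r := by
  have := (hO r).isManifold
  exact ((hO r).isQuot (smul_mem_regularDomain dG hact hWinv r) u).dim_eq
    (fun g z hz => free_regularDomain hact hfree g z hz) u.2

/-- Consecutive members of the tower above the order `m` and their orbit spaces form a reduction. -/
theorem isReduction_regularDomain (dG : ℕ) [ChartedSpace (Euc dG) G] [LieGroup (𝓡 dG) ∞ G]
    [∀ r, ContMDiffSMul (𝓡 dG) (𝓡 (d r)) ∞ G (M r)] [SecondCountableTopology G]
    (hφ : ∀ r, IsPDESystem (d (r + 1)) k (φ r))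
    (hint : ∀ r w, φ (r + 1) w ∈ integralElements k (contactIdeal (d (r + 1)) (φ r)))
    (hact : IsProlongedAction G φ)
    (hWinv : ∀ (g : G), ∀ z ∈ W, g • z ∈ W) (hfree : ∀ (g : G), ∀ z ∈ W, g • z = z → g = 1)
    (hs : s ≤ m)
    (hO : ∀ r, IsOrbitManifold G (regularDomain G k φ (W : Set (M s)) m r) (d r) (n r))
    {j : ℕ} (hj : m ≤ j) (u : regularDomain G k φ (W : Set (M s)) m (j + 1))
    (u' : regularDomain G k φ (W : Set (M s)) m (j + 2))
    {ψ : OrbitSpace G (regularDomain G k φ (W : Set (M s)) m (j + 2)) →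
      Plane (OrbitSpace G (regularDomain G k φ (W : Set (M s)) m (j + 1))) (n (j + 1))}
    (hψ : IsInduced (φ (j + 1)) ψ) :
    IsReduction G k (φ j) (φ (j + 1)) (regularDomain G k φ (W : Set (M s)) m (j + 1))
      (orbitMap G _ u) (regularDomain G k φ (W : Set (M s)) m (j + 2)) (orbitMap G _ u') ψ
      (n (j + 2)) (d (j + 2)) := by
  have hman := fun r => (hO r).isManifold
  have hq := (hO (j + 1)).isQuot (smul_mem_regularDomain dG hact hWinv _) u
  refine ⟨hφ j, hφ (j + 1), hact (j + 1), hint j, hq,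
    (hO (j + 2)).isQuot (smul_mem_regularDomain dG hact hWinv _) u',
    mem_regularDomain_succ hφ hs (by omega), ?_, ?_⟩
  · intro x hx v hv h0
    obtain ⟨ξ, rfl⟩ := hq.exists_infAction (dim_regularDomain dG hact hWinv hfree hO u) hx
      (fun g => free_regularDomain hact hfree g x hx) h0
    obtain ⟨i, rfl⟩ := Nat.exists_eq_add_of_le hj
    rw [mem_contactDist, diff_infAction_of_equivariant (dG := dG) (f := fun w => (φ (m + i) w).base)
      (hact.base_smul (m + i)) ((hφ (m + i)).contMDiff_base x) ξ] at hv
    rw [infAction_eq_zero_of_mem_plane hφ hint hact hfree hs i x hx ξ hv, map_zero]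
  · intro w hw
    obtain ⟨h1, h2⟩ := hψ ⟨w, hw⟩
    rw [orbitMap_of_mem u' hw, h2]
    exact (mapPlane_orbitMap (hO (j + 1)) u ⟨_, h1⟩ _).symm

theorem isEmpty_orbitSpace {X : Type*} [TopologicalSpace X] [MulAction G X] {U : Opens X}
    (h : IsEmpty U) : IsEmpty (OrbitSpace G U) :=
  ⟨fun b => by obtain ⟨z, -⟩ := toOrbit_surjective b; exact h.elim z⟩

/-- As the projections of the tower are surjective, an empty regular domain can only lie over an
empty one. -/
theorem isEmpty_regularDomain (hφ : ∀ r, IsPDESystem (d (r + 1)) k (φ r)) (hs : s ≤ m)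
    {r : ℕ} (hr : m + 1 ≤ r)
    (h : IsEmpty (regularDomain G k φ (W : Set (M s)) m (r + 1))) :
    IsEmpty (regularDomain G k φ (W : Set (M s)) m r) := by
  refine ⟨fun u => ?_⟩
  obtain ⟨w, hw⟩ := (hφ r).surjective (u : M r)
  have hw' : (φ r w).base = u := hw
  exact h.elim ⟨w, (mem_regularDomain_succ hφ hs hr w).2 (by rw [hw']; exact u.2)⟩

/-- The orbit space of the order `j + 2` is a PDE system on the orbit space of the order `j + 1`,
and its contact ideal is the reduced ideal. -/
theorem reduced_isPDESystem (dG : ℕ) [ChartedSpace (Euc dG) G] [LieGroup (𝓡 dG) ∞ G]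
    [∀ r, ContMDiffSMul (𝓡 dG) (𝓡 (d r)) ∞ G (M r)] [SecondCountableTopology G]
    (hφ : ∀ r, IsPDESystem (d (r + 1)) k (φ r))
    (hint : ∀ r w, φ (r + 1) w ∈ integralElements k (contactIdeal (d (r + 1)) (φ r)))
    (hact : IsProlongedAction G φ)
    (hWinv : ∀ (g : G), ∀ z ∈ W, g • z ∈ W) (hfree : ∀ (g : G), ∀ z ∈ W, g • z = z → g = 1)
    (hs : s ≤ m)
    (hO : ∀ r, IsOrbitManifold G (regularDomain G k φ (W : Set (M s)) m r) (d r) (n r))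
    {j : ℕ} (hj : m ≤ j)
    {ψ : OrbitSpace G (regularDomain G k φ (W : Set (M s)) m (j + 2)) →
      Plane (OrbitSpace G (regularDomain G k φ (W : Set (M s)) m (j + 1))) (n (j + 1))}
    (hψ : IsInduced (φ (j + 1)) ψ) :
    IsPDESystem (n (j + 2)) k ψ ∧
    reducedIdeal G (regularDomain G k φ (W : Set (M s)) m (j + 2)) (n (j + 2))
      (contactIdeal (d (j + 2)) (φ (j + 1))) = contactIdeal (n (j + 2)) ψ := by
  rcases isEmpty_or_nonempty (regularDomain G k φ (W : Set (M s)) m (j + 2)) with he | ⟨⟨u'⟩⟩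
  · have := isEmpty_orbitSpace (G := G) he
    have := isEmpty_orbitSpace (G := G) (isEmpty_regularDomain hφ hs (by omega) he)
    exact ⟨isPDESystem_of_isEmpty ψ, funext isEmptyElim⟩
  · have u : regularDomain G k φ (W : Set (M s)) m (j + 1) :=
      ⟨_, (mem_regularDomain_succ hφ hs (by omega) (u' : M (j + 2))).1 u'.2⟩
    have hman := fun r => (hO r).isManifold
    have h := isReduction_regularDomain dG hφ hint hact hWinv hfree hs hO hj u u' hψ
    have hdim := dim_regularDomain dG hact hWinv hfree hO u
    have hf := fun (g : G) (z : M (j + 1)) => free_regularDomain (k := k) (m := m) hact hfree g z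
    have h1 := h.isPDESystem hdim hf
    refine ⟨h1, ?_⟩
    rw [← quotIdeal_orbitMap (hO (j + 2)) u']
    exact h.quotIdeal_eq h1 hdim hf

/-- The orbit space of the order `j + 3` is the prolongation of that of the order `j + 2`. -/
theorem reduced_isProlongation (dG : ℕ) [ChartedSpace (Euc dG) G] [LieGroup (𝓡 dG) ∞ G]
    [∀ r, ContMDiffSMul (𝓡 dG) (𝓡 (d r)) ∞ G (M r)] [SecondCountableTopology G]
    (hφ : ∀ r, IsPDESystem (d (r + 1)) k (φ r))
    (hpr : ∀ r, IsProlongation (d (r + 2)) k (contactIdeal (d (r + 1)) (φ r)) (φ (r + 1)))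
    (hact : IsProlongedAction G φ)
    (hWinv : ∀ (g : G), ∀ z ∈ W, g • z ∈ W) (hfree : ∀ (g : G), ∀ z ∈ W, g • z = z → g = 1)
    (hs : s ≤ m)
    (hO : ∀ r, IsOrbitManifold G (regularDomain G k φ (W : Set (M s)) m r) (d r) (n r))
    {j : ℕ} (hj : m ≤ j)
    {ψ : OrbitSpace G (regularDomain G k φ (W : Set (M s)) m (j + 2)) →
      Plane (OrbitSpace G (regularDomain G k φ (W : Set (M s)) m (j + 1))) (n (j + 1))}
    (hψ : IsInduced (φ (j + 1)) ψ)
    {ψ₂ : OrbitSpace G (regularDomain G k φ (W : Set (M s)) m (j + 3)) →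
      Plane (OrbitSpace G (regularDomain G k φ (W : Set (M s)) m (j + 2))) (n (j + 2))}
    (hψ₂ : IsInduced (φ (j + 2)) ψ₂) :
    IsProlongation (n (j + 3)) k (contactIdeal (n (j + 2)) ψ) ψ₂ ∧
    removed k (contactIdeal (n (j + 2)) ψ) ψ₂ =
      {Q | ∃ (z : regularDomain G k φ (W : Set (M s)) m (j + 2)) (P : Submodule ℝ (Euc (d (j + 2)))),
        (⟨z, P⟩ : Plane (M (j + 2)) (d (j + 2))) ∈
          removed k (contactIdeal (d (j + 2)) (φ (j + 1))) (φ (j + 2)) ∧ Q = pushPlane z P} := by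
  have hint := fun r => (hpr r).integral
  rcases isEmpty_or_nonempty (regularDomain G k φ (W : Set (M s)) m (j + 3)) with he | ⟨⟨u₂⟩⟩
  · have := isEmpty_orbitSpace (G := G) he
    have := isEmpty_orbitSpace (G := G) (isEmpty_regularDomain hφ hs (by omega) he)
    exact ⟨isProlongation_of_isEmpty _ _, Set.ext fun Q => isEmptyElim Q.base⟩
  · have u' : regularDomain G k φ (W : Set (M s)) m (j + 2) :=
      ⟨_, (mem_regularDomain_succ hφ hs (by omega) (u₂ : M (j + 3))).1 u₂.2⟩
    have u : regularDomain G k φ (W : Set (M s)) m (j + 1) :=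
      ⟨_, (mem_regularDomain_succ hφ hs (by omega) (u' : M (j + 2))).1 u'.2⟩
    have hman := fun r => (hO r).isManifold
    have h := isReduction_regularDomain dG hφ hint hact hWinv hfree hs hO hj u u' hψ
    have h₂ := isReduction_regularDomain dG (j := j + 1) hφ hint hact hWinv hfree hs hO (by omega) u'
      u₂ hψ₂
    have hdim := dim_regularDomain dG hact hWinv hfree hO u
    have hf := fun (g : G) (z : M (j + 1)) => free_regularDomain (k := k) (m := m) hact hfree g z
    have h1 := (reduced_isPDESystem dG hφ hint hact hWinv hfree hs hO hj hψ).1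
    have h2 := (reduced_isPDESystem dG (j := j + 1) hφ hint hact hWinv hfree hs hO (by omega) hψ₂).1
    refine ⟨h.isProlongation h₂ h1 h2 (hpr (j + 1)) hdim hf, ?_⟩
    rw [h.removed_eq h₂ h1 hdim hf]
    ext Q
    constructor
    · rintro ⟨w, hw, P, hP, rfl⟩
      exact ⟨⟨w, hw⟩, P, hP, mapPlane_orbitMap (hO (j + 2)) u' ⟨w, hw⟩ P⟩
    · rintro ⟨z, P, hP, rfl⟩
      exact ⟨z, z.2, P, hP, (mapPlane_orbitMap (hO (j + 2)) u' z P).symm⟩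

end TowerReduction

end EDS

end

theorem mainTheorem1
    {G : Type*} {dG : ℕ} [Group G] [TopologicalSpace G] [ChartedSpace (Euc dG) G]
    [LieGroup (𝓡 dG) ∞ G] [SecondCountableTopology G]
    -- the manifolds of the prolongation tower, with smooth actions of `G`
    {M : ℕ → Type*} {d : ℕ → ℕ} [∀ r, TopologicalSpace (M r)] [∀ r, T2Space (M r)]
    [∀ r, ChartedSpace (Euc (d r)) (M r)] [∀ r, IsManifold (𝓡 (d r)) ∞ (M r)]
    [∀ r, MulAction G (M r)] [∀ r, ContMDiffSMul (𝓡 dG) (𝓡 (d r)) ∞ G (M r)]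
    -- a `G`-invariant exterior differential system of infinite type and its prolongations
    (k : ℕ) (J₀ : M 0 → GradedIdeal (d 0)) (hJ₀ : IsEDS J₀)
    (hinv : ∀ (g : G) (x : M 0) (n : ℕ) (η : AltForm (d 0) n), η ∈ (J₀ (g • x)).deg n ↔
      η.compContinuousLinearMap (diff (d 0) (d 0) (fun x : M 0 => g • x) x) ∈ (J₀ x).deg n)
    (φ : ∀ r, M (r + 1) → Plane (M r) (d r)) (hφ : IsTower k J₀ φ)
    (hact : IsProlongedAction G φ) (htype : ∀ r, 1 < r → d (r - 1) < d r)
    -- the action is free on the open conull set `W` of the order `rs`, with a manifold quotient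
    (rs : ℕ) (W : Opens (M rs)) (hWnull : IsNull (d rs) (W : Set (M rs))ᶜ)
    (hWinv : ∀ (g : G), ∀ z ∈ W, g • z ∈ W) (hfree : ∀ (g : G), ∀ z ∈ W, g • z = z → g = 1)
    {n₀ : ℕ} [ChartedSpace (Euc n₀) (OrbitSpace G W)] (hW : IsOrbitManifold G W (d rs) n₀)
    -- horizontal invariant coframes appear at the order `rcf`
    (rcf : ℕ) (hcf : ∀ s, rcf ≤ s →
      IsNull (d (s + 1)) {w : M (s + 1) | ¬ HasInvariantCoframe G k (φ s) w}) :
    let U : ∀ r, Opens (M r) := regularDomain G k φ (W : Set (M rs)) (max rs rcf)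
    let J : ∀ r, M r → GradedIdeal (d r) := towerIdeal J₀ φ
    ∃ (n : ℕ → ℕ) (_ : ∀ r, ChartedSpace (Euc (n r)) (OrbitSpace G (U r))),
      (∀ r, IsOrbitManifold G (U r) (d r) (n r)) ∧
      ∃ ro ≤ max rs rcf + 2,
        -- prolongation commutes with reduction
        (∀ r, ro ≤ r → ∃ ψ : OrbitSpace G (U (r + 1)) → Plane (OrbitSpace G (U r)) (n r),
          IsInduced (φ r) ψ ∧
          IsProlongation (n (r + 1)) k (reducedIdeal G (U r) (n r) (J r)) ψ ∧
          removed k (reducedIdeal G (U r) (n r) (J r)) ψ =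
            {Q | ∃ (z : U r) (P : Submodule ℝ (Euc (d r))),
              (⟨z, P⟩ : Plane (M r) (d r)) ∈ removed k (J r) (φ r) ∧ Q = pushPlane z P} ∧
          reducedIdeal G (U (r + 1)) (n (r + 1)) (J (r + 1)) = contactIdeal (n (r + 1)) ψ) ∧
        -- the reduced systems are syzygy systems and their prolongations
        (∀ r, ro ≤ r + 1 → ∃ ψ : OrbitSpace G (U (r + 1)) → Plane (OrbitSpace G (U r)) (n r),
          IsInduced (φ r) ψ ∧ IsPDESystem (n (r + 1)) k ψ ∧
          reducedIdeal G (U (r + 1)) (n (r + 1)) (J (r + 1)) = contactIdeal (n (r + 1)) ψ ∧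
          ∃ ψ' : OrbitSpace G (U (r + 2)) → Plane (OrbitSpace G (U (r + 1))) (n (r + 1)),
            IsInduced (φ (r + 1)) ψ' ∧ IsProlongation (n (r + 2)) k (contactIdeal (n (r + 1)) ψ) ψ' ∧
            reducedIdeal G (U (r + 2)) (n (r + 2)) (J (r + 2)) = contactIdeal (n (r + 2)) ψ') := by
  have hφ' : ∀ r, IsPDESystem (d (r + 1)) k (φ r) := fun r => (hφ r).toIsPDESystem
  have hpr : ∀ r, IsProlongation (d (r + 2)) k (contactIdeal (d (r + 1)) (φ r)) (φ (r + 1)) :=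
    fun r => hφ (r + 1)
  have hs : rs ≤ max rs rcf := le_max_left _ _
  intro U J
  choose C hC using fun r => exists_isOrbitManifold_regularDomain (dG := dG) (k := k) (m := max rs rcf)
    hφ' hact hWinv hfree hW r
  choose ψ hψ using fun (r : ℕ) (hr : max rs rcf + 1 ≤ r) =>
    exists_isInduced dG hφ' hact hWinv hs hC hr
  -- the difference `d r - dG` is truncated only for orders with an empty regular domain
  refine ⟨fun r => d r - dG, C, hC, max rs rcf + 2, le_rfl, fun r hr => ?_, fun r hr => ?_⟩
  · obtain ⟨j, rfl⟩ : ∃ j, r = j + 2 := ⟨r - 2, by omega⟩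
    have hj : max rs rcf ≤ j := by omega
    have h1 := reduced_isPDESystem dG hφ' (fun r => (hpr r).integral) hact hWinv hfree hs hC hj
      (hψ (j + 1) (by omega))
    have h2 := reduced_isPDESystem dG (j := j + 1) hφ' (fun r => (hpr r).integral) hact hWinv hfree hs
      hC (by omega) (hψ (j + 2) (by omega))
    have h3 := reduced_isProlongation dG hφ' hpr hact hWinv hfree hs hC hj (hψ (j + 1) (by omega))
      (hψ (j + 2) (by omega))
    refine ⟨ψ (j + 2) (by omega), hψ (j + 2) (by omega), ?_, ?_, h2.2⟩
    · exact h1.2 ▸ h3.1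
    · exact h1.2 ▸ h3.2
  · obtain ⟨j, rfl⟩ : ∃ j, r = j + 1 := ⟨r - 1, by omega⟩
    have hj : max rs rcf ≤ j := by omega
    have h1 := reduced_isPDESystem dG hφ' (fun r => (hpr r).integral) hact hWinv hfree hs hC hj
      (hψ (j + 1) (by omega))
    have h2 := reduced_isPDESystem dG (j := j + 1) hφ' (fun r => (hpr r).integral) hact hWinv hfree hs
      hC (by omega) (hψ (j + 2) (by omega))
    have h3 := reduced_isProlongation dG hφ' hpr hact hWinv hfree hs hC hj (hψ (j + 1) (by omega))
      (hψ (j + 2) (by omega))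
    exact ⟨ψ (j + 1) (by omega), hψ (j + 1) (by omega), h1.1, h1.2, ψ (j + 2) (by omega), hψ (j + 2) (by omega), h3.1,
      h2.2⟩
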